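/- Let $k$ be an algebraically closed field of characteristic $0$, let $n\ge 1$, and let $r\in k\setminus\{0,1\}$ and $p_{ij}\in k\setminus\{0\}$ $(1\le i<j\le n)$. Put $\kappa^i_j=p_{ij}$ if $i<j$, $\kappa^i_i=r$, and $\kappa^i_j=r/p_{ji}$ if $i>j$; let $R_{ij}^{ab}=\kappa^i_j$ if $i=b,\ j=a$; $R_{ij}^{ab}=r-1$ if $i=a,\ j=b,\ i>j$; and $R_{ij}^{ab}=0$ otherwise. Let $A(R_Q)$ be the FRT bialgebra: the algebra generated by $T_i^j$ $(1\le i,j\le n)$ with relations $\sum_{c,d} R_{ij}^{cd}T_c^aT_d^b=\sum_{c,d} T_i^cT_j^dR_{cd}^{ab}$ and with $\Delta(T_i^j)=\sum_c T_i^c\otimes T_c^j$, $\varepsilon(T_i^j)=\delta_{ij}$. In the convolution algebra $A(R_Q)^*$ let $K_i$ be the algebra map $A(R_Q)\to k$ with $K_i(T_j^l)=\delta_{jl}\kappa^i_j$, and for $1\le i\le n-1$ let $E^i_{i+1}$ be the functional with $E^i_{i+1}(T_a^b)=\delta_{a,i}\delta_{b,i+1}$ and $E^i_{i+1}(uv)=K_{i+1}(u)E^i_{i+1}(v)+E^i_{i+1}(u)K_i(v)$.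 Let $B^l\subset A(R_Q)^*$ be the subalgebra generated by all $K_j^{\pm1}$ and $E^i_{i+1}$; it is a Hopf algebra with comultiplication dual to the multiplication of $A(R_Q)$, so that the $K_j$ are group-like and $\Delta(E^i_{i+1})=K_{i+1}\otimes E^i_{i+1}+E^i_{i+1}\otimes K_i$. Let $\mathrm{gr}\,B^l$ be the graded Hopf algebra associated with the filtration $H_0=kG(B^l)$, $H_{s+1}=\Delta^{-1}(H_0\otimes B^l+B^l\otimes H_s)$, and let $\pi:\mathrm{gr}\,B^l\to kG(B^l)$ be the projection onto degree $0$. Let $R=\{x:(\mathrm{id}\otimes\pi)\Delta(x)=x\otimes 1\}$, with coaction $\rho=(\pi\otimes\mathrm{id})\Delta$, adjoint action $h\cdot x=\sum h_1xS(h_2)$, braiding $c(v\otimes w)=\sum(v_{-1}\cdot w)\otimes v_0$, and comultiplication $\Delta_R=(\Pi\otimes\mathrm{id})\Delta$, where $\Pi=\mathrm{id}*(S\circ\pi)$; let $P(R)=\{x\in R:\Delta_R(x)=x\otimes1+1\otimes x\}$. Let $x_i\in\mathrm{gr}\,B^l$ be the class of $E^i_{i+1}K_i^{-1}$ in degree $1$,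 $V=\mathrm{span}_k\{x_1,\dots,x_{n-1}\}$, $\overline{K_i}=K_i^{-1}K_{i+1}$, and let $SLG$ be the group generated by $\overline{K_1},\dots,\overline{K_{n-1}}$. Let $B(V)$ be the subalgebra of $\mathrm{gr}\,B^l$ generated by $V$, and $B(V)\#kSLG$ the subalgebra generated by $V$ and $SLG$. Then: 1. $B^l$ is pointed (so the filtration above is its coradical filtration). 2. $x_1,\dots,x_{n-1}$ are linearly independent, $V\subseteq P(R)$, $\rho(x_i)=\overline{K_i}\otimes x_i$, and $V$ is stable under the adjoint action of $kSLG$; so $V$ is a Yetter–Drinfeld module over $kSLG$. 3. $B(V)\#kSLG$ is a Hopf subalgebra of $\mathrm{gr}\,B^l$, and multiplication is a linear isomorphism from $B(V)\otimes kSLG$ onto it. Its intersection with $R$ is $B(V)$, and $B(V)\cap P(R)=V$. 4. The braiding of $V$ is of Cartan type $A_{n-1}$: there are scalars $l_{ij}\in k$ $(1\le i,j\le n-1)$ with $c(x_i\otimes x_j)=l_{ij}\,x_j\otimes x_i$, $l_{ii}=r^{-1}$, and $$l_{ij}l_{ji}=\begin{cases} r^{-2}& i=j,\\ r& |i-j|=1,\\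 1& |i-j|\ge 2.\end{cases}$$ If $(a_{ij})$ denotes the Cartan matrix of type $A_{n-1}$, then $l_{ij}l_{ji}=l_{ii}^{a_{ij}}$ for all $i,j$. In particular the braiding is of Cartan-FL-type with matrix $(a_{ij})$: $(a_{ij})$ is a generalized Cartan matrix, and there are $q\in k\setminus\{0,1\}$ and positive integers $d_i$ with $d_ia_{ij}=d_ja_{ji}$ and $l_{ij}l_{ji}=q^{d_ia_{ij}}$ for all $i,j$. -/

import Mathlib

open scoped TensorProduct

noncomputable section

namespace QuantumGL

/-! ### Linear algebra over a field -/

section LinAlg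

variable {k : Type*} [Field k]

lemma eq_zero_of_map_left {ι M N : Type*} {X : ι → Type*} [AddCommGroup M] [Module k M]
    [AddCommGroup N] [Module k N] [∀ i, AddCommGroup (X i)] [∀ i, Module k (X i)]
    (p : ∀ i, M →ₗ[k] X i) (hp : ∀ m, (∀ i, p i m = 0) → m = 0)
    (t : M ⊗[k] N) (ht : ∀ i, (p i).rTensor N t = 0) : t = 0 := by
  classical
  let b := Module.Basis.ofVectorSpace k N
  apply (TensorProduct.equivFinsuppOfBasisRight (M := M) b).injective
  rw [map_zero]
  ext j
  apply hp
  intro i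
  have key : ∀ s : M ⊗[k] N, TensorProduct.equivFinsuppOfBasisRight b ((p i).rTensor N s) j
      = p i (TensorProduct.equivFinsuppOfBasisRight b s j) := by
    intro s
    induction s with
    | zero => simp
    | tmul x y =>
      simp only [LinearMap.rTensor_tmul,
        TensorProduct.equivFinsuppOfBasisRight_apply_tmul_apply, map_smul]
    | add x y hx hy => simp only [map_add, Finsupp.add_apply, hx, hy]
  rw [← key, ht i]
  simp

lemma eq_zero_of_map_right {ι M N : Type*} {X : ι → Type*} [AddCommGroup M] [Module k M]
    [AddCommGroup N] [Module k N] [∀ i, AddCommGroup (X i)] [∀ i, Module k (X i)]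
    (p : ∀ i, N →ₗ[k] X i) (hp : ∀ m, (∀ i, p i m = 0) → m = 0)
    (t : M ⊗[k] N) (ht : ∀ i, (p i).lTensor M t = 0) : t = 0 := by
  apply (TensorProduct.comm k M N).injective
  rw [map_zero]
  apply eq_zero_of_map_left p hp
  intro i
  have := ht i
  have h2 : (p i).rTensor M (TensorProduct.comm k M N t)
      = TensorProduct.comm k M (X i) ((p i).lTensor M t) := by
    rw [LinearMap.rTensor, LinearMap.lTensor, TensorProduct.map_comm]
  rw [h2, this, map_zero]

/-- Jointly injective families of linear maps have jointly injective tensor products. -/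
lemma eq_zero_of_map {ι κ M N : Type*} {X : ι → Type*} {Y : κ → Type*}
    [AddCommGroup M] [Module k M] [AddCommGroup N] [Module k N]
    [∀ i, AddCommGroup (X i)] [∀ i, Module k (X i)]
    [∀ i, AddCommGroup (Y i)] [∀ i, Module k (Y i)]
    (p : ∀ i, M →ₗ[k] X i) (q : ∀ i, N →ₗ[k] Y i)
    (hp : ∀ m, (∀ i, p i m = 0) → m = 0) (hq : ∀ m, (∀ i, q i m = 0) → m = 0)
    (t : M ⊗[k] N) (ht : ∀ i j, TensorProduct.map (p i) (q j) t = 0) : t = 0 := by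
  apply eq_zero_of_map_left p hp
  intro i
  apply eq_zero_of_map_right q hq
  intro j
  rw [← ht i j, ← LinearMap.comp_apply, LinearMap.lTensor_comp_rTensor]

lemma map_injective_of_injective {M N M' N' : Type*} [AddCommGroup M] [Module k M]
    [AddCommGroup N] [Module k N] [AddCommGroup M'] [Module k M'] [AddCommGroup N'] [Module k N']
    (f : M →ₗ[k] M') (g : N →ₗ[k] N') (hf : Function.Injective f) (hg : Function.Injective g) :
    Function.Injective (TensorProduct.map f g) := by
  rw [injective_iff_map_eq_zero]
  intro t ht
  refine eq_zero_of_map (ι := Unit) (κ := Unit) (fun _ => f) (fun _ => g)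
    (fun m h => hf (by simpa using h ())) (fun m h => hg (by simpa using h ())) t
    (fun _ _ => ht)

end LinAlg

/-! ### The bialgebra `A(R)` -/

section FRT

variable {k ι : Type*} [Field k] [Fintype ι]

/-- The defining relations `∑ R_{ij}^{cd} T_c^a T_d^b = ∑ T_i^c T_j^d R_{cd}^{ab}`; the entry
`R_{ij}^{cd}` is `R i j c d`, and `T_i^j` is the free generator with index `(i, j)`. -/
inductive FRTRel (R : ι → ι → ι → ι → k) :
    FreeAlgebra k (ι × ι) → FreeAlgebra k (ι × ι) → Prop
  | rel (i j a b : ι) : FRTRel R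
      (∑ c, ∑ d, R i j c d • (FreeAlgebra.ι k (c, a) * FreeAlgebra.ι k (d, b)))
      (∑ c, ∑ d, R c d a b • (FreeAlgebra.ι k (i, c) * FreeAlgebra.ι k (j, d)))

/-- The algebra `A(R)` of the Faddeev-Reshetikhin-Takhtajan construction. -/
def FRT (R : ι → ι → ι → ι → k) : Type _ := RingQuot (FRTRel R)

namespace FRT

variable (R : ι → ι → ι → ι → k)

instance : Ring (FRT R) := inferInstanceAs (Ring (RingQuot (FRTRel R)))
instance : Algebra k (FRT R) := inferInstanceAs (Algebra k (RingQuot (FRTRel R)))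

/-- The quotient map from the free algebra. -/
def mk : FreeAlgebra k (ι × ι) →ₐ[k] FRT R := RingQuot.mkAlgHom k (FRTRel R)

/-- The generator `T_i^j`. -/
def T (i j : ι) : FRT R := mk R (FreeAlgebra.ι k (i, j))

lemma T_rel (i j a b : ι) :
    ∑ c, ∑ d, R i j c d • (T R c a * T R d b) = ∑ c, ∑ d, R c d a b • (T R i c * T R j d) := by
  have h : mk R _ = mk R _ := RingQuot.mkAlgHom_rel k (FRTRel.rel (R := R) i j a b)
  simp only [map_sum, map_smul, map_mul] at h
  exact h

/-- The universal property of `A(R)`. -/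
def lift {B : Type*} [Ring B] [Algebra k B] (t : ι → ι → B)
    (ht : ∀ i j a b, ∑ c, ∑ d, R i j c d • (t c a * t d b)
      = ∑ c, ∑ d, R c d a b • (t i c * t j d)) : FRT R →ₐ[k] B :=
  RingQuot.liftAlgHom k ⟨FreeAlgebra.lift k fun x => t x.1 x.2, by
    rintro x y ⟨i, j, a, b⟩
    simpa only [map_sum, map_smul, map_mul, FreeAlgebra.lift_ι_apply] using ht i j a b⟩

@[simp] lemma lift_T {B : Type*} [Ring B] [Algebra k B] (t : ι → ι → B)
    (ht : ∀ i j a b, ∑ c, ∑ d, R i j c d • (t c a * t d b)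
      = ∑ c, ∑ d, R c d a b • (t i c * t j d)) (i j : ι) : lift R t ht (T R i j) = t i j := by
  rw [lift, T, mk]
  erw [RingQuot.liftAlgHom_mkAlgHom_apply]
  simp

lemma hom_ext {B : Type*} [Ring B] [Algebra k B] {f g : FRT R →ₐ[k] B}
    (h : ∀ i j, f (T R i j) = g (T R i j)) : f = g := by
  apply RingQuot.ringQuot_ext'
  apply FreeAlgebra.hom_ext
  funext x
  exact h x.1 x.2

lemma induction {P : FRT R → Prop} (hT : ∀ i j, P (T R i j)) (hc : ∀ c, P (algebraMap k _ c))
    (hadd : ∀ a b, P a → P b → P (a + b)) (hmul : ∀ a b, P a → P b → P (a * b)) (a : FRT R) :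
    P a := by
  obtain ⟨x, rfl⟩ : ∃ x, mk R x = a := RingQuot.mkAlgHom_surjective k (FRTRel R) a
  induction x using FreeAlgebra.induction with
  | grade0 c => rw [AlgHom.commutes]; exact hc c
  | grade1 x => exact hT x.1 x.2
  | mul x y hx hy => rw [map_mul]; exact hmul _ _ hx hy
  | add x y hx hy => rw [map_add]; exact hadd _ _ hx hy

lemma sum4 {M : Type*} [AddCommMonoid M] (f : ι → ι → ι → ι → M) :
    ∑ c, ∑ d, ∑ e, ∑ g, f c d e g = ∑ e, ∑ g, ∑ c, ∑ d, f c d e g := by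
  calc ∑ c, ∑ d, ∑ e, ∑ g, f c d e g = ∑ c, ∑ e, ∑ d, ∑ g, f c d e g :=
        Finset.sum_congr rfl fun _ _ => Finset.sum_comm
    _ = ∑ c, ∑ e, ∑ g, ∑ d, f c d e g :=
        Finset.sum_congr rfl fun _ _ => Finset.sum_congr rfl fun _ _ => Finset.sum_comm
    _ = ∑ e, ∑ c, ∑ g, ∑ d, f c d e g := Finset.sum_comm
    _ = _ := Finset.sum_congr rfl fun _ _ => Finset.sum_comm

/-- `Δ(T_i^j) = ∑ T_i^l ⊗ T_l^j`. -/
def comulHom : FRT R →ₐ[k] FRT R ⊗[k] FRT R :=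
  lift R (fun i j => ∑ l, T R i l ⊗ₜ[k] T R l j) (by
    intro i j a b
    have h1 : ∀ c d, (∑ l, T R c l ⊗ₜ[k] T R l a) * (∑ l, T R d l ⊗ₜ[k] T R l b)
        = ∑ e, ∑ f, (T R c e * T R d f) ⊗ₜ[k] (T R e a * T R f b) := by
      intro c d
      simp only [Finset.sum_mul_sum, Algebra.TensorProduct.tmul_mul_tmul]
    have h2 : ∀ c d, (∑ l, T R i l ⊗ₜ[k] T R l c) * (∑ l, T R j l ⊗ₜ[k] T R l d)
        = ∑ e, ∑ f, (T R i e * T R j f) ⊗ₜ[k] (T R e c * T R f d) := by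
      intro c d
      simp only [Finset.sum_mul_sum, Algebra.TensorProduct.tmul_mul_tmul]
    simp only [h1, h2, Finset.smul_sum]
    rw [sum4, sum4 (fun c d e f => R c d a b •
      ((T R i e * T R j f) ⊗ₜ[k] (T R e c * T R f d)))]
    have e1 : ∀ e f, ∑ c, ∑ d, R i j c d • ((T R c e * T R d f) ⊗ₜ[k] (T R e a * T R f b))
        = ∑ c, ∑ d, (R c d e f • (T R i c * T R j d)) ⊗ₜ[k] (T R e a * T R f b) := by
      intro e f
      simp only [← TensorProduct.sum_tmul, ← T_rel, TensorProduct.smul_tmul']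
    have e2 : ∀ e f, ∑ c, ∑ d, R c d a b • ((T R i e * T R j f) ⊗ₜ[k] (T R e c * T R f d))
        = ∑ c, ∑ d, (T R i e * T R j f) ⊗ₜ[k] (R e f c d • (T R c a * T R d b)) := by
      intro e f
      simp only [← TensorProduct.tmul_sum, T_rel, ← TensorProduct.tmul_smul]
    simp only [e1, e2]
    rw [sum4]
    simp only [TensorProduct.smul_tmul])

/-- `ε(T_i^j) = δ_{ij}`. -/
def counitHom [DecidableEq ι] : FRT R →ₐ[k] k :=
  lift R (fun i j => if i = j then 1 else 0) (by
    intro i j a b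
    simp only [smul_eq_mul, mul_ite, mul_one, mul_zero, Finset.sum_ite_eq, Finset.sum_ite_eq',
      Finset.mem_univ, if_true])

instance [DecidableEq ι] : Bialgebra k (FRT R) :=
  Bialgebra.ofAlgHom (comulHom R) (counitHom R)
    (by
      apply hom_ext
      intro i j
      simp only [comulHom, AlgHom.comp_apply, lift_T, map_sum, Algebra.TensorProduct.map_tmul,
        TensorProduct.sum_tmul, TensorProduct.tmul_sum, AlgHom.id_apply]
      rw [Finset.sum_comm]
      rfl)
    (by
      apply hom_ext
      intro i j
      simp [comulHom, counitHom, TensorProduct.ite_tmul])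
    (by
      apply hom_ext
      intro i j
      simp [comulHom, counitHom, TensorProduct.tmul_ite])

lemma comul_T [DecidableEq ι] (i j : ι) :
    Coalgebra.comul (R := k) (T R i j) = ∑ l, T R i l ⊗ₜ[k] T R l j :=
  lift_T R _ _ i j

lemma counit_T [DecidableEq ι] (i j : ι) :
    Coalgebra.counit (R := k) (T R i j) = if i = j then 1 else 0 :=
  lift_T R _ _ i j

end FRT

end FRT

/-! ### Existence of antipodes -/

section Antipode

variable {k H : Type*} [Field k] [Ring H] [Bialgebra k H]

/-- The subspace `∑_{a + b = n} D_a ⊗ D_b` of `H ⊗ H`. -/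
def tensFil (D : ℕ → Submodule k H) (n : ℕ) : Submodule k (H ⊗[k] H) :=
  Submodule.span k {t | ∃ a b x y, a + b = n ∧ x ∈ D a ∧ y ∈ D b ∧ t = x ⊗ₜ[k] y}

open WithConv

lemma conv_congr {D : ℕ → Submodule k H} {n : ℕ} {x : H}
    (hx : Coalgebra.comul x ∈ tensFil D n) (f g f' g' : WithConv (H →ₗ[k] H))
    (h : ∀ a b, a + b = n → ∀ x ∈ D a, ∀ y ∈ D b, f x * g y = f' x * g' y) :
    (f * g) x = (f' * g') x := by
  rw [LinearMap.convMul_apply, LinearMap.convMul_apply]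
  generalize Coalgebra.comul (R := k) x = t at hx
  induction hx using Submodule.span_induction with
  | mem t ht =>
    obtain ⟨a, b, x, y, hab, hx, hy, rfl⟩ := ht
    simpa using h a b hab x hx y hy
  | zero => simp
  | add s t _ _ hs ht => simp only [map_add, hs, ht]
  | smul c t _ ht => simp only [map_smul, ht]

lemma exists_inverse_one_sub {D : ℕ → Submodule k H} (hmono : Monotone D)
    (hcom : ∀ n, ∀ x ∈ D n, Coalgebra.comul x ∈ tensFil D n) (hex : ∀ x, ∃ n, x ∈ D n)
    (N : WithConv (H →ₗ[k] H)) (hN : ∀ x ∈ D 0, N x = 0) :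
    ∃ M : WithConv (H →ₗ[k] H), (1 - N) * M = 1 ∧ M * (1 - N) = 1 := by
  have hpow : ∀ n, ∀ x ∈ D n, (N ^ (n + 1)) x = 0 := by
    intro n
    induction n with
    | zero => simpa using hN
    | succ n ih =>
      intro x hx
      rw [pow_succ']
      have := conv_congr (hcom _ x hx) N (N ^ (n + 1)) 0 0 (by
        intro a b hab x hx y hy
        rcases Nat.eq_zero_or_pos a with rfl | ha
        · simp [hN x hx]
        · rw [ih y (hmono (by omega) hy)]
          simp)
      rw [this, mul_zero]
      rfl
  have hpow2 : ∀ n, ∀ x ∈ D n, ∀ i, n < i → (N ^ i) x = 0 := by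
    intro n x hx i hi
    obtain ⟨j, rfl⟩ : ∃ j, i = j + 1 := ⟨i - 1, by omega⟩
    exact hpow j x (hmono (by omega) hx)
  have hsum : ∀ n, ∀ x ∈ D n, ∑ᶠ i, (N ^ i) x = ∑ i ∈ Finset.range (n + 1), (N ^ i) x := by
    intro n x hx
    apply finsum_eq_sum_of_support_subset
    intro i hi
    by_contra h
    exact hi (hpow2 n x hx i (by simpa using h))
  have hfin : ∀ x, (Function.support fun i => (N ^ i) x).Finite := by
    intro x
    obtain ⟨n, hn⟩ := hex x
    apply (Finset.range (n + 1)).finite_toSet.subset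
    intro i hi
    by_contra h
    exact hi (hpow2 n x hn i (by simpa using h))
  let M : WithConv (H →ₗ[k] H) := toConv
    { toFun := fun x => ∑ᶠ i, (N ^ i) x
      map_add' := fun x y => by
        rw [← finsum_add_distrib (hfin x) (hfin y)]
        exact finsum_congr fun i => map_add (N ^ i).ofConv x y
      map_smul' := fun c x => by
        rw [RingHom.id_apply, smul_finsum' c (hfin x)]
        exact finsum_congr fun i => map_smul (N ^ i).ofConv c x }
  have hM : ∀ n, ∀ x ∈ D n, M x = (∑ i ∈ Finset.range (n + 1), N ^ i) x := by
    intro n x hx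
    refine (hsum n x hx).trans ?_
    rw [WithConv.ofConv_sum, LinearMap.sum_apply]
  refine ⟨M, ?_, ?_⟩
  · ext x
    obtain ⟨n, hn⟩ := hex x
    have h1 := conv_congr (hcom _ x hn) (1 - N) M (1 - N) (∑ i ∈ Finset.range (n + 1), N ^ i) (by
      intro a b hab x hx y hy
      rw [hM n y (hmono (by omega) hy)])
    refine h1.trans ?_
    rw [mul_neg_geom_sum]
    have := hpow n x hn
    simp [this]
  · ext x
    obtain ⟨n, hn⟩ := hex x
    have h1 := conv_congr (hcom _ x hn) M (1 - N) (∑ i ∈ Finset.range (n + 1), N ^ i) (1 - N) (by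
      intro a b hab x hx y hy
      rw [hM n x (hmono (by omega) hx)])
    refine h1.trans ?_
    rw [geom_sum_mul_neg]
    have := hpow n x hn
    simp [this]

/-- A bialgebra with an exhaustive coalgebra filtration whose bottom term is spanned by invertible
group-like elements has an antipode. -/
lemma exists_antipode {D : ℕ → Submodule k H} (hmono : Monotone D)
    (hcom : ∀ n, ∀ x ∈ D n, Coalgebra.comul x ∈ tensFil D n) (hex : ∀ x, ∃ n, x ∈ D n)
    (h0 : D 0 ≤ Submodule.span k {g | IsGroupLikeElem k g ∧ IsUnit g}) :
    ∃ S : H →ₗ[k] H, toConv S * toConv LinearMap.id = 1 ∧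
      toConv LinearMap.id * toConv S = 1 := by
  let b := Module.Basis.extend (linearIndepOn_isGroupLikeElem (R := k) (A := H))
  let g₀ : WithConv (H →ₗ[k] H) := toConv (b.constr k fun x => Ring.inverse (x : H))
  have hg : ∀ g : H, IsGroupLikeElem k g → g₀ g = Ring.inverse g := by
    intro g hg
    have hmem := Module.Basis.subset_extend (linearIndepOn_isGroupLikeElem (R := k) (A := H)) hg
    have : b ⟨g, hmem⟩ = g := Module.Basis.extend_apply_self _ _
    change b.constr k (fun x => Ring.inverse (x : H)) g = _
    conv_lhs => rw [← this]
    rw [Module.Basis.constr_basis]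
  have hvan : ∀ f : WithConv (H →ₗ[k] H), (∀ g, IsGroupLikeElem k g → IsUnit g → f g = 0) →
      ∀ x ∈ D 0, f x = 0 := by
    intro f hf x hx
    have : Submodule.span k {g | IsGroupLikeElem k g ∧ IsUnit g} ≤ LinearMap.ker f.ofConv := by
      rw [Submodule.span_le]
      exact fun g hg => hf g hg.1 hg.2
    exact this (h0 hx)
  let u : WithConv (H →ₗ[k] H) := toConv LinearMap.id
  obtain ⟨M₁, hM₁, -⟩ := exists_inverse_one_sub hmono hcom hex (1 - u * g₀) (hvan _ (by
    intro g h1 h2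
    have : (u * g₀) g = 1 := by
      rw [LinearMap.convMul_apply, h1.comul_eq_tmul_self]
      have := hg g h1
      simp [u, this, Ring.mul_inverse_cancel _ h2]
    simp [this, h1]))
  obtain ⟨M₂, -, hM₂⟩ := exists_inverse_one_sub hmono hcom hex (1 - g₀ * u) (hvan _ (by
    intro g h1 h2
    have : (g₀ * u) g = 1 := by
      rw [LinearMap.convMul_apply, h1.comul_eq_tmul_self]
      have := hg g h1
      simp [u, this, Ring.inverse_mul_cancel _ h2]
    simp [this, h1]))
  rw [sub_sub_cancel] at hM₁ hM₂
  have e1 : u * (g₀ * M₁) = 1 := by rw [← mul_assoc]; exact hM₁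
  have e2 : (M₂ * g₀) * u = 1 := by rw [mul_assoc]; exact hM₂
  have e3 : M₂ * g₀ = g₀ * M₁ := left_inv_eq_right_inv e2 e1
  refine ⟨(g₀ * M₁).ofConv, ?_, e1⟩
  rw [← e3]
  exact e2

/-- The Hopf algebra structure on a bialgebra that has an antipode. -/
@[reducible]
def hopfOfExists (h : ∃ S : H →ₗ[k] H, toConv S * toConv LinearMap.id = 1 ∧
      toConv LinearMap.id * toConv S = 1) : HopfAlgebra k H :=
  HopfAlgebra.ofConvInverse h.choose h.choose_spec.1 h.choose_spec.2

end Antipode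

/-! ### Hopf algebras inside the dual of a bialgebra -/

section Dual

open WithConv

variable {k A : Type*} [Field k] [Ring A] [Bialgebra k A]

variable (k A) in
/-- The pull-back of functionals along the multiplication `A ⊗ A → A`; it is an algebra map for
the convolution products. -/
def mulDual : WithConv (A →ₗ[k] k) →ₐ[k] WithConv (A ⊗[k] A →ₗ[k] k) :=
  AlgHom.ofLinearMap
    { toFun := fun f => toConv (f.ofConv ∘ₗ LinearMap.mul' k A)
      map_add' := fun _ _ => rfl
      map_smul' := fun _ _ => rfl }
    (by
      ext a b
      change (1 : WithConv (A →ₗ[k] k)) (a * b) = _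
      simp [mul_comm])
    (by
      intro f g
      have := LinearMap.convMul_comp_coalgHom_distrib f g (Bialgebra.mulCoalgHom k A)
      exact WithConv.ext this)

lemma mulDual_tmul (f : WithConv (A →ₗ[k] k)) (a b : A) :
    mulDual k A f (a ⊗ₜ[k] b) = f (a * b) := rfl

variable {B : Type*} [Ring B] [Algebra k B] (j : B →ₐ[k] WithConv (A →ₗ[k] k))

/-- Evaluation at an element of `A`. -/
def evalAt (a : A) : B →ₗ[k] k where
  toFun f := j f a
  map_add' f g := by rw [map_add]; rfl
  map_smul' c f := by rw [map_smul]; rfl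

@[simp] lemma evalAt_apply (a : A) (f : B) : evalAt j a f = j f a := rfl

/-- The map `B ⊗ B → (A ⊗ A)^*` with `(f ⊗ g)(a ⊗ b) = f(a) g(b)`. -/
def evTensor : B ⊗[k] B →ₗ[k] WithConv (A ⊗[k] A →ₗ[k] k) :=
  (WithConv.linearEquiv k (A ⊗[k] A →ₗ[k] k)).symm.toLinearMap ∘ₗ
    TensorProduct.dualDistrib k A A ∘ₗ
      TensorProduct.map ((WithConv.linearEquiv k (A →ₗ[k] k)).toLinearMap ∘ₗ j.toLinearMap)
        ((WithConv.linearEquiv k (A →ₗ[k] k)).toLinearMap ∘ₗ j.toLinearMap)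

@[simp] lemma evTensor_tmul (f g : B) (a b : A) :
    evTensor j (f ⊗ₜ[k] g) (a ⊗ₜ[k] b) = j f a * j g b := rfl

lemma evTensor_one : evTensor j 1 = 1 := by
  ext a b
  change j 1 a * j 1 b = _
  simp [mul_comm]

lemma evTensor_mul (s t : B ⊗[k] B) : evTensor j (s * t) = evTensor j s * evTensor j t := by
  induction s with
  | zero => simp
  | add s₁ s₂ h₁ h₂ => rw [add_mul, map_add, map_add, add_mul, h₁, h₂]
  | tmul f g =>
    induction t with
    | zero => simp
    | add s₁ s₂ h₁ h₂ => rw [mul_add, map_add, map_add, mul_add, h₁, h₂]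
    | tmul f' g' =>
      rw [Algebra.TensorProduct.tmul_mul_tmul]
      have h := TensorProduct.map_convMul_map (R := k) (f := j f) (h := j f') (g := j g)
        (k := j g')
      have h2 := LinearMap.algHom_comp_convMul_distrib (R := k)
        (Algebra.TensorProduct.lid k k).toAlgHom
        (toConv (TensorProduct.map (j f).ofConv (j g).ofConv))
        (toConv (TensorProduct.map (j f').ofConv (j g').ofConv))
      rw [h, ← map_mul, ← map_mul] at h2
      have e : ∀ u v : B, evTensor j (u ⊗ₜ[k] v)
          = toConv ((Algebra.TensorProduct.lid k k).toAlgHom.toLinearMap ∘ₗ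
            TensorProduct.map (j u).ofConv (j v).ofConv) := by
        intro u v
        ext a b
        simp
      rw [e, e, e]
      exact WithConv.ext h2

lemma lid_map_evalAt (t : B ⊗[k] B) (a b : A) :
    TensorProduct.lid k k (TensorProduct.map (evalAt j a) (evalAt j b) t)
      = evTensor j t (a ⊗ₜ[k] b) := by
  induction t with
  | zero => simp
  | add s₁ s₂ h₁ h₂ => simp only [map_add, h₁, h₂]; rfl
  | tmul f g => simp

/-- `evTensor` as an algebra map. -/
def evTensorHom : B ⊗[k] B →ₐ[k] WithConv (A ⊗[k] A →ₗ[k] k) :=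
  AlgHom.ofLinearMap (evTensor j) (evTensor_one j) (evTensor_mul j)

variable {j}

lemma eq_zero_of_evalAt (hj : Function.Injective j) (f : B) (h : ∀ a, evalAt j a f = 0) : f = 0 := by
  apply hj
  rw [map_zero]
  exact WithConv.ext (LinearMap.ext h)

lemma evTensor_injective (hj : Function.Injective j) : Function.Injective (evTensor j) := by
  rw [injective_iff_map_eq_zero]
  intro t ht
  apply eq_zero_of_map (evalAt j) (evalAt j) (eq_zero_of_evalAt hj) (eq_zero_of_evalAt hj)
  intro a b
  apply (TensorProduct.lid k k).injective
  rw [lid_map_evalAt, ht, map_zero]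
  rfl

variable (hj : Function.Injective j)

/-- The comultiplication dual to the multiplication of `A`: `Δ(f)` is the element of `B ⊗ B` with
`Δ(f)(a ⊗ b) = f(ab)`. -/
def dualComul (hB : ∀ f, mulDual k A (j f) ∈ (evTensorHom j).range) : B →ₐ[k] B ⊗[k] B :=
  ((AlgEquiv.ofInjective (evTensorHom j) (evTensor_injective hj)).symm.toAlgHom).comp
    (((mulDual k A).comp j).codRestrict (evTensorHom j).range hB)

variable (hB : ∀ f, mulDual k A (j f) ∈ (evTensorHom j).range)

lemma evTensor_dualComul (f : B) :
    evTensor j (dualComul hj hB f) = mulDual k A (j f) := by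
  have := congrArg Subtype.val ((AlgEquiv.ofInjective (evTensorHom j)
    (evTensor_injective hj)).apply_symm_apply
      (((mulDual k A).comp j).codRestrict (evTensorHom j).range hB f))
  exact this

variable (j) in
/-- The counit `f ↦ f(1)`. -/
def dualCounit : B →ₐ[k] k :=
  AlgHom.ofLinearMap (evalAt j 1) (by simp) (by
    intro f g
    simp [Algebra.TensorProduct.one_def])

lemma evalAt_comul (f : B) (a b : A) :
    TensorProduct.lid k k (TensorProduct.map (evalAt j a) (evalAt j b) (dualComul hj hB f))
      = j f (a * b) := by
  rw [lid_map_evalAt, evTensor_dualComul]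
  rfl

lemma lTensor_evalAt (f : B) (a b : A) :
    evalAt j b (TensorProduct.lid k B ((evalAt j a).rTensor B (dualComul hj hB f)))
      = j f (a * b) := by
  rw [← evalAt_comul hj hB]
  generalize dualComul hj hB f = t
  induction t with
  | zero => simp
  | add s₁ s₂ h₁ h₂ => simp only [map_add, h₁, h₂]
  | tmul f g => simp

lemma rTensor_evalAt (f : B) (a b : A) :
    evalAt j a (TensorProduct.rid k B ((evalAt j b).lTensor B (dualComul hj hB f)))
      = j f (a * b) := by
  rw [← evalAt_comul hj hB]
  generalize dualComul hj hB f = t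
  induction t with
  | zero => simp
  | add s₁ s₂ h₁ h₂ => simp only [map_add, h₁, h₂]
  | tmul f g => simp [mul_comm]

/-- An algebra `B` of functionals on `A` with `mulDual B ⊆ B ⊗ B` is a bialgebra. -/
@[reducible]
def dualBialgebra : Bialgebra k B :=
  Bialgebra.ofAlgHom (dualComul hj hB) (dualCounit j)
    (by
      apply AlgHom.ext
      intro f
      rw [← sub_eq_zero]
      apply eq_zero_of_map (evalAt j)
        (fun x : A × A => (TensorProduct.lid k k).toLinearMap ∘ₗ
          TensorProduct.map (evalAt j x.1) (evalAt j x.2))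
        (eq_zero_of_evalAt hj)
      · intro t ht
        apply evTensor_injective hj
        ext a b
        rw [map_zero]
        exact (lid_map_evalAt j t a b).symm.trans (ht (a, b))
      · rintro a ⟨b, c⟩
        apply (TensorProduct.lid k k).injective
        rw [map_sub, map_sub, map_zero, sub_eq_zero]
        have h1 : TensorProduct.lid k k (TensorProduct.map (evalAt j a)
            ((TensorProduct.lid k k).toLinearMap ∘ₗ
              TensorProduct.map (evalAt j b) (evalAt j c))
            (Algebra.TensorProduct.assoc k k k B B B
              (Algebra.TensorProduct.map (dualComul hj hB) (.id k B) (dualComul hj hB f))))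
            = j f (a * b * c) := by
          rw [← evalAt_comul hj hB f (a * b) c]
          generalize dualComul hj hB f = t
          induction t with
          | zero => simp
          | add s₁ s₂ h₁ h₂ => simp only [map_add, h₁, h₂]
          | tmul f g =>
            simp only [Algebra.TensorProduct.map_tmul, TensorProduct.map_tmul,
              TensorProduct.lid_tmul, evalAt_apply, smul_eq_mul]
            rw [← evalAt_comul hj hB f a b]
            generalize dualComul hj hB f = t
            induction t with
            | zero => simp
            | add s₁ s₂ h₁ h₂ => simp only [map_add, TensorProduct.add_tmul, h₁, h₂, add_mul]
            | tmul f' g' => simp [mul_assoc]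
        have h2 : TensorProduct.lid k k (TensorProduct.map (evalAt j a)
            ((TensorProduct.lid k k).toLinearMap ∘ₗ
              TensorProduct.map (evalAt j b) (evalAt j c))
              (Algebra.TensorProduct.map (.id k B) (dualComul hj hB) (dualComul hj hB f)))
            = j f (a * (b * c)) := by
          rw [← evalAt_comul hj hB f a (b * c)]
          generalize dualComul hj hB f = t
          induction t with
          | zero => simp
          | add s₁ s₂ h₁ h₂ => simp only [map_add, h₁, h₂]
          | tmul f g =>
            simp only [Algebra.TensorProduct.map_tmul, TensorProduct.map_tmul,
              TensorProduct.lid_tmul, evalAt_apply, smul_eq_mul, AlgHom.id_apply,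
              LinearMap.comp_apply, LinearEquiv.coe_coe]
            rw [← evalAt_comul hj hB g b c]
        exact (h1.trans (by rw [mul_assoc])).trans h2.symm)
    (by
      apply AlgHom.ext
      intro f
      apply (TensorProduct.lid k B).injective
      rw [← sub_eq_zero]
      apply eq_zero_of_evalAt hj
      intro a
      rw [map_sub, sub_eq_zero]
      refine (lTensor_evalAt hj hB f 1 a).trans ?_
      simp)
    (by
      apply AlgHom.ext
      intro f
      apply (TensorProduct.rid k B).injective
      rw [← sub_eq_zero]
      apply eq_zero_of_evalAt hj
      intro a
      rw [map_sub, sub_eq_zero]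
      refine (rTensor_evalAt hj hB f a 1).trans ?_
      simp)

end Dual

/-! ### The Yang-Baxter operator `R_Q` and the Hopf algebra `B^l` -/

/-- The parameters `Q = {r ≠ 1, p_{ij}}_{i < j}` of the multiparameter deformation of `GL_{m+1}`.
Only the values `p i j` with `i < j` are used. -/
structure QParam (k : Type*) [Field k] (m : ℕ) where
  r : k
  p : Fin (m + 1) → Fin (m + 1) → k
  r_ne_zero : r ≠ 0
  r_ne_one : r ≠ 1
  p_ne_zero : ∀ i j, i < j → p i j ≠ 0

section Borel

open WithConv

variable {k : Type*} [Field k] {m : ℕ} (Q : QParam k m)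

namespace QParam

/-- The scalar `κ^i_j`. -/
def kappa (i j : Fin (m + 1)) : k :=
  if i < j then Q.p i j else if i = j then Q.r else Q.r / Q.p j i

/-- The matrix entry `R_{ij}^{cd}` of `R_Q`. -/
def Rmat (i j c d : Fin (m + 1)) : k :=
  if i = d ∧ j = c then Q.kappa i j else if i = c ∧ j = d ∧ j < i then Q.r - 1 else 0

lemma kappa_self (i : Fin (m + 1)) : Q.kappa i i = Q.r := by simp [kappa]

lemma kappa_ne_zero (i j : Fin (m + 1)) : Q.kappa i j ≠ 0 := by
  unfold kappa
  split_ifs with h1 h2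
  · exact Q.p_ne_zero i j h1
  · exact Q.r_ne_zero
  · exact div_ne_zero Q.r_ne_zero (Q.p_ne_zero j i (by omega))

lemma kappa_mul {i j : Fin (m + 1)} (h : i ≠ j) : Q.kappa i j * Q.kappa j i = Q.r := by
  unfold kappa
  rcases lt_or_gt_of_ne h with h1 | h1
  · rw [if_pos h1, if_neg (by omega), if_neg (by omega)]
    exact mul_div_cancel₀ _ (Q.p_ne_zero i j h1)
  · rw [if_neg (by omega), if_neg (by omega), if_pos h1]
    exact div_mul_cancel₀ _ (Q.p_ne_zero j i h1)

/-- The bialgebra `A(R_Q)`. -/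
abbrev A : Type _ := FRT Q.Rmat

/-- The algebra map `A(R_Q) → k` with `T_j^l ↦ δ_{jl} χ_j`. -/
def charHom (χ : Fin (m + 1) → k) : Q.A →ₐ[k] k :=
  FRT.lift Q.Rmat (fun j l => if j = l then χ j else 0) (by
    intro i j a b
    simp only [smul_eq_mul, mul_ite, ite_mul, mul_zero, zero_mul, Finset.sum_ite_eq,
      Finset.sum_ite_eq', Finset.mem_univ, if_true, Rmat]
    split_ifs with h1 h2
    · rw [h1.1, h1.2]; ring
    · rw [h2.1, h2.2.1]
    · simp)

lemma charHom_T (χ : Fin (m + 1) → k) (j l : Fin (m + 1)) :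
    Q.charHom χ (FRT.T Q.Rmat j l) = if j = l then χ j else 0 := FRT.lift_T _ _ _ _ _

/-- The algebra map `a ↦ [[K_{s+1}(a), E(a)], [0, K_s(a)]]`, where `E = E^s_{s+1}` is the functional
with `E(T_j^l) = δ_{js} δ_{l,s+1}` and `E(ab) = K_{s+1}(a) E(b) + E(a) K_s(b)`. -/
def matHom (s : Fin m) : Q.A →ₐ[k] Matrix (Fin 2) (Fin 2) k :=
  FRT.lift Q.Rmat (fun j l =>
    !![if j = l then Q.kappa s.succ j else 0, if j = s.castSucc ∧ l = s.succ then 1 else 0;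
      0, if j = l then Q.kappa s.castSucc j else 0]) (by
    intro i j a b
    have hs : s.castSucc < s.succ := Fin.castSucc_lt_succ
    have h1 := Q.kappa_mul hs.ne
    have h2 : ∀ i : Fin (m + 1), i ≤ s.castSucc ∨ s.succ ≤ i := fun i => by
      rw [Fin.le_def, Fin.le_def, Fin.val_succ, Fin.val_castSucc]
      omega
    generalize s.castSucc = u at *
    generalize s.succ = v at *
    apply Matrix.ext
    intro x y
    fin_cases x <;> fin_cases y <;>
      simp only [Matrix.sum_apply, Matrix.smul_apply, Matrix.mul_apply, Fin.sum_univ_two,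
        Fin.zero_eta, Fin.mk_one, Matrix.of_apply, Matrix.cons_val', Matrix.cons_val_zero,
        Matrix.cons_val_one, Matrix.cons_val_fin_one, Matrix.empty_val', smul_eq_mul, mul_zero,
        zero_mul, add_zero, zero_add, Finset.sum_const_zero]
    · simp only [mul_ite, ite_mul, mul_zero, zero_mul, Finset.sum_ite_eq,
        Finset.sum_ite_eq', Finset.mem_univ, if_true, Rmat]
      split_ifs with h3 h4
      · rw [h3.1, h3.2]; ring
      · rw [h4.1, h4.2.1]
      · simp
    · simp only [mul_add, Finset.sum_add_distrib, ite_and, mul_ite, ite_mul, mul_zero, zero_mul,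
        mul_one, one_mul, Finset.sum_ite_eq, Finset.sum_ite_eq', Finset.mem_univ, if_true,
        Finset.sum_ite_irrel, Finset.sum_const_zero]
      have hself := Q.kappa_self
      have h3 : ∀ i j, i = j ∨ Q.kappa i j * Q.kappa j i = Q.r :=
        fun i j => or_iff_not_imp_left.2 fun h => Q.kappa_mul h
      have hi2 := h2 i
      have hj2 := h2 j
      have hiu := h3 i u
      have hiv := h3 i v
      have hju := h3 j u
      have hjv := h3 j v
      clear h3 h2
      by_cases ha : a = v <;> by_cases hb : b = v <;> by_cases hi : i = u <;>
        by_cases hj : j = u <;> simp only [ha, hb, hi, hj, Rmat, if_true, if_false] <;> grind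
    · simp only [mul_ite, ite_mul, mul_zero, zero_mul, Finset.sum_ite_eq,
        Finset.sum_ite_eq', Finset.mem_univ, if_true, Rmat]
      split_ifs with h3 h4
      · rw [h3.1, h3.2]; ring
      · rw [h4.1, h4.2.1]
      · simp)

lemma matHom_T (s : Fin m) (j l : Fin (m + 1)) : Q.matHom s (FRT.T Q.Rmat j l) =
    !![if j = l then Q.kappa s.succ j else 0, if j = s.castSucc ∧ l = s.succ then 1 else 0;
      0, if j = l then Q.kappa s.castSucc j else 0] := FRT.lift_T _ _ _ _ _

/-- The convolution algebra `A(R_Q)^*`. -/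
abbrev Dual : Type _ := WithConv (Q.A →ₗ[k] k)

/-- The functional `K_i`: the algebra map with `K_i(T_j^l) = δ_{jl} κ^i_j`. -/
def Kfun (i : Fin (m + 1)) : Q.Dual := toConv (Q.charHom (Q.kappa i)).toLinearMap

/-- The functional `K_i⁻¹`: the algebra map with `K_i⁻¹(T_j^l) = δ_{jl} (κ^i_j)⁻¹`. -/
def KfunInv (i : Fin (m + 1)) : Q.Dual := toConv (Q.charHom fun j => (Q.kappa i j)⁻¹).toLinearMap

/-- The functional `E^s_{s+1}`. -/
def Efun (s : Fin m) : Q.Dual :=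
  toConv (LinearMap.proj (1 : Fin 2) ∘ₗ LinearMap.proj (0 : Fin 2) ∘ₗ (Q.matHom s).toLinearMap)

lemma charHom_conv (χ ψ : Fin (m + 1) → k) :
    (toConv (Q.charHom χ).toLinearMap : Q.Dual) * toConv (Q.charHom ψ).toLinearMap
      = toConv (Q.charHom fun j => χ j * ψ j).toLinearMap := by
  have : (toConv (Q.charHom χ) * toConv (Q.charHom ψ)) = toConv (Q.charHom fun j => χ j * ψ j) := by
    apply WithConv.ext
    apply FRT.hom_ext
    intro i j
    change (toConv (Q.charHom χ) * toConv (Q.charHom ψ)) (FRT.T Q.Rmat i j) = _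
    rw [AlgHom.convMul_apply]
    by_cases h : i = j
    · simp [FRT.comul_T, charHom_T, h]
    · simp [FRT.comul_T, charHom_T, h]
  exact congrArg (fun f => toConv f.ofConv.toLinearMap) this

lemma charHom_one : (toConv (Q.charHom fun _ => 1).toLinearMap : Q.Dual) = 1 := by
  have : Q.charHom (fun _ => 1) = Bialgebra.counitAlgHom k Q.A := by
    apply FRT.hom_ext
    intro i j
    simp [charHom_T, FRT.counit_T]
  rw [this]
  rfl

lemma Kfun_mul_inv (i : Fin (m + 1)) : Q.Kfun i * Q.KfunInv i = 1 := by
  rw [Kfun, KfunInv, charHom_conv, ← charHom_one]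
  simp [Q.kappa_ne_zero]

lemma Kfun_inv_mul (i : Fin (m + 1)) : Q.KfunInv i * Q.Kfun i = 1 := by
  rw [Kfun, KfunInv, charHom_conv, ← charHom_one]
  simp [Q.kappa_ne_zero]

lemma matHom_entries (s : Fin m) (a : Q.A) :
    Q.matHom s a 0 0 = Q.Kfun s.succ a ∧ Q.matHom s a 1 1 = Q.Kfun s.castSucc a ∧
      Q.matHom s a 1 0 = 0 := by
  induction a using FRT.induction with
  | hT i j => simp [matHom_T, Kfun, charHom_T]
  | hc c =>
    have h : ∀ i, Q.Kfun i (algebraMap k Q.A c) = c := fun i => AlgHom.commutes _ c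
    simp [h, Matrix.algebraMap_matrix_apply]
  | hadd a b ha hb => simp [ha, hb]
  | hmul a b ha hb =>
    have h : ∀ i, Q.Kfun i (a * b) = Q.Kfun i a * Q.Kfun i b := fun i => map_mul (Q.charHom _) _ _
    simp [Matrix.mul_apply, Fin.sum_univ_two, ha, hb, h]

lemma Efun_mul (s : Fin m) (a b : Q.A) :
    Q.Efun s (a * b) = Q.Kfun s.succ a * Q.Efun s b + Q.Efun s a * Q.Kfun s.castSucc b := by
  change Q.matHom s (a * b) 0 1 = _ * Q.matHom s b 0 1 + Q.matHom s a 0 1 * _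
  rw [map_mul, Matrix.mul_apply, Fin.sum_univ_two, (Q.matHom_entries s a).1,
    (Q.matHom_entries s b).2.1]

lemma Efun_T (s : Fin m) (j l : Fin (m + 1)) :
    Q.Efun s (FRT.T Q.Rmat j l) = if j = s.castSucc ∧ l = s.succ then 1 else 0 := by
  change Q.matHom s _ 0 1 = _
  rw [matHom_T]
  simp

/-- The subalgebra of `A(R_Q)^*` generated by the `K_i`, `K_i⁻¹` and `E^s_{s+1}`. -/
def borelSub : Subalgebra k Q.Dual :=
  Algebra.adjoin k (Set.range Q.Kfun ∪ Set.range Q.KfunInv ∪ Set.range Q.Efun)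

end QParam

/-- The algebra `B^l`. -/
def Borel : Type _ := Q.borelSub

namespace Borel

instance : Ring (Borel Q) := inferInstanceAs (Ring Q.borelSub)
instance : Algebra k (Borel Q) := inferInstanceAs (Algebra k Q.borelSub)

/-- The inclusion `B^l → A(R_Q)^*`. -/
def incl : Borel Q →ₐ[k] Q.Dual := Q.borelSub.val

lemma incl_injective : Function.Injective (incl Q) := Subtype.val_injective

/-- The element `K_i` of `B^l`. -/
def K (i : Fin (m + 1)) : Borel Q :=
  ⟨Q.Kfun i, Algebra.subset_adjoin (Or.inl (Or.inl ⟨i, rfl⟩))⟩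

/-- The element `K_i⁻¹` of `B^l`. -/
def Kinv (i : Fin (m + 1)) : Borel Q :=
  ⟨Q.KfunInv i, Algebra.subset_adjoin (Or.inl (Or.inr ⟨i, rfl⟩))⟩

/-- The element `E^s_{s+1}` of `B^l`. -/
def E (s : Fin m) : Borel Q :=
  ⟨Q.Efun s, Algebra.subset_adjoin (Or.inr ⟨s, rfl⟩)⟩

lemma K_mul_Kinv (i : Fin (m + 1)) : K Q i * Kinv Q i = 1 := Subtype.ext (Q.Kfun_mul_inv i)
lemma Kinv_mul_K (i : Fin (m + 1)) : Kinv Q i * K Q i = 1 := Subtype.ext (Q.Kfun_inv_mul i)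

lemma mulDual_K (i : Fin (m + 1)) :
    mulDual k Q.A (incl Q (K Q i)) = evTensorHom (incl Q) (K Q i ⊗ₜ K Q i) := by
  ext a b
  change Q.Kfun i (a * b) = Q.Kfun i a * Q.Kfun i b
  exact map_mul (Q.charHom (Q.kappa i)) a b

lemma mulDual_Kinv (i : Fin (m + 1)) :
    mulDual k Q.A (incl Q (Kinv Q i)) = evTensorHom (incl Q) (Kinv Q i ⊗ₜ Kinv Q i) := by
  ext a b
  change Q.KfunInv i (a * b) = Q.KfunInv i a * Q.KfunInv i b
  exact map_mul (Q.charHom fun j => (Q.kappa i j)⁻¹) a b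

lemma mulDual_E (s : Fin m) :
    mulDual k Q.A (incl Q (E Q s)) = evTensorHom (incl Q)
      (K Q s.succ ⊗ₜ E Q s + E Q s ⊗ₜ K Q s.castSucc) := by
  ext a b
  exact Q.Efun_mul s a b

lemma mulDual_mem (f : Borel Q) : mulDual k Q.A (incl Q f) ∈ (evTensorHom (incl Q)).range := by
  have h : Q.borelSub ≤ ((evTensorHom (incl Q)).range).comap (mulDual k Q.A) := by
    apply Algebra.adjoin_le
    rintro x ((⟨i, rfl⟩ | ⟨i, rfl⟩) | ⟨s, rfl⟩)
    · exact ⟨_, (mulDual_K Q i).symm⟩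
    · exact ⟨_, (mulDual_Kinv Q i).symm⟩
    · exact ⟨_, (mulDual_E Q s).symm⟩
  exact h f.2

/-- `B^l` is a bialgebra, with `Δ(f)(a ⊗ b) = f(ab)` and `ε(f) = f(1)`. -/
instance : Bialgebra k (Borel Q) := dualBialgebra (incl_injective Q) (mulDual_mem Q)

lemma evTensor_comul (f : Borel Q) :
    evTensorHom (incl Q) (Coalgebra.comul f) = mulDual k Q.A (incl Q f) :=
  evTensor_dualComul (incl_injective Q) (mulDual_mem Q) f

lemma comul_eq {f : Borel Q} {t : Borel Q ⊗[k] Borel Q}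
    (h : mulDual k Q.A (incl Q f) = evTensorHom (incl Q) t) : Coalgebra.comul f = t := by
  apply evTensor_injective (incl_injective Q)
  exact (evTensor_comul Q f).trans h

lemma comul_K (i : Fin (m + 1)) : Coalgebra.comul (K Q i) = K Q i ⊗ₜ[k] K Q i :=
  comul_eq Q (mulDual_K Q i)

lemma comul_Kinv (i : Fin (m + 1)) : Coalgebra.comul (Kinv Q i) = Kinv Q i ⊗ₜ[k] Kinv Q i :=
  comul_eq Q (mulDual_Kinv Q i)

lemma comul_E (s : Fin m) : Coalgebra.comul (E Q s) =
    K Q s.succ ⊗ₜ[k] E Q s + E Q s ⊗ₜ[k] K Q s.castSucc :=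
  comul_eq Q (mulDual_E Q s)

lemma isGroupLike_K (i : Fin (m + 1)) : IsGroupLikeElem k (K Q i) where
  counit_eq_one := map_one (Q.charHom (Q.kappa i))
  comul_eq_tmul_self := comul_K Q i

lemma isGroupLike_Kinv (i : Fin (m + 1)) : IsGroupLikeElem k (Kinv Q i) where
  counit_eq_one := map_one (Q.charHom fun j => (Q.kappa i j)⁻¹)
  comul_eq_tmul_self := comul_Kinv Q i

/-- Words in the generators with `n` letters `E`. -/
inductive Word : ℕ → Borel Q → Prop
  | one : Word 0 1
  | K {n x} (i : Fin (m + 1)) : Word n x → Word n (K Q i * x)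
  | Kinv {n x} (i : Fin (m + 1)) : Word n x → Word n (Kinv Q i * x)
  | E {n x} (s : Fin m) : Word n x → Word (n + 1) (E Q s * x)

/-- The span of the words with at most `n` letters `E`. -/
def wordFil (n : ℕ) : Submodule k (Borel Q) := Submodule.span k {x | ∃ l ≤ n, Word Q l x}

lemma wordFil_mono : Monotone (wordFil Q) := fun _ _ h =>
  Submodule.span_mono fun _ ⟨l, hl, hx⟩ => ⟨l, hl.trans h, hx⟩

lemma wordFil_zero :
    wordFil Q 0 ≤ Submodule.span k {g | IsGroupLikeElem k g ∧ IsUnit g} := by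
  apply Submodule.span_mono
  rintro x ⟨l, hl, hx⟩
  induction hx with
  | one => exact ⟨.one, isUnit_one⟩
  | K i _ ih =>
    exact ⟨(isGroupLike_K Q i).mul (ih hl).1, IsUnit.mul
      ⟨⟨_, _, K_mul_Kinv Q i, Kinv_mul_K Q i⟩, rfl⟩ (ih hl).2⟩
  | Kinv i _ ih =>
    exact ⟨(isGroupLike_Kinv Q i).mul (ih hl).1, IsUnit.mul
      ⟨⟨_, _, Kinv_mul_K Q i, K_mul_Kinv Q i⟩, rfl⟩ (ih hl).2⟩
  | E s _ ih => omega

lemma mul_wordFil {n n' : ℕ} (g : Borel Q) (hg : ∀ l x, Word Q l x → l ≤ n → g * x ∈ wordFil Q n')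
    {y : Borel Q} (hy : y ∈ wordFil Q n) : g * y ∈ wordFil Q n' := by
  induction hy using Submodule.span_induction with
  | mem x hx => exact hg _ x hx.choose_spec.2 hx.choose_spec.1
  | zero => simp
  | add x y _ _ hx hy => rw [mul_add]; exact add_mem hx hy
  | smul c x _ hx => rw [mul_smul_comm]; exact Submodule.smul_mem _ _ hx

lemma K_mul_wordFil {n : ℕ} (i : Fin (m + 1)) {y : Borel Q} (hy : y ∈ wordFil Q n) :
    K Q i * y ∈ wordFil Q n :=
  mul_wordFil Q _ (fun l _ h hl => Submodule.subset_span ⟨l, hl, h.K i⟩) hy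

lemma Kinv_mul_wordFil {n : ℕ} (i : Fin (m + 1)) {y : Borel Q} (hy : y ∈ wordFil Q n) :
    Kinv Q i * y ∈ wordFil Q n :=
  mul_wordFil Q _ (fun l _ h hl => Submodule.subset_span ⟨l, hl, h.Kinv i⟩) hy

lemma E_mul_wordFil {n : ℕ} (s : Fin m) {y : Borel Q} (hy : y ∈ wordFil Q n) :
    E Q s * y ∈ wordFil Q (n + 1) :=
  mul_wordFil Q _ (fun l _ h hl => Submodule.subset_span ⟨l + 1, by omega, h.E s⟩) hy

lemma mul_tensFil {n n' d e : ℕ} (g h : Borel Q)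
    (hg : ∀ l, ∀ y ∈ wordFil Q l, g * y ∈ wordFil Q (l + d))
    (hh : ∀ l, ∀ y ∈ wordFil Q l, h * y ∈ wordFil Q (l + e)) (hn : n + d + e = n')
    {t : Borel Q ⊗[k] Borel Q} (ht : t ∈ tensFil (wordFil Q) n) :
    (g ⊗ₜ[k] h) * t ∈ tensFil (wordFil Q) n' := by
  induction ht using Submodule.span_induction with
  | mem t ht =>
    obtain ⟨a, b, x, y, hab, hx, hy, rfl⟩ := ht
    rw [Algebra.TensorProduct.tmul_mul_tmul]
    exact Submodule.subset_span ⟨a + d, b + e, _, _, by omega, hg _ _ hx, hh _ _ hy, rfl⟩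
  | zero => simp
  | add x y _ _ hx hy => rw [mul_add]; exact add_mem hx hy
  | smul c x _ hx => rw [mul_smul_comm]; exact Submodule.smul_mem _ _ hx

lemma comul_word {n : ℕ} {x : Borel Q} (hx : Word Q n x) :
    Coalgebra.comul x ∈ tensFil (wordFil Q) n := by
  induction hx with
  | one =>
    rw [Bialgebra.comul_one]
    exact Submodule.subset_span ⟨0, 0, 1, 1, rfl, Submodule.subset_span ⟨0, le_rfl, .one⟩,
      Submodule.subset_span ⟨0, le_rfl, .one⟩, rfl⟩
  | K i _ ih =>
    rw [Bialgebra.comul_mul, comul_K]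
    exact mul_tensFil Q (d := 0) (e := 0) _ _ (fun _ _ => K_mul_wordFil Q i)
      (fun _ _ => K_mul_wordFil Q i) rfl ih
  | Kinv i _ ih =>
    rw [Bialgebra.comul_mul, comul_Kinv]
    exact mul_tensFil Q (d := 0) (e := 0) _ _ (fun _ _ => Kinv_mul_wordFil Q i)
      (fun _ _ => Kinv_mul_wordFil Q i) rfl ih
  | E s _ ih =>
    rw [Bialgebra.comul_mul, comul_E, add_mul]
    exact add_mem (mul_tensFil Q (d := 0) (e := 1) _ _ (fun _ _ => K_mul_wordFil Q _)
      (fun _ _ => E_mul_wordFil Q s) rfl ih) (mul_tensFil Q (d := 1) (e := 0) _ _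
      (fun _ _ => E_mul_wordFil Q s) (fun _ _ => K_mul_wordFil Q _) rfl ih)

lemma tensFil_wordFil_mono {n n' : ℕ} (h : n ≤ n') :
    tensFil (wordFil Q) n ≤ tensFil (wordFil Q) n' := by
  apply Submodule.span_mono
  rintro t ⟨a, b, x, y, hab, hx, hy, rfl⟩
  exact ⟨a, b + (n' - n), x, y, by omega, hx, wordFil_mono Q (by omega) hy, rfl⟩

lemma comul_wordFil (n : ℕ) (x : Borel Q) (hx : x ∈ wordFil Q n) :
    Coalgebra.comul x ∈ tensFil (wordFil Q) n := by
  induction hx using Submodule.span_induction with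
  | mem t ht =>
    obtain ⟨l, hl, hw⟩ := ht
    exact tensFil_wordFil_mono Q hl (comul_word Q hw)
  | zero => simp
  | add x y _ _ hx hy => rw [map_add]; exact add_mem hx hy
  | smul c x _ hx => rw [map_smul]; exact Submodule.smul_mem _ _ hx

lemma mul_mem_wordFil {l n : ℕ} {x y : Borel Q} (hx : x ∈ wordFil Q l) (hy : y ∈ wordFil Q n) :
    x * y ∈ wordFil Q (l + n) := by
  induction hx using Submodule.span_induction with
  | mem x hx =>
    obtain ⟨a, ha, hw⟩ := hx
    have key : x * y ∈ wordFil Q (a + n) := by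
      clear ha
      induction hw with
      | one => rw [one_mul, zero_add]; exact hy
      | K i _ ih => rw [mul_assoc]; exact K_mul_wordFil Q i ih
      | Kinv i _ ih => rw [mul_assoc]; exact Kinv_mul_wordFil Q i ih
      | E s _ ih => rw [mul_assoc, add_right_comm]; exact E_mul_wordFil Q s ih
    exact wordFil_mono Q (by omega) key
  | zero => simp
  | add x z _ _ hx hz => rw [add_mul]; exact add_mem hx hz
  | smul c x _ hx => rw [smul_mul_assoc]; exact Submodule.smul_mem _ _ hx

lemma one_mem_wordFil : 1 ∈ wordFil Q 0 := Submodule.subset_span ⟨0, le_rfl, .one⟩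

/-- The union of the filtration `wordFil`. -/
def wordUnion : Subalgebra k (Borel Q) where
  carrier := {x | ∃ n, x ∈ wordFil Q n}
  mul_mem' := fun ⟨l, hl⟩ ⟨n, hn⟩ => ⟨l + n, mul_mem_wordFil Q hl hn⟩
  add_mem' := fun ⟨l, hl⟩ ⟨n, hn⟩ => ⟨max l n, add_mem (wordFil_mono Q (le_max_left l n) hl)
    (wordFil_mono Q (le_max_right l n) hn)⟩
  algebraMap_mem' := fun c => ⟨0, by
    rw [Algebra.algebraMap_eq_smul_one]
    exact Submodule.smul_mem _ _ (one_mem_wordFil Q)⟩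

lemma exists_mem_wordFil (x : Borel Q) : ∃ n, x ∈ wordFil Q n := by
  have h : Q.borelSub ≤ (wordUnion Q).map (incl Q) := by
    apply Algebra.adjoin_le
    rintro x ((⟨i, rfl⟩ | ⟨i, rfl⟩) | ⟨s, rfl⟩)
    · refine ⟨K Q i, ⟨0, ?_⟩, rfl⟩
      rw [← mul_one (K Q i)]
      exact K_mul_wordFil Q i (one_mem_wordFil Q)
    · refine ⟨Kinv Q i, ⟨0, ?_⟩, rfl⟩
      rw [← mul_one (Kinv Q i)]
      exact Kinv_mul_wordFil Q i (one_mem_wordFil Q)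
    · refine ⟨E Q s, ⟨0 + 1, ?_⟩, rfl⟩
      rw [← mul_one (E Q s)]
      exact E_mul_wordFil Q s (one_mem_wordFil Q)
  obtain ⟨y, hy, hxy⟩ := h x.2
  rw [← incl_injective Q hxy]
  exact hy

/-- `B^l` is a Hopf algebra. -/
instance : HopfAlgebra k (Borel Q) :=
  hopfOfExists (exists_antipode (wordFil_mono Q) (comul_wordFil Q) (exists_mem_wordFil Q)
    (wordFil_zero Q))

end Borel

end Borel

/-! ### The coradical filtration -/

section Filtration

variable {k H : Type*} [Field k] [Ring H] [Bialgebra k H]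

variable (k H) in
/-- The span of the group-like elements, i.e. the group algebra of `G(H)` inside `H`. -/
def groupSpan : Submodule k H := Submodule.span k {g | IsGroupLikeElem k g}

/-- `Δ⁻¹(U ⊗ H + H ⊗ W)`, written as the kernel of `H → H ⊗ H → H/U ⊗ H/W`. -/
def wedge (U W : Submodule k H) : Submodule k H :=
  LinearMap.ker (TensorProduct.map U.mkQ W.mkQ ∘ₗ Coalgebra.comul)

variable (k H) in
/-- The coradical filtration of a pointed bialgebra, shifted by one: `corPre 0 = 0`,
`corPre 1 = k G(H)` and `corPre (n + 1) = Δ⁻¹(k G(H) ⊗ H + H ⊗ corPre n)`. -/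
def corPre : ℕ → Submodule k H
  | 0 => ⊥
  | 1 => groupSpan k H
  | n + 2 => wedge (groupSpan k H) (corPre (n + 1))

variable (k H) in
/-- The term `H_n` of the coradical filtration of a pointed bialgebra. -/
abbrev corFil (n : ℕ) : Submodule k H := corPre k H (n + 1)

lemma map_mkQ_ker_right {M N M' P : Type*} [AddCommGroup M] [Module k M] [AddCommGroup N]
    [Module k N] [AddCommGroup M'] [Module k M'] [AddCommGroup P] [Module k P]
    (g : M →ₗ[k] M') (f : N →ₗ[k] P) (t : M ⊗[k] N) :
    TensorProduct.map g (LinearMap.ker f).mkQ t = 0 ↔ TensorProduct.map g f t = 0 := by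
  have h : TensorProduct.map g f = (((LinearMap.ker f).liftQ f le_rfl).lTensor M') ∘ₗ
      TensorProduct.map g (LinearMap.ker f).mkQ := by
    rw [LinearMap.lTensor_comp_map, Submodule.liftQ_mkQ]
  rw [h, LinearMap.comp_apply]
  exact (map_eq_zero_iff _ (Module.Flat.lTensor_preserves_injective_linearMap _
    (LinearMap.ker_eq_bot.1 (Submodule.ker_liftQ_eq_bot _ _ _ le_rfl)))).symm

lemma map_mkQ_ker_left {M N M' P : Type*} [AddCommGroup M] [Module k M] [AddCommGroup N]
    [Module k N] [AddCommGroup M'] [Module k M'] [AddCommGroup P] [Module k P]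
    (g : M →ₗ[k] M') (f : N →ₗ[k] P) (t : N ⊗[k] M) :
    TensorProduct.map (LinearMap.ker f).mkQ g t = 0 ↔ TensorProduct.map f g t = 0 := by
  have h : TensorProduct.map f g = (((LinearMap.ker f).liftQ f le_rfl).rTensor M') ∘ₗ
      TensorProduct.map (LinearMap.ker f).mkQ g := by
    rw [LinearMap.rTensor_comp_map, Submodule.liftQ_mkQ]
  rw [h, LinearMap.comp_apply]
  exact (map_eq_zero_iff _ (Module.Flat.rTensor_preserves_injective_linearMap _
    (LinearMap.ker_eq_bot.1 (Submodule.ker_liftQ_eq_bot _ _ _ le_rfl)))).symm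

lemma mem_wedge {U W : Submodule k H} {x : H} :
    x ∈ wedge U W ↔ TensorProduct.map U.mkQ W.mkQ (Coalgebra.comul x) = 0 := Iff.rfl

lemma wedge_assoc (U V W : Submodule k H) : wedge (wedge U V) W = wedge U (wedge V W) := by
  ext x
  rw [mem_wedge, mem_wedge]
  unfold wedge
  rw [map_mkQ_ker_left, map_mkQ_ker_right]
  rw [← LinearMap.map_comp_rTensor, ← LinearMap.map_comp_lTensor, LinearMap.comp_apply,
    LinearMap.comp_apply, ← Coalgebra.coassoc_apply,
    ← (TensorProduct.assoc k (H ⧸ U) (H ⧸ V) (H ⧸ W)).map_eq_zero_iff]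
  rw [TensorProduct.map_map_assoc]

lemma wedge_mono {U U' W W' : Submodule k H} (hU : U ≤ U') (hW : W ≤ W') :
    wedge U W ≤ wedge U' W' := by
  intro x hx
  rw [mem_wedge] at *
  have : TensorProduct.map U'.mkQ W'.mkQ = TensorProduct.map (Submodule.factor hU)
      (Submodule.factor hW) ∘ₗ TensorProduct.map U.mkQ W.mkQ := by
    rw [← TensorProduct.map_comp, Submodule.factor_comp_mk, Submodule.factor_comp_mk]
  rw [this, LinearMap.comp_apply, hx, map_zero]

lemma wedge_bot_right_le (U : Submodule k H) : wedge U ⊥ ≤ U := by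
  intro x hx
  rw [mem_wedge] at hx
  have h : ∀ t : H ⊗[k] H, TensorProduct.rid k (H ⧸ U) (TensorProduct.map LinearMap.id
      ((⊥ : Submodule k H).liftQ Coalgebra.counit bot_le)
        (TensorProduct.map U.mkQ (⊥ : Submodule k H).mkQ t))
      = U.mkQ (TensorProduct.rid k H (Coalgebra.counit.lTensor H t)) := by
    intro t
    induction t with
    | zero => simp
    | tmul x y => simp
    | add x y hx hy => simp only [map_add, hx, hy]
  have h2 := h (Coalgebra.comul x)
  rw [hx, map_zero, map_zero, Coalgebra.lTensor_counit_comul] at h2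
  simpa using h2.symm

lemma wedge_bot_left_le (U : Submodule k H) : wedge ⊥ U ≤ U := by
  intro x hx
  rw [mem_wedge] at hx
  have h : ∀ t : H ⊗[k] H, TensorProduct.lid k (H ⧸ U) (TensorProduct.map
      ((⊥ : Submodule k H).liftQ Coalgebra.counit bot_le) LinearMap.id
        (TensorProduct.map (⊥ : Submodule k H).mkQ U.mkQ t))
      = U.mkQ (TensorProduct.lid k H (Coalgebra.counit.rTensor H t)) := by
    intro t
    induction t with
    | zero => simp
    | tmul x y => simp
    | add x y hx hy => simp only [map_add, hx, hy]
  have h2 := h (Coalgebra.comul x)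
  rw [hx, map_zero, map_zero, Coalgebra.rTensor_counit_comul] at h2
  simpa using h2.symm

lemma wedge_group_bot : wedge (groupSpan k H) ⊥ = groupSpan k H := by
  apply le_antisymm (wedge_bot_right_le _)
  refine Submodule.span_le.2 fun g hg => ?_
  have h1 : (groupSpan k H).mkQ g = 0 := by
    rw [Submodule.mkQ_apply, Submodule.Quotient.mk_eq_zero]
    exact Submodule.subset_span hg
  rw [SetLike.mem_coe, mem_wedge, IsGroupLikeElem.comul_eq_tmul_self hg, TensorProduct.map_tmul,
    h1, TensorProduct.zero_tmul]

lemma wedge_bot_group : wedge ⊥ (groupSpan k H) = groupSpan k H := by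
  apply le_antisymm (wedge_bot_left_le _)
  refine Submodule.span_le.2 fun g hg => ?_
  have h1 : (groupSpan k H).mkQ g = 0 := by
    rw [Submodule.mkQ_apply, Submodule.Quotient.mk_eq_zero]
    exact Submodule.subset_span hg
  rw [SetLike.mem_coe, mem_wedge, IsGroupLikeElem.comul_eq_tmul_self hg, TensorProduct.map_tmul,
    h1, TensorProduct.tmul_zero]

lemma corPre_succ (n : ℕ) : corPre k H (n + 1) = wedge (groupSpan k H) (corPre k H n) := by
  cases n with
  | zero => exact wedge_group_bot.symm
  | succ n => rfl

lemma wedge_bot_corPre (n : ℕ) : wedge ⊥ (corPre k H n) = corPre k H n := by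
  cases n with
  | zero => exact le_antisymm (wedge_bot_left_le _) bot_le
  | succ n => rw [corPre_succ, ← wedge_assoc, wedge_bot_group]

lemma corPre_add (i j : ℕ) : corPre k H (i + j) = wedge (corPre k H i) (corPre k H j) := by
  induction i with
  | zero => rw [zero_add]; exact (wedge_bot_corPre j).symm
  | succ i ih => rw [add_right_comm, corPre_succ, ih, corPre_succ, wedge_assoc]

lemma corPre_mono : Monotone (corPre k H) := by
  apply monotone_nat_of_le_succ
  intro n
  conv_lhs => rw [← wedge_bot_corPre n]
  rw [corPre_succ]
  exact wedge_mono bot_le le_rfl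

variable (k H) in
/-- The subquotient `H_n / H_{n-1}`. -/
def Piece (n : ℕ) : Type _ :=
  corFil k H n ⧸ (corPre k H n).comap (corFil k H n).subtype

instance (n : ℕ) : AddCommGroup (Piece k H n) :=
  inferInstanceAs (AddCommGroup (corFil k H n ⧸ (corPre k H n).comap (corFil k H n).subtype))

instance (n : ℕ) : Module k (Piece k H n) :=
  inferInstanceAs (Module k (corFil k H n ⧸ (corPre k H n).comap (corFil k H n).subtype))

variable (k H) in
/-- The inclusion `H_n / H_{n-1} → H / H_{n-1}`. -/
def pieceIncl (n : ℕ) : Piece k H n →ₗ[k] H ⧸ corPre k H n :=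
  Submodule.mapQ _ _ (corFil k H n).subtype le_rfl

variable (k H) in
/-- The class in `H_n / H_{n-1}` of an element of `H_n`. -/
def pieceMk (n : ℕ) : corFil k H n →ₗ[k] Piece k H n :=
  ((corPre k H n).comap (corFil k H n).subtype).mkQ

lemma pieceMk_surjective (n : ℕ) : Function.Surjective (pieceMk k H n) :=
  Submodule.mkQ_surjective ((corPre k H n).comap (corFil k H n).subtype)

lemma pieceMk_eq_zero {n : ℕ} {x : corFil k H n} (h : x.1 ∈ corPre k H n) :
    pieceMk k H n x = 0 :=
  (Submodule.Quotient.mk_eq_zero ((corPre k H n).comap (corFil k H n).subtype)).2 h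

lemma pieceIncl_mk (n : ℕ) (x : corFil k H n) :
    pieceIncl k H n (pieceMk k H n x) = (corPre k H n).mkQ x.1 := rfl

lemma pieceIncl_injective (n : ℕ) : Function.Injective (pieceIncl k H n) := by
  rw [injective_iff_map_eq_zero]
  intro x hx
  obtain ⟨x, rfl⟩ := pieceMk_surjective n x
  rw [pieceIncl_mk] at hx
  exact pieceMk_eq_zero (by simpa using hx)

lemma pieceIncl_exact (n : ℕ) : Function.Exact (pieceIncl k H n)
    (Submodule.factor (corPre_mono (k := k) (H := H) n.le_succ)) := by
  intro x
  obtain ⟨x, rfl⟩ := Submodule.mkQ_surjective _ x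
  constructor
  · intro hx
    have hx' : x ∈ corPre k H (n + 1) := by simpa using hx
    exact ⟨pieceMk k H n ⟨x, hx'⟩, rfl⟩
  · rintro ⟨y, hy⟩
    obtain ⟨y, rfl⟩ := pieceMk_surjective n y
    rw [← hy]
    change (corPre k H (n + 1)).mkQ y.1 = 0
    simp

lemma exists_of_map_eq_zero {i j : ℕ} {t : H ⊗[k] H}
    (h1 : TensorProduct.map (corPre k H (i + 1)).mkQ (corPre k H j).mkQ t = 0)
    (h2 : TensorProduct.map (corPre k H i).mkQ (corPre k H (j + 1)).mkQ t = 0) :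
    ∃ s : corFil k H i ⊗[k] corFil k H j,
      TensorProduct.map (corPre k H i).mkQ (corPre k H j).mkQ
        (TensorProduct.map (corFil k H i).subtype (corFil k H j).subtype s)
      = TensorProduct.map (corPre k H i).mkQ (corPre k H j).mkQ t := by
  set fi := Submodule.factor (corPre_mono (k := k) (H := H) i.le_succ) with hfi
  set fj := Submodule.factor (corPre_mono (k := k) (H := H) j.le_succ) with hfj
  set T := TensorProduct.map (corPre k H i).mkQ (corPre k H j).mkQ t with hT
  have e1 : fi.rTensor _ T = 0 := by
    rw [hT, ← LinearMap.comp_apply, LinearMap.rTensor_comp_map, hfi, Submodule.factor_comp_mk]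
    exact h1
  have e2 : fj.lTensor _ T = 0 := by
    rw [hT, ← LinearMap.comp_apply, LinearMap.lTensor_comp_map, hfj, Submodule.factor_comp_mk]
    exact h2
  obtain ⟨s, hs⟩ := (rTensor_exact (H ⧸ corPre k H j) (pieceIncl_exact (k := k) (H := H) i)
    (Submodule.factor_surjective _) T).1 e1
  have e3 : fj.lTensor _ s = 0 := by
    apply Module.Flat.rTensor_preserves_injective_linearMap (M := H ⧸ corPre k H (j + 1)) _
      (pieceIncl_injective (k := k) (H := H) i)
    rw [map_zero, ← e2, ← hs, ← LinearMap.comp_apply, ← LinearMap.comp_apply,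
      LinearMap.lTensor_comp_rTensor, LinearMap.rTensor_comp_lTensor]
  obtain ⟨u, hu⟩ := (lTensor_exact (Piece k H i) (pieceIncl_exact (k := k) (H := H) j)
    (Submodule.factor_surjective _) s).1 e3
  obtain ⟨v, rfl⟩ := TensorProduct.map_surjective
    (pieceMk_surjective (k := k) (H := H) i) (pieceMk_surjective (k := k) (H := H) j) u
  refine ⟨v, ?_⟩
  rw [← hs, ← hu]
  rw [← LinearMap.comp_apply, ← LinearMap.comp_apply, ← LinearMap.comp_apply,
    ← TensorProduct.map_comp, LinearMap.rTensor_comp_lTensor, ← TensorProduct.map_comp]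
  rfl

lemma map_mkQ_subtype {i j a b : ℕ} (h : i < a ∨ j < b) (s : corFil k H i ⊗[k] corFil k H j) :
    TensorProduct.map (corPre k H a).mkQ (corPre k H b).mkQ
        (TensorProduct.map (corFil k H i).subtype (corFil k H j).subtype s) = 0 := by
  induction s with
  | zero => simp
  | add x y hx hy => simp only [map_add, hx, hy, add_zero]
  | tmul x y =>
    rcases h with h | h
    · have : (corPre k H a).mkQ x.1 = 0 := by simpa using corPre_mono h x.2
      simp only [TensorProduct.map_tmul, Submodule.subtype_apply, this, TensorProduct.zero_tmul]
    · have : (corPre k H b).mkQ y.1 = 0 := by simpa using corPre_mono h y.2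
      simp only [TensorProduct.map_tmul, Submodule.subtype_apply, this, TensorProduct.tmul_zero]

variable (k H) in
/-- The subspace `∑_{a + b + 1 = n} H_a ⊗ H_b`. -/
def tensPre (n : ℕ) : Submodule k (H ⊗[k] H) :=
  Submodule.span k {t | ∃ a b x y, a + b + 1 = n ∧ x ∈ corFil k H a ∧ y ∈ corFil k H b ∧
    t = x ⊗ₜ[k] y}

lemma tensPre_le (n : ℕ) : tensPre k H n ≤ tensPre k H (n + 1) := by
  apply Submodule.span_mono
  rintro t ⟨a, b, x, y, h, hx, hy, rfl⟩
  exact ⟨a, b + 1, x, y, by omega, hx, corPre_mono (by omega) hy, rfl⟩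

lemma mem_tensPre (n : ℕ) : ∀ t : H ⊗[k] H, (∀ i j, i + j = n →
    TensorProduct.map (corPre k H i).mkQ (corPre k H j).mkQ t = 0) → t ∈ tensPre k H n := by
  induction n with
  | zero =>
    intro t ht
    have h := ht 0 0 rfl
    have hinj : Function.Injective (corPre k H 0).mkQ := by
      rw [← LinearMap.ker_eq_bot, Submodule.ker_mkQ]
      rfl
    have : t = 0 := map_injective_of_injective _ _ hinj hinj (by rw [h, map_zero])
    rw [this]
    exact zero_mem _
  | succ n ih =>
    intro t ht
    have hs : ∀ p : ℕ × ℕ, ∃ s : corFil k H p.1 ⊗[k] corFil k H p.2, p.1 + p.2 = n →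
      TensorProduct.map (corPre k H p.1).mkQ (corPre k H p.2).mkQ
        (TensorProduct.map (corFil k H p.1).subtype (corFil k H p.2).subtype s)
      = TensorProduct.map (corPre k H p.1).mkQ (corPre k H p.2).mkQ t := by
      rintro ⟨i, j⟩
      by_cases hij : i + j = n
      · obtain ⟨s, hs⟩ := exists_of_map_eq_zero (ht (i + 1) j (by omega)) (ht i (j + 1) (by omega))
        exact ⟨s, fun _ => hs⟩
      · exact ⟨0, fun h => absurd h hij⟩
    choose s hs using hs
    set u := ∑ p ∈ Finset.HasAntidiagonal.antidiagonal n,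
      TensorProduct.map (corFil k H p.1).subtype (corFil k H p.2).subtype (s p) with hu
    have hw : t - u ∈ tensPre k H n := by
      apply ih
      intro i j hij
      rw [map_sub, hu, map_sum, Finset.sum_eq_single (i, j), hs (i, j) hij, sub_self]
      · rintro ⟨a, b⟩ hab hne
        rw [Finset.HasAntidiagonal.mem_antidiagonal] at hab
        apply map_mkQ_subtype
        rw [Ne, Prod.mk.injEq] at hne
        simp only at hab ⊢
        omega
      · intro h
        exact absurd (Finset.HasAntidiagonal.mem_antidiagonal.2 hij) h
    have hu' : u ∈ tensPre k H (n + 1) := by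
      apply Submodule.sum_mem
      rintro ⟨a, b⟩ hab
      rw [Finset.HasAntidiagonal.mem_antidiagonal] at hab
      simp only at hab
      generalize s (a, b) = v
      induction v with
      | zero => simp
      | add x y hx hy => rw [map_add]; exact add_mem hx hy
      | tmul x y => exact Submodule.subset_span ⟨a, b, x, y, by omega, x.2, y.2, rfl⟩
    rw [← sub_add_cancel t u]
    exact add_mem (tensPre_le n hw) hu'

/-- `Δ(H_n) ⊆ ∑_{a + b = n} H_a ⊗ H_b`. -/
lemma comul_mem_tensPre {n : ℕ} {x : H} (hx : x ∈ corFil k H n) :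
    Coalgebra.comul x ∈ tensPre k H (n + 1) := by
  apply mem_tensPre
  intro i j hij
  rw [corFil, ← hij, corPre_add] at hx
  exact hx

lemma one_mem_corFil : (1 : H) ∈ corFil k H 0 :=
  Submodule.subset_span (IsGroupLikeElem.one (R := k))

lemma group_mul_mem {x y : H} (hx : x ∈ groupSpan k H) (hy : y ∈ groupSpan k H) :
    x * y ∈ groupSpan k H := by
  induction hx using Submodule.span_induction with
  | zero => simp
  | add a b _ _ ha hb => rw [add_mul]; exact add_mem ha hb
  | smul c a _ ha => rw [smul_mul_assoc]; exact Submodule.smul_mem _ _ ha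
  | mem g hg =>
    induction hy using Submodule.span_induction with
    | zero => simp
    | add a b _ _ ha hb => rw [mul_add]; exact add_mem ha hb
    | smul c a _ ha => rw [mul_smul_comm]; exact Submodule.smul_mem _ _ ha
    | mem h hh => exact Submodule.subset_span (IsGroupLikeElem.mul hg hh)

/-- The coradical filtration is multiplicative. -/
lemma mul_mem_corFil {i j : ℕ} {x y : H} (hx : x ∈ corFil k H i) (hy : y ∈ corFil k H j) :
    x * y ∈ corFil k H (i + j) := by
  obtain ⟨n, hn⟩ : ∃ n, i + j = n := ⟨_, rfl⟩
  induction n using Nat.strong_induction_on generalizing i j x y with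
  | _ n ih =>
  have hx' := comul_mem_tensPre hx
  have hy' := comul_mem_tensPre hy
  rw [corFil, hn, corPre_succ, mem_wedge, Bialgebra.comul_mul]
  generalize Coalgebra.comul (R := k) x = s at hx'
  generalize Coalgebra.comul (R := k) y = t at hy'
  induction hx' using Submodule.span_induction with
  | zero => simp
  | add a b _ _ ha hb => rw [add_mul, map_add, ha, hb, add_zero]
  | smul c a _ ha => rw [smul_mul_assoc, map_smul, ha, smul_zero]
  | mem s hs =>
    obtain ⟨a, b, x, y, hab, hx, hy, rfl⟩ := hs
    induction hy' using Submodule.span_induction with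
    | zero => simp
    | add a b _ _ ha hb => rw [mul_add, map_add, ha, hb, add_zero]
    | smul c a _ ha => rw [mul_smul_comm, map_smul, ha, smul_zero]
    | mem t ht =>
      obtain ⟨c, d, z, w, hcd, hz, hw, rfl⟩ := ht
      rw [Algebra.TensorProduct.tmul_mul_tmul, TensorProduct.map_tmul]
      by_cases hbd : b + d < n
      · have h := corPre_mono (by omega : b + d + 1 ≤ n) (ih _ hbd hy hw rfl)
        have h' : (corPre k H n).mkQ (y * w) = 0 := by simpa using h
        rw [h', TensorProduct.tmul_zero]
      · obtain rfl : a = 0 := by omega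
        obtain rfl : c = 0 := by omega
        have h' : (groupSpan k H).mkQ (x * z) = 0 := by simpa using group_mul_mem hx hz
        rw [h', TensorProduct.zero_tmul]

end Filtration

/-! ### The associated graded Hopf algebra -/

section Graded

variable {k H : Type*} [Field k] [Ring H] [Bialgebra k H]

lemma mk_pieceMk {n l : ℕ} (h : n = l) {x : corFil k H n} {y : corFil k H l} (hxy : x.1 = y.1) :
    (GradedMonoid.mk n (pieceMk k H n x) : GradedMonoid (Piece k H))
      = GradedMonoid.mk l (pieceMk k H l y) := by
  subst h
  rw [Subtype.ext hxy]

lemma mul_mem_corPre_left {i j : ℕ} {x y : H} (hx : x ∈ corPre k H i) (hy : y ∈ corFil k H j) :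
    x * y ∈ corPre k H (i + j) := by
  cases i with
  | zero =>
    obtain rfl : x = 0 := hx
    rw [zero_mul]
    exact zero_mem _
  | succ i =>
    rw [add_right_comm]
    exact mul_mem_corFil hx hy

lemma mul_mem_corPre_right {i j : ℕ} {x y : H} (hx : x ∈ corFil k H i) (hy : y ∈ corPre k H j) :
    x * y ∈ corPre k H (i + j) := by
  cases j with
  | zero =>
    obtain rfl : y = 0 := hy
    rw [mul_zero]
    exact zero_mem _
  | succ j => exact mul_mem_corFil hx hy

variable (k H) in
/-- The multiplication `H_i × H_j → H_{i+j} / H_{i+j-1}`. -/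
def filMul (i j : ℕ) : corFil k H i →ₗ[k] corFil k H j →ₗ[k] Piece k H (i + j) :=
  LinearMap.mk₂ k (fun x y => pieceMk k H (i + j) ⟨x.1 * y.1, mul_mem_corFil x.2 y.2⟩)
    (fun x x' y => by rw [← map_add]; congr 1; exact Subtype.ext (add_mul _ _ _))
    (fun c x y => by rw [← map_smul]; congr 1; exact Subtype.ext (smul_mul_assoc _ _ _))
    (fun x y y' => by rw [← map_add]; congr 1; exact Subtype.ext (mul_add _ _ _))
    (fun c x y => by rw [← map_smul]; congr 1; exact Subtype.ext (mul_smul_comm _ _ _))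

variable (k H) in
/-- The multiplication of the associated graded algebra on homogeneous elements. -/
def pieceMul (i j : ℕ) : Piece k H i →ₗ[k] Piece k H j →ₗ[k] Piece k H (i + j) :=
  ((corPre k H i).comap (corFil k H i).subtype).liftQ
    (LinearMap.flip (((corPre k H j).comap (corFil k H j).subtype).liftQ (filMul k H i j).flip
      (fun y hy => by
        ext x
        exact pieceMk_eq_zero (mul_mem_corPre_right x.2 hy))))
    (fun x hx => by
      refine LinearMap.ext fun y => ?_
      obtain ⟨y, rfl⟩ := pieceMk_surjective j y
      exact pieceMk_eq_zero (mul_mem_corPre_left hx y.2))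

lemma pieceMul_mk {i j : ℕ} (x : corFil k H i) (y : corFil k H j) :
    pieceMul k H i j (pieceMk k H i x) (pieceMk k H j y)
      = pieceMk k H (i + j) ⟨x.1 * y.1, mul_mem_corFil x.2 y.2⟩ := rfl

instance : GradedMonoid.GMul (Piece k H) where
  mul {i j} x y := pieceMul k H i j x y

instance : GradedMonoid.GOne (Piece k H) where
  one := pieceMk k H 0 ⟨1, one_mem_corFil⟩

instance : GradedMonoid.GMonoid (Piece k H) where
  one_mul := by
    rintro ⟨n, x⟩
    obtain ⟨x, rfl⟩ := pieceMk_surjective n x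
    exact mk_pieceMk (zero_add n) (one_mul _)
  mul_one := by
    rintro ⟨n, x⟩
    obtain ⟨x, rfl⟩ := pieceMk_surjective n x
    exact mk_pieceMk (add_zero n) (mul_one _)
  mul_assoc := by
    rintro ⟨n, x⟩ ⟨l, y⟩ ⟨q, z⟩
    obtain ⟨x, rfl⟩ := pieceMk_surjective n x
    obtain ⟨y, rfl⟩ := pieceMk_surjective l y
    obtain ⟨z, rfl⟩ := pieceMk_surjective q z
    exact mk_pieceMk (add_assoc n l q) (mul_assoc _ _ _)

instance : DirectSum.GRing (Piece k H) where
  mul_zero {i j} x := map_zero (pieceMul k H i j x)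
  zero_mul {i j} y := LinearMap.map_zero₂ (pieceMul k H i j) y
  mul_add {i j} x := map_add (pieceMul k H i j x)
  add_mul {i j} x x' y := LinearMap.map_add₂ (pieceMul k H i j) x x' y
  natCast n := n • pieceMk k H 0 ⟨1, one_mem_corFil⟩
  natCast_zero := zero_nsmul _
  natCast_succ n := succ_nsmul _ n
  intCast n := n • pieceMk k H 0 ⟨1, one_mem_corFil⟩
  intCast_ofNat n := natCast_zsmul _ n
  intCast_negSucc_ofNat n := negSucc_zsmul _ n

instance : DirectSum.GAlgebra k (Piece k H) where
  toFun := (LinearMap.toSpanSingleton k _ (pieceMk k H 0 ⟨1, one_mem_corFil⟩)).toAddMonoidHom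
  map_one := one_smul k (pieceMk k H 0 ⟨1, one_mem_corFil⟩)
  map_mul r s := by
    change GradedMonoid.mk 0 ((r * s) • pieceMk k H 0 ⟨1, one_mem_corFil⟩) =
      GradedMonoid.mk (0 + 0) (pieceMul k H 0 0 (r • pieceMk k H 0 ⟨1, one_mem_corFil⟩)
        (s • pieceMk k H 0 ⟨1, one_mem_corFil⟩))
    rw [map_smul, map_smul, LinearMap.smul_apply, pieceMul_mk, ← map_smul, ← map_smul, ← map_smul]
    refine mk_pieceMk rfl ?_
    simp [smul_smul, mul_comm]
  commutes := by
    rintro r ⟨n, x⟩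
    obtain ⟨x, rfl⟩ := pieceMk_surjective n x
    change GradedMonoid.mk (0 + n) (pieceMul k H 0 n (r • pieceMk k H 0 ⟨1, one_mem_corFil⟩)
        (pieceMk k H n x)) = GradedMonoid.mk (n + 0) (pieceMul k H n 0
        (pieceMk k H n x) (r • pieceMk k H 0 ⟨1, one_mem_corFil⟩))
    rw [map_smul, LinearMap.smul_apply, map_smul, pieceMul_mk, pieceMul_mk, ← map_smul,
      ← map_smul]
    refine mk_pieceMk (by omega) ?_
    simp
  smul_def := by
    rintro r ⟨n, x⟩
    obtain ⟨x, rfl⟩ := pieceMk_surjective n x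
    change GradedMonoid.mk n (r • pieceMk k H n x) = GradedMonoid.mk (0 + n)
      (pieceMul k H 0 n (r • pieceMk k H 0 ⟨1, one_mem_corFil⟩) (pieceMk k H n x))
    rw [map_smul, LinearMap.smul_apply, pieceMul_mk, ← map_smul, ← map_smul]
    refine mk_pieceMk (by omega) ?_
    simp

variable (k H) in
/-- The associated graded space `gr H = ⨁ₙ H_n / H_{n-1}` of the coradical filtration. -/
def Gr : Type _ := DirectSum ℕ (Piece k H)

instance : Ring (Gr k H) := inferInstanceAs (Ring (DirectSum ℕ (Piece k H)))
instance : Algebra k (Gr k H) := inferInstanceAs (Algebra k (DirectSum ℕ (Piece k H)))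

namespace Gr

variable (k H) in
/-- The class in degree `n` of an element of `H_n`. -/
def cls (n : ℕ) : corFil k H n →ₗ[k] Gr k H :=
  DirectSum.lof k ℕ (Piece k H) n ∘ₗ pieceMk k H n

lemma cls_mul {i j : ℕ} (x : corFil k H i) (y : corFil k H j) :
    cls k H i x * cls k H j y = cls k H (i + j) ⟨x.1 * y.1, mul_mem_corFil x.2 y.2⟩ :=
  DirectSum.of_mul_of _ _

lemma cls_one : cls k H 0 ⟨1, one_mem_corFil⟩ = 1 := rfl

lemma induction {P : Gr k H → Prop} (h : ∀ n x, P (cls k H n x)) (h0 : P 0)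
    (hadd : ∀ x y, P x → P y → P (x + y)) (x : Gr k H) : P x := by
  induction x using DirectSum.induction_on with
  | zero => exact h0
  | of n x =>
    obtain ⟨x, rfl⟩ := pieceMk_surjective n x
    exact h n x
  | add x y hx hy => exact hadd x y hx hy

lemma linearMap_ext {M : Type*} [AddCommGroup M] [Module k M] {f g : Gr k H →ₗ[k] M}
    (h : ∀ n x, f (cls k H n x) = g (cls k H n x)) : f = g := by
  ext x
  induction x using Gr.induction with
  | h n x => exact h n x
  | h0 => simp
  | hadd x y hx hy => simp only [map_add, hx, hy]

variable (k H) in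
/-- The degree `i` component, as a map `gr H → H / H_{i-1}`. -/
def comp (i : ℕ) : Gr k H →ₗ[k] H ⧸ corPre k H i :=
  pieceIncl k H i ∘ₗ DirectSum.component k ℕ (Piece k H) i

lemma comp_cls (i n : ℕ) (x : corFil k H n) :
    comp k H i (cls k H n x) = if i = n then (corPre k H i).mkQ x.1 else 0 := by
  by_cases h : i = n
  · subst h
    rw [if_pos rfl]
    change pieceIncl k H i (DirectSum.component k ℕ (Piece k H) i
      (DirectSum.lof k ℕ (Piece k H) i (pieceMk k H i x))) = _
    rw [DirectSum.component.lof_self]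
    rfl
  · rw [if_neg h]
    change pieceIncl k H i (DirectSum.component k ℕ (Piece k H) i
      (DirectSum.lof k ℕ (Piece k H) n (pieceMk k H n x))) = _
    rw [DirectSum.component.of, dif_neg (Ne.symm h), map_zero]

lemma eq_zero_of_comp (x : Gr k H) (h : ∀ i, comp k H i x = 0) : x = 0 := by
  apply DirectSum.ext_component k
  intro i
  apply pieceIncl_injective (k := k) (H := H) i
  exact (h i).trans (map_zero (comp k H i)).symm

variable (k H) in
/-- The map `H / H_{i+j-1} → H / H_{i-1} ⊗ H / H_{j-1}` induced by `Δ`. -/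
def delta (i j : ℕ) :
    (H ⧸ corPre k H (i + j)) →ₗ[k] (H ⧸ corPre k H i) ⊗[k] (H ⧸ corPre k H j) :=
  (corPre k H (i + j)).liftQ
    (TensorProduct.map (corPre k H i).mkQ (corPre k H j).mkQ ∘ₗ Coalgebra.comul)
    (corPre_add i j).le

lemma delta_mk (i j : ℕ) (x : H) : delta k H i j ((corPre k H (i + j)).mkQ x) =
    TensorProduct.map (corPre k H i).mkQ (corPre k H j).mkQ (Coalgebra.comul x) := rfl

variable (k H) in
/-- All components of an element of `gr H ⊗ gr H`. -/
def tensComp : Gr k H ⊗[k] Gr k H →ₗ[k]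
    ∀ a : ℕ × ℕ, (H ⧸ corPre k H a.1) ⊗[k] (H ⧸ corPre k H a.2) :=
  LinearMap.pi fun a => TensorProduct.map (comp k H a.1) (comp k H a.2)

variable (k H) in
/-- The components of the comultiplication of `gr H`. -/
def deltaComp : Gr k H →ₗ[k]
    ∀ a : ℕ × ℕ, (H ⧸ corPre k H a.1) ⊗[k] (H ⧸ corPre k H a.2) :=
  LinearMap.pi fun a => delta k H a.1 a.2 ∘ₗ comp k H (a.1 + a.2)

lemma tensComp_injective : Function.Injective (tensComp k H) := by
  rw [injective_iff_map_eq_zero]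
  intro t ht
  exact eq_zero_of_map (comp k H) (comp k H) eq_zero_of_comp eq_zero_of_comp t
    fun i j => congrFun ht (i, j)

variable (k H) in
/-- The span of the pairs `(x ⊗ y, [x] ⊗ [y])` with `x ∈ H_a`, `y ∈ H_b` and `a + b = n`. -/
def lifts (n : ℕ) : Submodule k ((H ⊗[k] H) × (Gr k H ⊗[k] Gr k H)) :=
  Submodule.span k {t | ∃ a b, ∃ x : corFil k H a, ∃ y : corFil k H b, a + b = n ∧
    t = (x.1 ⊗ₜ[k] y.1, cls k H a x ⊗ₜ[k] cls k H b y)}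

lemma map_comp_of_lifts {n : ℕ} {t : (H ⊗[k] H) × (Gr k H ⊗[k] Gr k H)} (ht : t ∈ lifts k H n)
    (i j : ℕ) : TensorProduct.map (comp k H i) (comp k H j) t.2 = if i + j = n then
      TensorProduct.map (corPre k H i).mkQ (corPre k H j).mkQ t.1 else 0 := by
  induction ht using Submodule.span_induction with
  | zero => simp
  | add s t _ _ hs ht =>
    rw [Prod.snd_add, Prod.fst_add, map_add, map_add, hs, ht]
    split_ifs <;> simp
  | smul c t _ ht =>
    rw [Prod.smul_snd, Prod.smul_fst, map_smul, map_smul, ht]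
    split_ifs <;> simp
  | mem t ht =>
    obtain ⟨a, b, x, y, hab, rfl⟩ := ht
    simp only [TensorProduct.map_tmul, comp_cls]
    by_cases h1 : i = a
    · by_cases h2 : j = b
      · rw [if_pos h1, if_pos h2, if_pos (by omega)]
      · rw [if_pos h1, if_neg h2, TensorProduct.tmul_zero, if_neg (by omega)]
    · rw [if_neg h1, TensorProduct.zero_tmul]
      split_ifs with h
      · rcases lt_or_gt_of_ne h1 with h3 | h3
        · have : (corPre k H j).mkQ y.1 = 0 := by
            simpa using corPre_mono (by omega : b + 1 ≤ j) y.2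
          rw [this, TensorProduct.tmul_zero]
        · have : (corPre k H i).mkQ x.1 = 0 := by
            simpa using corPre_mono (by omega : a + 1 ≤ i) x.2
          rw [this, TensorProduct.zero_tmul]
      · rfl

lemma exists_lift {n : ℕ} {t : H ⊗[k] H} (ht : t ∈ tensPre k H (n + 1)) :
    ∃ T, (t, T) ∈ lifts k H n := by
  induction ht using Submodule.span_induction with
  | zero => exact ⟨0, zero_mem _⟩
  | add s t _ _ hs ht =>
    obtain ⟨S, hS⟩ := hs
    obtain ⟨T, hT⟩ := ht
    exact ⟨S + T, add_mem hS hT⟩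
  | smul c t _ ht =>
    obtain ⟨T, hT⟩ := ht
    exact ⟨c • T, Submodule.smul_mem _ c hT⟩
  | mem t ht =>
    obtain ⟨a, b, x, y, hab, hx, hy, rfl⟩ := ht
    exact ⟨_, Submodule.subset_span ⟨a, b, ⟨x, hx⟩, ⟨y, hy⟩, by omega, rfl⟩⟩

lemma tensComp_of_lifts {n : ℕ} {x : corFil k H n} {T : Gr k H ⊗[k] Gr k H}
    (h : (Coalgebra.comul x.1, T) ∈ lifts k H n) :
    tensComp k H T = deltaComp k H (cls k H n x) := by
  funext a
  change TensorProduct.map (comp k H a.1) (comp k H a.2) T =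
    delta k H a.1 a.2 (comp k H (a.1 + a.2) (cls k H n x))
  rw [map_comp_of_lifts h a.1 a.2, comp_cls]
  split_ifs
  · rfl
  · simp

lemma deltaComp_mem (x : Gr k H) : deltaComp k H x ∈ LinearMap.range (tensComp k H) := by
  induction x using Gr.induction with
  | h n x =>
    obtain ⟨T, hT⟩ := exists_lift (comul_mem_tensPre x.2)
    exact ⟨T, tensComp_of_lifts hT⟩
  | h0 => rw [map_zero]; exact zero_mem _
  | hadd x y hx hy => rw [map_add]; exact add_mem hx hy

variable (k H) in
/-- The comultiplication of `gr H`: the component of `Δ[x]`, `x ∈ H_n`, in bidegree `(i, j)` with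
`i + j = n` is the class of `Δ(x)`, and the other components vanish. -/
def comulGr : Gr k H →ₗ[k] Gr k H ⊗[k] Gr k H :=
  (LinearEquiv.ofInjective (tensComp k H) tensComp_injective).symm.toLinearMap ∘ₗ
    (deltaComp k H).codRestrict (LinearMap.range (tensComp k H)) deltaComp_mem

lemma tensComp_comulGr (x : Gr k H) : tensComp k H (comulGr k H x) = deltaComp k H x :=
  congrArg Subtype.val ((LinearEquiv.ofInjective (tensComp k H)
    tensComp_injective).apply_symm_apply
      ((deltaComp k H).codRestrict (LinearMap.range (tensComp k H)) deltaComp_mem x))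

lemma map_comp_comulGr (i j : ℕ) (x : Gr k H) :
    TensorProduct.map (comp k H i) (comp k H j) (comulGr k H x)
      = delta k H i j (comp k H (i + j) x) := congrFun (tensComp_comulGr x) (i, j)

lemma comulGr_of_lifts {n : ℕ} {x : corFil k H n} {T : Gr k H ⊗[k] Gr k H}
    (h : (Coalgebra.comul x.1, T) ∈ lifts k H n) : comulGr k H (cls k H n x) = T :=
  tensComp_injective ((tensComp_comulGr _).trans (tensComp_of_lifts h).symm)

lemma comul_mem_lifts {n : ℕ} (x : corFil k H n) :
    (Coalgebra.comul x.1, comulGr k H (cls k H n x)) ∈ lifts k H n := by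
  obtain ⟨T, hT⟩ := exists_lift (comul_mem_tensPre x.2)
  rwa [comulGr_of_lifts hT]

variable (k H) in
/-- The counit of `gr H`: the counit of `H` in degree `0`, and zero in positive degrees. -/
def counitGr : Gr k H →ₗ[k] k :=
  (corPre k H 0).liftQ Coalgebra.counit bot_le ∘ₗ comp k H 0

lemma delta_assoc (i j l : ℕ) (x : H) :
    TensorProduct.assoc k _ _ _ ((delta k H i j).rTensor (H ⧸ corPre k H l)
      (delta k H (i + j) l ((corPre k H (i + j + l)).mkQ x)))
    = (delta k H j l).lTensor (H ⧸ corPre k H i)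
      (delta k H i (j + l) ((corPre k H (i + (j + l))).mkQ x)) := by
  rw [delta_mk, delta_mk]
  have e1 : (delta k H i j).rTensor (H ⧸ corPre k H l) ∘ₗ
      TensorProduct.map (corPre k H (i + j)).mkQ (corPre k H l).mkQ =
      TensorProduct.map (TensorProduct.map (corPre k H i).mkQ (corPre k H j).mkQ)
        (corPre k H l).mkQ ∘ₗ Coalgebra.comul.rTensor H := by
    rw [LinearMap.rTensor_comp_map, LinearMap.map_comp_rTensor]
    rfl
  have e2 : (delta k H j l).lTensor (H ⧸ corPre k H i) ∘ₗ
      TensorProduct.map (corPre k H i).mkQ (corPre k H (j + l)).mkQ =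
      TensorProduct.map (corPre k H i).mkQ (TensorProduct.map (corPre k H j).mkQ
        (corPre k H l).mkQ) ∘ₗ Coalgebra.comul.lTensor H := by
    rw [LinearMap.lTensor_comp_map, LinearMap.map_comp_lTensor]
    rfl
  have f1 := LinearMap.congr_fun e1 (Coalgebra.comul x)
  have f2 := LinearMap.congr_fun e2 (Coalgebra.comul x)
  rw [LinearMap.comp_apply, LinearMap.comp_apply] at f1 f2
  rw [f1, f2, ← Coalgebra.coassoc_apply, TensorProduct.map_map_assoc]

instance : Coalgebra k (Gr k H) where
  comul := comulGr k H
  counit := counitGr k H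
  coassoc := by
    ext x
    rw [← sub_eq_zero]
    apply eq_zero_of_map (Y := fun a : ℕ × ℕ => (H ⧸ corPre k H a.1) ⊗[k] (H ⧸ corPre k H a.2))
      (comp k H) (fun a : ℕ × ℕ => TensorProduct.map (comp k H a.1) (comp k H a.2))
      eq_zero_of_comp
    · intro t ht
      exact eq_zero_of_map (comp k H) (comp k H) eq_zero_of_comp eq_zero_of_comp t
        fun i j => ht (i, j)
    · rintro i ⟨j, l⟩
      rw [map_sub, sub_eq_zero]
      simp only [LinearMap.comp_apply, LinearEquiv.coe_coe]
      rw [TensorProduct.map_map_assoc]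
      have e1 : TensorProduct.map (TensorProduct.map (comp k H i) (comp k H j)) (comp k H l) ∘ₗ
          (comulGr k H).rTensor (Gr k H) = (delta k H i j).rTensor (H ⧸ corPre k H l) ∘ₗ
            TensorProduct.map (comp k H (i + j)) (comp k H l) := by
        rw [LinearMap.map_comp_rTensor, LinearMap.rTensor_comp_map]
        congr 1
        ext x
        exact map_comp_comulGr i j x
      have e2 : TensorProduct.map (comp k H i) (TensorProduct.map (comp k H j) (comp k H l)) ∘ₗ
          (comulGr k H).lTensor (Gr k H) = (delta k H j l).lTensor (H ⧸ corPre k H i) ∘ₗ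
            TensorProduct.map (comp k H i) (comp k H (j + l)) := by
        rw [LinearMap.map_comp_lTensor, LinearMap.lTensor_comp_map]
        congr 1
        ext x
        exact map_comp_comulGr j l x
      have f1 := LinearMap.congr_fun e1 (comulGr k H x)
      have f2 := LinearMap.congr_fun e2 (comulGr k H x)
      rw [LinearMap.comp_apply, LinearMap.comp_apply] at f1 f2
      rw [f1, f2, map_comp_comulGr, map_comp_comulGr]
      clear f1 f2
      induction x using Gr.induction with
      | h n x =>
        rw [comp_cls, comp_cls]
        by_cases hn : i + j + l = n
        · rw [if_pos hn, if_pos (by omega)]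
          exact delta_assoc i j l x.1
        · rw [if_neg hn, if_neg (by omega)]
          simp
      | h0 => simp
      | hadd x y hx hy => simp only [map_add, hx, hy]
  rTensor_counit_comp_comul := by
    ext x
    apply (TensorProduct.lid k (Gr k H)).injective
    rw [← sub_eq_zero]
    apply eq_zero_of_comp
    intro j
    rw [map_sub, sub_eq_zero]
    have e1 : ∀ t : Gr k H ⊗[k] Gr k H,
        comp k H j (TensorProduct.lid k _ ((counitGr k H).rTensor (Gr k H) t)) =
        TensorProduct.lid k _ (((corPre k H 0).liftQ Coalgebra.counit bot_le).rTensor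
          (H ⧸ corPre k H j) (TensorProduct.map (comp k H 0) (comp k H j) t)) := by
      intro t
      induction t with
      | zero => simp
      | add x y hx hy => simp only [map_add, hx, hy]
      | tmul x y => simp [counitGr]
    rw [LinearMap.comp_apply, e1, map_comp_comulGr]
    induction x using Gr.induction with
    | h n x =>
      simp only [TensorProduct.mk_apply, TensorProduct.lid_tmul, one_smul]
      rw [comp_cls, comp_cls]
      by_cases hn : j = n
      · rw [if_pos (by omega), if_pos hn, delta_mk]
        have e2 : ∀ t : H ⊗[k] H, TensorProduct.lid k _
            (((corPre k H 0).liftQ Coalgebra.counit bot_le).rTensor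
            (H ⧸ corPre k H j) (TensorProduct.map (corPre k H 0).mkQ (corPre k H j).mkQ t)) =
            (corPre k H j).mkQ (TensorProduct.lid k _ (Coalgebra.counit.rTensor H t)) := by
          intro t
          induction t with
          | zero => simp
          | add x y hx hy => simp only [map_add, hx, hy]
          | tmul x y =>
            simp
            rfl
        rw [e2, Coalgebra.rTensor_counit_comul]
        simp
      · rw [if_neg (by omega), if_neg hn]
        simp
    | h0 => simp
    | hadd x y hx hy => simp only [map_add, hx, hy]
  lTensor_counit_comp_comul := by
    ext x
    apply (TensorProduct.rid k (Gr k H)).injective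
    rw [← sub_eq_zero]
    apply eq_zero_of_comp
    intro i
    rw [map_sub, sub_eq_zero]
    have e1 : ∀ t : Gr k H ⊗[k] Gr k H,
        comp k H i (TensorProduct.rid k _ ((counitGr k H).lTensor (Gr k H) t)) =
        TensorProduct.rid k _ (((corPre k H 0).liftQ Coalgebra.counit bot_le).lTensor
          (H ⧸ corPre k H i) (TensorProduct.map (comp k H i) (comp k H 0) t)) := by
      intro t
      induction t with
      | zero => simp
      | add x y hx hy => simp only [map_add, hx, hy]
      | tmul x y => simp [counitGr]
    rw [LinearMap.comp_apply, e1, map_comp_comulGr]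
    induction x using Gr.induction with
    | h n x =>
      simp only [TensorProduct.mk_apply, LinearMap.flip_apply, TensorProduct.rid_tmul, one_smul]
      rw [comp_cls, comp_cls]
      by_cases hn : i = n
      · rw [if_pos (by omega), if_pos hn, delta_mk]
        have e2 : ∀ t : H ⊗[k] H, TensorProduct.rid k _
            (((corPre k H 0).liftQ Coalgebra.counit bot_le).lTensor
            (H ⧸ corPre k H i) (TensorProduct.map (corPre k H i).mkQ (corPre k H 0).mkQ t)) =
            (corPre k H i).mkQ (TensorProduct.rid k _ (Coalgebra.counit.lTensor H t)) := by
          intro t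
          induction t with
          | zero => simp
          | add x y hx hy => simp only [map_add, hx, hy]
          | tmul x y =>
            simp
            rfl
        rw [e2, Coalgebra.lTensor_counit_comul]
        simp
      · rw [if_neg (by omega), if_neg hn]
        simp
    | h0 => simp
    | hadd x y hx hy => simp only [map_add, hx, hy]

lemma mul_mem_lifts {m n : ℕ} {s t : (H ⊗[k] H) × (Gr k H ⊗[k] Gr k H)}
    (hs : s ∈ lifts k H m) (ht : t ∈ lifts k H n) : s * t ∈ lifts k H (m + n) := by
  induction hs using Submodule.span_induction with
  | zero => rw [zero_mul]; exact zero_mem _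
  | add s s' _ _ hs hs' => rw [add_mul]; exact add_mem hs hs'
  | smul c s _ hs => rw [smul_mul_assoc]; exact Submodule.smul_mem _ c hs
  | mem s hs =>
    obtain ⟨a, b, x, y, hab, rfl⟩ := hs
    induction ht using Submodule.span_induction with
    | zero => rw [mul_zero]; exact zero_mem _
    | add s s' _ _ hs hs' => rw [mul_add]; exact add_mem hs hs'
    | smul c s _ hs => rw [mul_smul_comm]; exact Submodule.smul_mem _ c hs
    | mem t ht =>
      obtain ⟨c, d, z, w, hcd, rfl⟩ := ht
      refine Submodule.subset_span ⟨a + c, b + d, ⟨_, mul_mem_corFil x.2 z.2⟩,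
        ⟨_, mul_mem_corFil y.2 w.2⟩, by omega, ?_⟩
      rw [Prod.mk_mul_mk, Algebra.TensorProduct.tmul_mul_tmul, Algebra.TensorProduct.tmul_mul_tmul,
        cls_mul, cls_mul]

lemma comul_cls_group {g : H} (hg : IsGroupLikeElem k g) :
    comulGr k H (cls k H 0 ⟨g, Submodule.subset_span hg⟩)
      = cls k H 0 ⟨g, Submodule.subset_span hg⟩ ⊗ₜ cls k H 0 ⟨g, Submodule.subset_span hg⟩ := by
  apply comulGr_of_lifts
  rw [hg.comul_eq_tmul_self]
  exact Submodule.subset_span ⟨0, 0, ⟨g, Submodule.subset_span hg⟩, ⟨g, Submodule.subset_span hg⟩,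
    rfl, rfl⟩

lemma counit_cls_zero (x : corFil k H 0) : counitGr k H (cls k H 0 x) = Coalgebra.counit x.1 := by
  rw [counitGr, LinearMap.comp_apply, comp_cls, if_pos rfl]
  rfl

lemma counit_cls_pos {n : ℕ} (hn : n ≠ 0) (x : corFil k H n) : counitGr k H (cls k H n x) = 0 := by
  rw [counitGr, LinearMap.comp_apply, comp_cls, if_neg (Ne.symm hn), map_zero]

lemma isGroupLike_cls {g : H} (hg : IsGroupLikeElem k g) :
    IsGroupLikeElem k (cls k H 0 ⟨g, Submodule.subset_span hg⟩) where
  counit_eq_one := (counit_cls_zero _).trans hg.counit_eq_one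
  comul_eq_tmul_self := comul_cls_group hg

/-- `gr H` is a bialgebra. -/
instance : Bialgebra k (Gr k H) :=
  Bialgebra.mk' k (Gr k H)
    (by
      rw [← cls_one]
      exact (counit_cls_zero _).trans Bialgebra.counit_one)
    (by
      intro x y
      change counitGr k H (x * y) = counitGr k H x * counitGr k H y
      induction x using Gr.induction with
      | h0 => simp
      | hadd x x' hx hx' => simp only [add_mul, map_add, hx, hx']
      | h n x =>
        induction y using Gr.induction with
        | h0 => simp
        | hadd x x' hx hx' => simp only [mul_add, map_add, hx, hx']
        | h l y =>
          rw [cls_mul]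
          by_cases hn : n = 0
          · by_cases hl : l = 0
            · subst hn hl
              rw [counit_cls_zero, counit_cls_zero]
              exact (counit_cls_zero ⟨x.1 * y.1, mul_mem_corFil x.2 y.2⟩).trans (Bialgebra.counit_mul x.1 y.1)
            · rw [counit_cls_pos hl, counit_cls_pos (by omega), mul_zero]
          · rw [counit_cls_pos hn, counit_cls_pos (by omega), zero_mul])
    (by
      rw [Algebra.TensorProduct.one_def, ← cls_one]
      exact comul_cls_group .one)
    (by
      intro x y
      change comulGr k H (x * y) = comulGr k H x * comulGr k H y
      induction x using Gr.induction with
      | h0 => simp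
      | hadd x x' hx hx' => simp only [add_mul, map_add, hx, hx']
      | h n x =>
        induction y using Gr.induction with
        | h0 => simp
        | hadd x x' hx hx' => simp only [mul_add, map_add, hx, hx']
        | h l y =>
          rw [cls_mul]
          apply comulGr_of_lifts
          rw [Bialgebra.comul_mul]
          exact mul_mem_lifts (comul_mem_lifts x) (comul_mem_lifts y))

variable (k H) in
/-- The sum of the homogeneous components of degree at most `n`. -/
def degLE (n : ℕ) : Submodule k (Gr k H) :=
  Submodule.span k {x | ∃ l ≤ n, ∃ y, x = cls k H l y}

lemma degLE_mono : Monotone (degLE k H) := fun _ _ h =>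
  Submodule.span_mono fun _ ⟨l, hl, hx⟩ => ⟨l, hl.trans h, hx⟩

lemma exists_mem_degLE (x : Gr k H) : ∃ n, x ∈ degLE k H n := by
  induction x using Gr.induction with
  | h n x => exact ⟨n, Submodule.subset_span ⟨n, le_rfl, x, rfl⟩⟩
  | h0 => exact ⟨0, zero_mem _⟩
  | hadd x y hx hy =>
    obtain ⟨a, ha⟩ := hx
    obtain ⟨b, hb⟩ := hy
    exact ⟨max a b, add_mem (degLE_mono (le_max_left a b) ha) (degLE_mono (le_max_right a b) hb)⟩

lemma comul_mem_tensFil (n : ℕ) (x : Gr k H) (hx : x ∈ degLE k H n) :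
    Coalgebra.comul x ∈ tensFil (degLE k H) n := by
  induction hx using Submodule.span_induction with
  | zero => simp
  | add x y _ _ hx hy => rw [map_add]; exact add_mem hx hy
  | smul c x _ hx => rw [map_smul]; exact Submodule.smul_mem _ _ hx
  | mem x hx =>
    obtain ⟨l, hl, y, rfl⟩ := hx
    have h : ∀ t ∈ lifts k H l, t.2 ∈ tensFil (degLE k H) n := by
      intro t ht
      induction ht using Submodule.span_induction with
      | zero => exact zero_mem _
      | add x y _ _ hx hy => exact add_mem hx hy
      | smul c x _ hx => exact Submodule.smul_mem _ c hx
      | mem t ht =>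
        obtain ⟨a, b, x, y, hab, rfl⟩ := ht
        exact Submodule.subset_span ⟨a, n - a, _, _, by omega,
          Submodule.subset_span ⟨a, le_rfl, x, rfl⟩,
          Submodule.subset_span ⟨b, by omega, y, rfl⟩, rfl⟩
    exact h _ (comul_mem_lifts y)

end Gr

end Graded

section GradedHopf

variable {k H : Type*} [Field k] [Ring H] [HopfAlgebra k H]

lemma Gr.degLE_zero :
    Gr.degLE k H 0 ≤ Submodule.span k {g | IsGroupLikeElem k g ∧ IsUnit g} := by
  refine Submodule.span_le.2 ?_
  rintro x ⟨l, hl, ⟨y, hy⟩, rfl⟩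
  obtain rfl : l = 0 := by omega
  have h : ∀ z : H, ∀ hz : z ∈ groupSpan k H, Gr.cls k H 0 ⟨z, hz⟩ ∈
      Submodule.span k {g | IsGroupLikeElem k g ∧ IsUnit g} := by
    intro z hz
    induction hz using Submodule.span_induction with
    | zero => exact (map_zero (Gr.cls k H 0)).symm ▸ zero_mem _
    | add x y h1 h2 hx hy =>
      have := add_mem hx hy
      rw [← map_add] at this
      exact this
    | smul c x h1 hx =>
      have := Submodule.smul_mem _ c hx
      rw [← map_smul] at this
      exact this
    | mem g hg =>
      refine Submodule.subset_span ⟨Gr.isGroupLike_cls hg, ?_⟩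
      have hg' : IsGroupLikeElem k (HopfAlgebra.antipode k g) := IsGroupLikeElem.antipode hg
      refine ⟨⟨Gr.cls k H 0 ⟨g, Submodule.subset_span hg⟩,
        Gr.cls k H 0 ⟨_, Submodule.subset_span hg'⟩, ?_, ?_⟩, rfl⟩
      · rw [Gr.cls_mul, ← Gr.cls_one]
        congr 1
        exact Subtype.ext (IsGroupLikeElem.mul_antipode_cancel hg)
      · rw [Gr.cls_mul, ← Gr.cls_one]
        congr 1
        exact Subtype.ext (IsGroupLikeElem.antipode_mul_cancel hg)
  exact h y hy

/-- `gr H` is a Hopf algebra. -/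
instance : HopfAlgebra k (Gr k H) :=
  hopfOfExists (exists_antipode Gr.degLE_mono Gr.comul_mem_tensFil Gr.exists_mem_degLE
    Gr.degLE_zero)

end GradedHopf

/-! ### Pointed coalgebras and Hopf subalgebras -/

section Sub

variable {k H : Type*} [Field k] [Ring H]

/-- `C` is a subcoalgebra: `Δ(C) ⊆ C ⊗ C`. -/
def IsSubcoalgebra [Bialgebra k H] (C : Submodule k H) : Prop :=
  ∀ x ∈ C, Coalgebra.comul x ∈ LinearMap.range (TensorProduct.map C.subtype C.subtype)

variable (k H) in
/-- Every simple subcoalgebra is one-dimensional. -/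
def IsPointed [Bialgebra k H] : Prop :=
  ∀ C : Submodule k H, IsSubcoalgebra C → C ≠ ⊥ →
    (∀ D : Submodule k H, D ≤ C → IsSubcoalgebra D → D = ⊥ ∨ D = C) → Module.finrank k C = 1

/-- A subalgebra which is stable under the comultiplication and the antipode. -/
def IsHopfSubalgebra [HopfAlgebra k H] (A : Subalgebra k H) : Prop :=
  IsSubcoalgebra (Subalgebra.toSubmodule A) ∧ ∀ x ∈ A, HopfAlgebra.antipode k x ∈ A

end Sub

/-! ### The biproduct decomposition of `gr H` -/

namespace Gr

section Biproduct

open WithConv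

variable {k H : Type*} [Field k] [Ring H] [HopfAlgebra k H]

variable (k H) in
/-- The projection `π : gr H → gr H(0) = k G(H)`, with values in `gr H`. -/
def proj : Gr k H →ₗ[k] Gr k H :=
  DirectSum.lof k ℕ (Piece k H) 0 ∘ₗ DirectSum.component k ℕ (Piece k H) 0

variable (k H) in
/-- The coinvariants `R = {x | (id ⊗ π) Δ(x) = x ⊗ 1}`. -/
def coinvariants : Submodule k (Gr k H) :=
  LinearMap.eqLocus ((proj k H).lTensor (Gr k H) ∘ₗ Coalgebra.comul)
    ((TensorProduct.mk k (Gr k H) (Gr k H)).flip 1)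

variable (k H) in
/-- The coaction `ρ = (π ⊗ id) Δ`. -/
def coaction : Gr k H →ₗ[k] Gr k H ⊗[k] Gr k H :=
  (proj k H).rTensor (Gr k H) ∘ₗ Coalgebra.comul

variable (k H) in
/-- The adjoint action `ad(h)(x) = ∑ h₁ x S(h₂)`. -/
def adjoint : Gr k H →ₗ[k] Module.End k (Gr k H) :=
  TensorProduct.lift ((LinearMap.mul k (Module.End k (Gr k H))).compl₁₂
    (LinearMap.mul k (Gr k H)) ((LinearMap.mul k (Gr k H)).flip ∘ₗ HopfAlgebra.antipode k)) ∘ₗ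
    Coalgebra.comul

variable (k H) in
/-- The braiding `c(v ⊗ w) = ∑ (v₋₁ · w) ⊗ v₀`, where `ρ(v) = ∑ v₋₁ ⊗ v₀`. -/
def braiding : Gr k H ⊗[k] Gr k H →ₗ[k] Gr k H ⊗[k] Gr k H :=
  (TensorProduct.lift (adjoint k H)).rTensor (Gr k H) ∘ₗ
    (TensorProduct.rightComm k (Gr k H) (Gr k H) (Gr k H)).toLinearMap ∘ₗ
    (coaction k H).rTensor (Gr k H)

variable (k H) in
/-- The projection `Π = id * (S ∘ π)` of `gr H = R # k G(H)` onto `R`. -/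
def toCoinvariants : Gr k H →ₗ[k] Gr k H :=
  ofConv (toConv LinearMap.id * toConv (HopfAlgebra.antipode k ∘ₗ proj k H))

variable (k H) in
/-- The comultiplication `Δ_R = (Π ⊗ id) Δ` of the braided Hopf algebra `R`, as a map defined on
`gr H`. -/
def braidedComul : Gr k H →ₗ[k] Gr k H ⊗[k] Gr k H :=
  (toCoinvariants k H).rTensor (Gr k H) ∘ₗ Coalgebra.comul

variable (k H) in
/-- The primitive elements `P(R) = {x ∈ R | Δ_R(x) = x ⊗ 1 + 1 ⊗ x}`. -/
def primitives : Submodule k (Gr k H) :=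
  coinvariants k H ⊓ LinearMap.eqLocus (braidedComul k H)
    ((TensorProduct.mk k (Gr k H) (Gr k H)).flip 1 + TensorProduct.mk k (Gr k H) (Gr k H) 1)

/-- A group-like element of `H`, as an element of `gr H(0)`. -/
def ofGroupLike (g : GroupLike k H) : Gr k H := cls k H 0 ⟨g.val, Submodule.subset_span g.2⟩

end Biproduct

end Gr

/-! ### Braidings of Cartan type -/

section Cartan

variable {k ι : Type*} [Field k]

/-- Generalized Cartan matrices. -/
structure IsGeneralizedCartan (a : Matrix ι ι ℤ) : Prop where
  diag : ∀ i, a i i = 2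
  nonpos : ∀ i j, i ≠ j → a i j ≤ 0
  zero_symm : ∀ i j, a i j = 0 → a j i = 0

/-- The braiding with coefficients `l` is of Cartan-FL-type with the (symmetrizable generalized)
Cartan matrix `a`. -/
def IsCartanFLType (l : ι → ι → k) (a : Matrix ι ι ℤ) : Prop :=
  IsGeneralizedCartan a ∧ ∃ q : k, q ≠ 0 ∧ q ≠ 1 ∧ ∃ d : ι → ℕ, (∀ i, 0 < d i) ∧
    (∀ i j, (d i : ℤ) * a i j = d j * a j i) ∧
    ∀ i j, l i j * l j i = q ^ ((d i : ℤ) * a i j)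

end Cartan

/-! ### The Hopf algebra `B(V) # k SLG` inside `gr B^l` -/

namespace Borel

variable {k : Type*} [Field k] {m : ℕ} (Q : QParam k m)

/-- The group-like element `K_s⁻¹ K_{s+1}` of `B^l`. -/
def Kbar (s : Fin m) : GroupLike k (Borel Q) where
  val := Kinv Q s.castSucc * K Q s.succ
  isGroupLikeElem_val := (isGroupLike_Kinv Q s.castSucc).mul (isGroupLike_K Q s.succ)

/-- The group `SLG` generated by the elements `K_s⁻¹ K_{s+1}`. -/
def SLG : Subgroup (GroupLike k (Borel Q)) := Subgroup.closure (Set.range (Kbar Q))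

/-- `E^s_{s+1} K_s⁻¹` lies in the first term of the coradical filtration. -/
lemma E_mul_Kinv_mem (s : Fin m) : E Q s * Kinv Q s.castSucc ∈ corFil k (Borel Q) 1 := by
  change _ ∈ wedge _ _
  have h : ∀ {g}, IsGroupLikeElem k g → (groupSpan k (Borel Q)).mkQ g = 0 := fun hg => by
    rw [Submodule.mkQ_apply, Submodule.Quotient.mk_eq_zero]
    exact Submodule.subset_span hg
  rw [mem_wedge, Bialgebra.comul_mul, comul_E, comul_Kinv, add_mul,
    Algebra.TensorProduct.tmul_mul_tmul, Algebra.TensorProduct.tmul_mul_tmul, map_add,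
    TensorProduct.map_tmul, TensorProduct.map_tmul,
    h ((isGroupLike_K Q _).mul (isGroupLike_Kinv Q _)), TensorProduct.zero_tmul, zero_add]
  have h2 := h ((isGroupLike_K Q s.castSucc).mul (isGroupLike_Kinv Q s.castSucc))
  change _ ⊗ₜ[k] (groupSpan k (Borel Q)).mkQ _ = 0
  rw [h2, TensorProduct.tmul_zero]

/-- The element `x_s = E^s_{s+1} K_s⁻¹` of `gr B^l`. -/
def x (s : Fin m) : Gr k (Borel Q) :=
  Gr.cls k (Borel Q) 1 ⟨E Q s * Kinv Q s.castSucc, E_mul_Kinv_mem Q s⟩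

/-- The span `V` of the elements `x_s`. -/
def V : Submodule k (Gr k (Borel Q)) := Submodule.span k (Set.range (x Q))

/-- The group algebra of `SLG` in `gr B^l`. -/
def kSLG : Submodule k (Gr k (Borel Q)) := Submodule.span k (Gr.ofGroupLike '' (SLG Q))

/-- The Nichols algebra `B(V)`, realized as the subalgebra of `R ⊆ gr B^l` generated by `V`. -/
def nichols : Subalgebra k (Gr k (Borel Q)) := Algebra.adjoin k (V Q)

/-- `B(V) # k SLG`, realized as the subalgebra of `gr B^l` generated by `V` and `SLG`. -/
def bosonization : Subalgebra k (Gr k (Borel Q)) :=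
  Algebra.adjoin k (V Q ∪ Gr.ofGroupLike '' (SLG Q))

end Borel

end QuantumGL

end

namespace QuantumGL

/-! ### Pointedness -/

section Pointed

variable {k H : Type*} [Field k] [Ring H] [Bialgebra k H]

/-! Since `Δ(T_i^j) = ∑ T_i^c ⊗ T_c^j`, evaluating functionals at the generators turns convolution
into matrix multiplication. Each `K_i` becomes an invertible diagonal matrix and each `E^s_{s+1}` a
matrix unit just above the diagonal, so all of `B^l` is upper triangular. A group-like element is
multiplicative on `A(R_Q)`, so its matrix satisfies the FRT relations, and `r ≠ 1` forces it to be
diagonal (`incl_T_eq_zero_of_isGroupLikeElem`). The entries `(s, s+1)` therefore vanish on the group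
algebra and separate the elements `E^s_{s+1} K_s⁻¹`; this is the linear independence of the `x_s` in
degree one (`eq_zero_of_sum_skewE_mem`).

Pointedness follows from counting letters `E`. Words with at most `n` of them lie in `H_n`, so the
`H_n` exhaust `B^l`. When the iterated wedges of `kG(H)` exhaust `H`, every nonzero subcoalgebra
meets `kG(H)` and hence contains a group-like element (`isPointed_of_exhaustive`).

The structure of `B(V) # kSLG` is that of a Radford biproduct. The map `π` is a bialgebra
projection, and `(id ⊗ π)Δ` sends `ug` to `ug ⊗ g` for a coinvariant `u` and a group-like `g`. So `u
⊗ g` can be read off from the product, while `Π` forgets `g` (`mul_injective_of_coinvariants`,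
`toCoinvariants_mul_ofGroupLike`). The elements of `SLG` commute with each `x_s` up to a nonzero
scalar, so group-likes can be moved to the right of words in `V`; this gives `B(V) · kSLG` as the
whole generated algebra, and `Π` then shows that its coinvariants are `B(V)`.

For `B(V) ∩ P(R) = V` the point is that primitive elements of `R` have degree one. If `x` is
primitive, then `Δ(x) = x ⊗ 1 + ρ(x)` (`comul_of_mem_primitives`), so `Δ(x)` has no component whose
two degrees are both positive. By the definition of the filtration, such components detect every
homogeneous part of degree at least two (`delta_injective`), and the part of degree zero is killed
by the counit. On the other side, `B(V)` is generated in degree one, so its part of degree one is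
only `V` (`homog_of_mem_nichols`).

Finally, `l_ij l_ji` is a quotient of four products `κ^a_b κ^b_a`. Such a product is `r` for `a ≠ b`
and `r²` for `a = b`, so only coincidences among the indices `i, i+1, j, j+1` matter. In the formal
statement `n = m + 1`. -/

lemma exists_isGroupLikeElem_of_inf_groupSpan {C : Submodule k H} (hC : IsSubcoalgebra C)
    (h : C ⊓ groupSpan k H ≠ ⊥) : ∃ g ∈ C, IsGroupLikeElem k g := by
  obtain ⟨x, ⟨hxC, hx⟩, hx0⟩ := Submodule.exists_mem_ne_zero_of_ne_bot h
  obtain ⟨c, rfl⟩ := (Finsupp.mem_span_range_iff_exists_finsupp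
    (v := GroupLike.val (R := k) (A := H)) (x := x)).1 (by
      refine Submodule.span_mono ?_ hx
      exact fun g hg => ⟨⟨g, hg⟩, rfl⟩)
  have hli := linearIndep_groupLikeVal (R := k) (A := H)
  obtain ⟨g, hg⟩ : ∃ g, c g ≠ 0 := by
    by_contra! h0
    obtain rfl : c = 0 := Finsupp.ext h0
    simp at hx0
  refine ⟨g, ?_, g.2⟩
  classical
  -- Distinct group-like elements are linearly independent, so they extend to a basis, and `f` can
  -- be chosen dual to `g` among them. Then `(f ⊗ id)Δ` extracts the single term `c g • g` from the
  -- combination.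
  obtain ⟨f, hf⟩ : ∃ f : H →ₗ[k] k, ∀ a : GroupLike k H, f a = if a = g then 1 else 0 := by
    let b := Module.Basis.extend hli.linearIndepOn_id
    refine ⟨b.constr k fun x => if (x : H) = g then 1 else 0, fun a => ?_⟩
    have hmem := Module.Basis.subset_extend hli.linearIndepOn_id ⟨a, rfl⟩
    have : b ⟨a, hmem⟩ = a := Module.Basis.extend_apply_self _ _
    conv_lhs => rw [← this]
    rw [Module.Basis.constr_basis]
    simp
  have hΔ := hC _ hxC
  -- Contracting the left factor of `C ⊗ C` by a functional leaves an element of `C`.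
  have h1 : ∀ t ∈ LinearMap.range (TensorProduct.map C.subtype C.subtype),
      TensorProduct.lid k H (f.rTensor H t) ∈ C := by
    rintro _ ⟨t, rfl⟩
    induction t with
    | zero => simp
    | add x y hx hy => simp only [map_add]; exact add_mem hx hy
    | tmul x y => simpa using C.smul_mem _ y.2
  have h2 := h1 _ hΔ
  have h3 : TensorProduct.lid k H (f.rTensor H (Coalgebra.comul (c.sum fun i a => a • i.val)))
      = c g • g.val := by
    simp only [Finsupp.sum, map_sum, map_smul, fun i : GroupLike k H => i.2.comul_eq_tmul_self,
      LinearMap.rTensor_tmul, TensorProduct.lid_tmul, hf, ite_smul, one_smul, zero_smul]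
    rw [Finset.sum_eq_single g (fun b _ hb => by simp [hb]) (fun hn => by simp_all)]
    simp
  rw [h3] at h2
  exact (Submodule.smul_mem_iff _ hg).1 h2

/-- Take the least `n` with `C ∩ H_n ≠ 0`. If `n > 0`, then `C` embeds into `H/H_0` and into
`H/H_{n-1}`, so `C ⊗ C` embeds into their tensor product. The wedge condition says that `Δ` of an
element of `C ∩ H_n` dies there, so `Δ` of it is zero, and the counit makes the element itself zero.
-/
lemma inf_groupSpan_ne_bot (hex : ∀ x : H, ∃ n, x ∈ corFil k H n) {C : Submodule k H}
    (hC : IsSubcoalgebra C) (h : C ≠ ⊥) : C ⊓ groupSpan k H ≠ ⊥ := by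
  have h0 : ∃ n, C ⊓ corFil k H n ≠ ⊥ := by
    obtain ⟨x, hx, hx0⟩ := Submodule.exists_mem_ne_zero_of_ne_bot h
    obtain ⟨n, hn⟩ := hex x
    exact ⟨n, Submodule.ne_bot_iff _ |>.2 ⟨x, ⟨hx, hn⟩, hx0⟩⟩
  classical
  have hmin : ∀ n < Nat.find h0, C ⊓ corFil k H n = ⊥ := fun n hn => not_not.1 (Nat.find_min h0 hn)
  have hspec := Nat.find_spec h0
  generalize Nat.find h0 = n at hmin hspec
  cases n with
  -- `corFil 0` is `corPre 1`, which is the group algebra by definition.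
  | zero => exact hspec
  | succ n =>
    exfalso
    obtain ⟨x, ⟨hxC, hx⟩, hx0⟩ := Submodule.exists_mem_ne_zero_of_ne_bot hspec
    have hinj : ∀ l ≤ n, Function.Injective ((corFil k H l).mkQ ∘ₗ C.subtype) := by
      intro l hl
      rw [injective_iff_map_eq_zero]
      intro y hy
      have : y.1 ∈ C ⊓ corFil k H l := ⟨y.2, by simpa using hy⟩
      rw [hmin l (by omega)] at this
      exact Subtype.ext this
    obtain ⟨t, ht⟩ := hC x hxC
    change x ∈ wedge (groupSpan k H) (corFil k H n) at hx
    rw [mem_wedge, ← ht, ← LinearMap.comp_apply, ← TensorProduct.map_comp] at hx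
    have ht0 : t = 0 := map_injective_of_injective _ _ (hinj 0 (by omega)) (hinj n le_rfl)
      (hx.trans (map_zero _).symm)
    rw [ht0, map_zero] at ht
    have := Coalgebra.rTensor_counit_comul (R := k) x
    rw [← ht, map_zero] at this
    apply hx0
    simpa using (congrArg (TensorProduct.lid k H) this).symm

/-- A simple subcoalgebra contains some group-like `g`, and the line `k ∙ g` is itself a
subcoalgebra, so it is everything. -/
lemma isPointed_of_exhaustive (hex : ∀ x : H, ∃ n, x ∈ corFil k H n) : IsPointed k H := by
  intro C hC h0 hmin
  obtain ⟨g, hgC, hg⟩ := exists_isGroupLikeElem_of_inf_groupSpan hC (inf_groupSpan_ne_bot hex hC h0)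
  have hle : k ∙ g ≤ C := (Submodule.span_singleton_le_iff_mem _ _).2 hgC
  have hsub : IsSubcoalgebra (k ∙ g) := by
    intro x hx
    obtain ⟨c, rfl⟩ := Submodule.mem_span_singleton.1 hx
    rw [map_smul, hg.comul_eq_tmul_self]
    have hmem := Submodule.mem_span_singleton_self (R := k) g
    exact Submodule.smul_mem _ _ ⟨⟨g, hmem⟩ ⊗ₜ ⟨g, hmem⟩, rfl⟩
  rcases hmin _ hle hsub with h | h
  · exact absurd (Submodule.span_singleton_eq_bot.1 h) hg.ne_zero
  · rw [← h]
    exact finrank_span_singleton hg.ne_zero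

end Pointed

/-! ### Contractions with the matrix `R_Q` -/

section

variable {k : Type*} [Field k] {m : ℕ} (Q : QParam k m)

/-- The two nonzero cases of `Rmat` exclude each other, since together they would give `i = j`
against `j < i`. The chain of conditions is therefore a sum, and contractions with it collapse term
by term. -/
lemma QParam.Rmat_eq (i j c d : Fin (m + 1)) : Q.Rmat i j c d =
    (if i = d then if j = c then Q.kappa i j else 0 else 0) +
      if i = c then if j = d then if j < i then Q.r - 1 else 0 else 0 else 0 := by
  unfold QParam.Rmat
  grind

lemma QParam.sum_Rmat_mul (F : Fin (m + 1) → Fin (m + 1) → k) (i j : Fin (m + 1)) :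
    ∑ c, ∑ d, Q.Rmat i j c d * F c d =
      Q.kappa i j * F j i + if j < i then (Q.r - 1) * F i j else 0 := by
  simp [Rmat_eq, add_mul, Finset.sum_add_distrib, ite_mul, Finset.sum_ite_irrel]

lemma QParam.sum_mul_Rmat (F : Fin (m + 1) → Fin (m + 1) → k) (a b : Fin (m + 1)) :
    ∑ c, ∑ d, Q.Rmat c d a b * F c d =
      Q.kappa b a * F b a + if b < a then (Q.r - 1) * F a b else 0 := by
  simp [Rmat_eq, add_mul, Finset.sum_add_distrib, ite_mul, Finset.sum_ite_irrel]

end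

/-! ### Pointedness of `B^l` -/

namespace Borel

variable {k : Type*} [Field k] {m : ℕ} (Q : QParam k m)

/-- `Δ` distributes the letters `E` of a word over the two tensor factors. A left factor without `E`
is in the group algebra; otherwise the right factor has fewer letters `E` than the word and the
induction hypothesis applies. This is exactly the wedge condition. -/
lemma wordFil_le_corFil (n : ℕ) : wordFil Q n ≤ corFil k (Borel Q) n := by
  induction n with
  | zero => exact (wordFil_zero Q).trans (Submodule.span_mono fun _ h => h.1)
  | succ n ih =>
    intro x hx
    have h := comul_wordFil Q _ x hx
    change x ∈ wedge _ _
    rw [mem_wedge]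
    generalize Coalgebra.comul (R := k) x = t at h
    induction h using Submodule.span_induction with
    | zero => simp
    | add x y _ _ hx hy => rw [map_add, hx, hy, add_zero]
    | smul c x _ hx => rw [map_smul, hx, smul_zero]
    | mem t ht =>
      obtain ⟨a, b, y, z, hab, hy, hz, rfl⟩ := ht
      rw [TensorProduct.map_tmul]
      rcases Nat.eq_zero_or_pos a with rfl | ha
      · have : (groupSpan k (Borel Q)).mkQ y = 0 := by
          rw [Submodule.mkQ_apply, Submodule.Quotient.mk_eq_zero]
          exact (wordFil_zero Q).trans (Submodule.span_mono fun _ h => h.1) hy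
        rw [this, TensorProduct.zero_tmul]
      · have : (corFil k (Borel Q) n).mkQ z = 0 := by
          simpa using ih (wordFil_mono Q (by omega) hz)
        rw [this, TensorProduct.tmul_zero]

lemma isPointed : IsPointed k (Borel Q) :=
  isPointed_of_exhaustive fun x =>
    (exists_mem_wordFil Q x).imp fun n hn => wordFil_le_corFil Q n hn

/-! ### Values of the functionals in `B^l` at the generators `T_i^j` -/

/-- This is matrix multiplication: `f ↦ (f(T_i^j))` represents `B^l` on a space of dimension `m +
1`. -/
lemma incl_mul_T (f g : Borel Q) (i j : Fin (m + 1)) :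
    incl Q (f * g) (FRT.T Q.Rmat i j) =
      ∑ c, incl Q f (FRT.T Q.Rmat i c) * incl Q g (FRT.T Q.Rmat c j) := by
  rw [map_mul, LinearMap.convMul_apply, FRT.comul_T]
  simp

lemma incl_one_T (i j : Fin (m + 1)) :
    incl Q 1 (FRT.T Q.Rmat i j) = if i = j then 1 else 0 := by
  rw [map_one]
  exact FRT.counit_T Q.Rmat i j

lemma incl_K_T (s i j : Fin (m + 1)) :
    incl Q (K Q s) (FRT.T Q.Rmat i j) = if i = j then Q.kappa s i else 0 :=
  Q.charHom_T _ i j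

lemma incl_Kinv_T (s i j : Fin (m + 1)) :
    incl Q (Kinv Q s) (FRT.T Q.Rmat i j) = if i = j then (Q.kappa s i)⁻¹ else 0 :=
  Q.charHom_T _ i j

lemma incl_E_T (s : Fin m) (i j : Fin (m + 1)) :
    incl Q (E Q s) (FRT.T Q.Rmat i j) = if i = s.castSucc ∧ j = s.succ then 1 else 0 :=
  Q.Efun_T s i j

/-- Every letter is upper triangular: `K` and `K⁻¹` are diagonal, and `E` is the matrix unit in
position `(s, s+1)`. -/
lemma incl_word_T_eq_zero {n : ℕ} {f : Borel Q} (hf : Word Q n f) {i j : Fin (m + 1)}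
    (hij : j < i) : incl Q f (FRT.T Q.Rmat i j) = 0 := by
  induction hf generalizing i j with
  | one => rw [incl_one_T, if_neg hij.ne']
  | K s _ ih => rw [incl_mul_T]; simp [incl_K_T, ih hij]
  | Kinv s _ ih => rw [incl_mul_T]; simp [incl_Kinv_T, ih hij]
  | E s _ ih =>
    rw [incl_mul_T]
    refine Finset.sum_eq_zero fun c _ => ?_
    rw [incl_E_T]
    split_ifs with h
    · rw [ih, mul_zero]
      rw [h.2]
      exact hij.trans (h.1 ▸ Fin.castSucc_lt_succ)
    · rw [zero_mul]

lemma incl_T_eq_zero (f : Borel Q) {i j : Fin (m + 1)} (hij : j < i) :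
    incl Q f (FRT.T Q.Rmat i j) = 0 := by
  obtain ⟨n, hn⟩ := exists_mem_wordFil Q f
  change evalAt (incl Q) (FRT.T Q.Rmat i j) f = 0
  induction hn using Submodule.span_induction with
  | mem x hx => exact incl_word_T_eq_zero Q hx.choose_spec.2 hij
  | zero => exact map_zero _
  | add x y _ _ hx hy => rw [map_add, hx, hy, add_zero]
  | smul c x _ hx => rw [map_smul, hx, smul_zero]

/-- The comultiplication of `B^l` is dual to the multiplication of `A(R_Q)`, so group-like means
multiplicative as a functional. -/
lemma incl_mul_of_isGroupLikeElem {g : Borel Q} (hg : IsGroupLikeElem k g) (a b : Q.A) :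
    incl Q g (a * b) = incl Q g a * incl Q g b := by
  have h := evTensor_comul Q g
  rw [hg.comul_eq_tmul_self] at h
  exact (congrArg (fun F : WithConv (Q.A ⊗[k] Q.A →ₗ[k] k) => F (a ⊗ₜ b)) h).symm

/-- In `g S(g) = 1` both factors are upper triangular, so the diagonal entry of the product is the
product of the diagonal entries. -/
lemma incl_T_self_ne_zero {g : Borel Q} (hg : IsGroupLikeElem k g) (i : Fin (m + 1)) :
    incl Q g (FRT.T Q.Rmat i i) ≠ 0 := by
  intro h
  have h1 := incl_mul_T Q g (HopfAlgebra.antipode k g) i i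
  rw [hg.mul_antipode_cancel, incl_one_T, if_pos rfl, Finset.sum_eq_zero] at h1
  · exact one_ne_zero h1
  · intro c _
    rcases lt_trichotomy c i with hc | rfl | hc
    · rw [incl_T_eq_zero Q g hc, zero_mul]
    · rw [h, zero_mul]
    · rw [incl_T_eq_zero Q _ hc, mul_zero]

/-- Group-like elements of `B^l` are diagonal. -/
lemma incl_T_eq_zero_of_isGroupLikeElem {g : Borel Q} (hg : IsGroupLikeElem k g)
    {i j : Fin (m + 1)} (hij : i < j) : incl Q g (FRT.T Q.Rmat i j) = 0 := by
  set t : Fin (m + 1) → Fin (m + 1) → k := fun a b => incl Q g (FRT.T Q.Rmat a b) with ht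
  -- By multiplicativity the scalars `t a b` satisfy the FRT relations themselves.
  have hrel : ∀ i j a b, ∑ c, ∑ d, Q.Rmat i j c d * (t c a * t d b)
      = ∑ c, ∑ d, Q.Rmat c d a b * (t i c * t j d) := by
    intro i j a b
    have h := congrArg (incl Q g).ofConv (FRT.T_rel Q.Rmat i j a b)
    simp only [map_sum, map_smul, smul_eq_mul] at h
    simpa only [ht, ← incl_mul_of_isGroupLikeElem Q hg] using h
  have hi := incl_T_self_ne_zero Q hg i
  have hj := incl_T_self_ne_zero Q hg j
  change t i i ≠ 0 at hi
  change t j j ≠ 0 at hj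
  change t i j = 0
  by_contra h0
  have hr0 := Q.r_ne_zero
  have hr1 := Q.r_ne_one
  have hp := Q.p_ne_zero i j hij
  -- For `i < j` these two instances read `r t_ii t_ij = κ^j_i t_ij t_ii` and `p_ij t_jj t_ij = r
  -- t_ij t_jj`. If `t_ij ≠ 0`, the second gives `p_ij = r`, hence `κ^j_i = r / p_ij = 1`, and the
  -- first then gives `r = 1`.
  have e1 := hrel i i i j
  have e2 := hrel i j j j
  have k1 : Q.kappa i j = Q.p i j := if_pos hij
  have k2 : Q.kappa j i = Q.r / Q.p i j := by
    rw [QParam.kappa, if_neg hij.not_gt, if_neg hij.ne']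
  rw [Q.sum_Rmat_mul, Q.sum_mul_Rmat, if_neg (lt_irrefl _), if_neg hij.not_gt] at e1
  rw [Q.sum_Rmat_mul, Q.sum_mul_Rmat, if_neg (lt_irrefl _), if_neg hij.not_gt] at e2
  rw [Q.kappa_self, k1] at e2
  rw [Q.kappa_self, k2] at e1
  have f2 : Q.p i j = Q.r := by
    apply mul_right_cancel₀ (mul_ne_zero h0 hj)
    linear_combination e2
  rw [f2, div_self hr0] at e1
  apply hr1
  apply mul_right_cancel₀ (mul_ne_zero h0 hi)
  linear_combination e1

/-! ### Commutation relations in `B^l` -/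

lemma K_mul_K (i j : Fin (m + 1)) : K Q i * K Q j = K Q j * K Q i := by
  apply incl_injective Q
  change Q.Kfun i * Q.Kfun j = Q.Kfun j * Q.Kfun i
  rw [QParam.Kfun, QParam.Kfun, QParam.charHom_conv, QParam.charHom_conv]
  simp only [mul_comm]

lemma incl_mul_comul (f : Borel Q) (a b : Q.A) :
    incl Q f (a * b) = evTensorHom (incl Q) (Coalgebra.comul f) (a ⊗ₜ b) := by
  rw [evTensor_comul]
  rfl

lemma incl_smul_apply (c : k) (f : Borel Q) (a : Q.A) : incl Q (c • f) a = c * incl Q f a := by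
  rw [map_smul]
  rfl

lemma evTensorHom_apply (f g f' g' : Borel Q) (a b : Q.A) :
    evTensorHom (incl Q) (f ⊗ₜ g + f' ⊗ₜ g') (a ⊗ₜ b)
      = incl Q f a * incl Q g b + incl Q f' a * incl Q g' b := by
  rw [map_add]
  rfl

/-- The counit is evaluation at `1`, where `matHom` is the identity matrix with zero off-diagonal
entry. -/
lemma counit_E (s : Fin m) : Coalgebra.counit (R := k) (E Q s) = 0 := by
  change Q.matHom s 1 0 1 = 0
  simp

/-- Both `K_i E` and `E K_i` are skew primitive, and because the `K`'s commute they are so with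
respect to the same pair of group-likes. Hence proportionality at `a` and at `b` gives it at `ab`
with the same factor, and only the values at `1` and at the generators need comparison. At
`T_s^{s+1}` these values are `κ^i_s` and `κ^i_{s+1}`, which gives the factor. -/
lemma K_mul_E (i : Fin (m + 1)) (s : Fin m) :
    K Q i * E Q s = (Q.kappa i s.castSucc / Q.kappa i s.succ) • (E Q s * K Q i) := by
  set c := Q.kappa i s.castSucc / Q.kappa i s.succ with hc
  have hκ := Q.kappa_ne_zero i s.succ
  apply incl_injective Q
  apply WithConv.ext
  ext a
  change incl Q _ a = incl Q _ a
  rw [incl_smul_apply]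
  induction a using FRT.induction with
  | hT a b =>
    simp only [incl_mul_T, incl_K_T, incl_E_T, ite_and, ite_mul, mul_ite, zero_mul, mul_zero,
      mul_one, one_mul, Finset.sum_ite_eq', Finset.mem_univ, if_true]
    split_ifs with h1 h2
    · rw [h1, h2, hc, div_mul_cancel₀ _ hκ]
    all_goals rfl
  | hc d =>
    -- On scalars both functionals vanish, because the counit is multiplicative and kills `E`.
    have h : ∀ f : Borel Q, Coalgebra.counit (R := k) f = 0 →
        incl Q f (algebraMap k Q.A d) = 0 := by
      intro f hf
      rw [Algebra.algebraMap_eq_smul_one]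
      refine (map_smul (incl Q f).ofConv d 1).trans ?_
      rw [show (incl Q f).ofConv 1 = 0 from hf, smul_zero]
    rw [h, h, mul_zero]
    · rw [Bialgebra.counit_mul, counit_E, zero_mul]
    · rw [Bialgebra.counit_mul, counit_E, mul_zero]
  | hadd a b ha hb =>
    have h : ∀ f : Borel Q, incl Q f (a + b) = incl Q f a + incl Q f b := fun f =>
      map_add (incl Q f).ofConv a b
    rw [h, h, ha, hb, mul_add]
  | hmul a b ha hb =>
    rw [incl_mul_comul, incl_mul_comul, Bialgebra.comul_mul, Bialgebra.comul_mul, comul_K, comul_E,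
      mul_add, add_mul]
    simp only [Algebra.TensorProduct.tmul_mul_tmul]
    rw [evTensorHom_apply, evTensorHom_apply, ha, hb, K_mul_K Q s.succ, K_mul_K Q s.castSucc]
    ring

lemma Kinv_mul_E (i : Fin (m + 1)) (s : Fin m) :
    Kinv Q i * E Q s = (Q.kappa i s.succ / Q.kappa i s.castSucc) • (E Q s * Kinv Q i) := by
  have h1 := Q.kappa_ne_zero i s.succ
  have h2 := Q.kappa_ne_zero i s.castSucc
  -- Conjugating the relation for `K_i` by `K_i⁻¹` on both sides gives the inverse factor.
  have h : E Q s * Kinv Q i =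
      (Q.kappa i s.castSucc / Q.kappa i s.succ) • (Kinv Q i * E Q s) := by
    calc E Q s * Kinv Q i = Kinv Q i * (K Q i * E Q s) * Kinv Q i := by
          rw [← mul_assoc, Kinv_mul_K, one_mul]
      _ = _ := by
          rw [K_mul_E, mul_smul_comm, smul_mul_assoc, mul_assoc, mul_assoc, K_mul_Kinv, mul_one]
  rw [h, smul_smul, div_mul_div_cancel₀ h2, div_self h1, one_smul]

lemma Kinv_mul_Kinv (i j : Fin (m + 1)) : Kinv Q i * Kinv Q j = Kinv Q j * Kinv Q i := by
  apply incl_injective Q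
  change Q.KfunInv i * Q.KfunInv j = Q.KfunInv j * Q.KfunInv i
  rw [QParam.KfunInv, QParam.KfunInv, QParam.charHom_conv, QParam.charHom_conv]
  simp only [mul_comm]

lemma K_mul_Kinv_comm (i j : Fin (m + 1)) : K Q i * Kinv Q j = Kinv Q j * K Q i := by
  apply incl_injective Q
  change Q.Kfun i * Q.KfunInv j = Q.KfunInv j * Q.Kfun i
  rw [QParam.KfunInv, QParam.Kfun, QParam.charHom_conv, QParam.charHom_conv]
  simp only [mul_comm]

/-- The coefficients of the braiding of `V`. -/
noncomputable def _root_.QuantumGL.QParam.braidCoeff (i j : Fin m) : k :=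
  Q.kappa i.succ j.castSucc * Q.kappa i.castSucc j.succ /
    (Q.kappa i.succ j.succ * Q.kappa i.castSucc j.castSucc)

lemma Kbar_mul_E (i j : Fin m) : (Kbar Q i).val * E Q j =
    Q.braidCoeff i j • (E Q j * (Kbar Q i).val) := by
  change Kinv Q i.castSucc * K Q i.succ * E Q j = _ • (E Q j * (Kinv Q i.castSucc * K Q i.succ))
  rw [mul_assoc, K_mul_E, mul_smul_comm, ← mul_assoc, Kinv_mul_E, smul_mul_assoc, smul_smul,
    mul_assoc, QParam.braidCoeff, div_mul_div_comm]

/-- The skew primitive element `E^s_{s+1} K_s⁻¹` of `B^l`. -/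
noncomputable abbrev skewE (s : Fin m) : Borel Q := E Q s * Kinv Q s.castSucc

lemma Kbar_mul_skewE (i j : Fin m) : (Kbar Q i).val * skewE Q j =
    Q.braidCoeff i j • (skewE Q j * (Kbar Q i).val) := by
  have h : (Kbar Q i).val * Kinv Q j.castSucc = Kinv Q j.castSucc * (Kbar Q i).val := by
    change Kinv Q _ * K Q _ * _ = _ * (Kinv Q _ * K Q _)
    rw [mul_assoc, K_mul_Kinv_comm, ← mul_assoc, Kinv_mul_Kinv, mul_assoc]
  rw [skewE, ← mul_assoc, Kbar_mul_E, smul_mul_assoc, mul_assoc, h, mul_assoc]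

lemma braidCoeff_ne_zero (i j : Fin m) : Q.braidCoeff i j ≠ 0 :=
  div_ne_zero (mul_ne_zero (Q.kappa_ne_zero _ _) (Q.kappa_ne_zero _ _))
    (mul_ne_zero (Q.kappa_ne_zero _ _) (Q.kappa_ne_zero _ _))

/-- Commutation up to a nonzero scalar passes from the generators to products and inverses, so `SLG`
acts on each line `k x_j` by a character. That `c` is nonzero is what allows the step to inverses.
-/
lemma exists_SLG_mul_skewE {g : GroupLike k (Borel Q)} (hg : g ∈ SLG Q) (j : Fin m) :
    ∃ c : k, c ≠ 0 ∧ g.val * skewE Q j = c • (skewE Q j * g.val) := by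
  induction hg using Subgroup.closure_induction with
  | mem g hg =>
    obtain ⟨i, rfl⟩ := hg
    exact ⟨_, braidCoeff_ne_zero Q i j, Kbar_mul_skewE Q i j⟩
  | one => exact ⟨1, one_ne_zero, by simp⟩
  | mul g h _ _ hg hh =>
    obtain ⟨c, hc, hg⟩ := hg
    obtain ⟨d, hd, hh⟩ := hh
    refine ⟨d * c, mul_ne_zero hd hc, ?_⟩
    rw [GroupLike.val_mul, mul_assoc, hh, mul_smul_comm, ← mul_assoc, hg, smul_mul_assoc,
      smul_smul, mul_assoc]
  | inv g _ hg =>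
    obtain ⟨c, hc, hg⟩ := hg
    refine ⟨c⁻¹, inv_ne_zero hc, ?_⟩
    have h1 : (g⁻¹).val * g.val = 1 := g.2.antipode_mul_cancel
    have h2 : g.val * (g⁻¹).val = 1 := g.2.mul_antipode_cancel
    rw [eq_inv_smul_iff₀ hc]
    calc c • ((g⁻¹).val * skewE Q j)
        = (g⁻¹).val * (c • (skewE Q j * g.val)) * (g⁻¹).val := by
          rw [mul_smul_comm, smul_mul_assoc, mul_assoc, mul_assoc, h2, mul_one]
      _ = _ := by rw [← hg, ← mul_assoc, h1, one_mul]

/-- Multiplying by `K_s⁻¹` on the right normalizes one of the two group-likes in `Δ(E)` to `1`,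
which is what places `x_s` among the coinvariants. -/
lemma comul_skewE (s : Fin m) : Coalgebra.comul (R := k) (skewE Q s) =
    (Kbar Q s).val ⊗ₜ skewE Q s + skewE Q s ⊗ₜ 1 := by
  rw [Bialgebra.comul_mul, comul_E, comul_Kinv, add_mul, Algebra.TensorProduct.tmul_mul_tmul,
    Algebra.TensorProduct.tmul_mul_tmul, K_mul_Kinv, K_mul_Kinv_comm]
  rfl

/-- No nontrivial combination of the elements `E^s_{s+1} K_s⁻¹` lies in the group algebra. -/
lemma eq_zero_of_sum_skewE_mem (c : Fin m → k)
    (h : ∑ s, c s • skewE Q s ∈ groupSpan k (Borel Q)) (s : Fin m) : c s = 0 := by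
  -- Evaluation at `T_s^{s+1}` kills the group algebra, whose elements are diagonal, while on the
  -- elements `E^t_{t+1} K_t⁻¹` it is nonzero only for `t = s`. It therefore isolates `c s`.
  have h1 : groupSpan k (Borel Q) ≤
      LinearMap.ker (evalAt (incl Q) (FRT.T Q.Rmat s.castSucc s.succ)) := by
    refine Submodule.span_le.2 fun g hg => ?_
    exact incl_T_eq_zero_of_isGroupLikeElem Q hg Fin.castSucc_lt_succ
  have h2 : ∀ t, evalAt (incl Q) (FRT.T Q.Rmat s.castSucc s.succ) (skewE Q t) =
      if t = s then (Q.kappa s.castSucc s.succ)⁻¹ else 0 := by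
    intro t
    change incl Q (E Q t * Kinv Q t.castSucc) _ = _
    rw [incl_mul_T]
    simp only [incl_E_T, incl_Kinv_T, mul_ite, ite_mul, one_mul, zero_mul, mul_zero,
      Finset.sum_ite_eq', Finset.mem_univ, if_true, Fin.castSucc_inj, Fin.succ_inj]
    by_cases hts : t = s
    · simp [hts]
    · simp [hts, Ne.symm hts]
  have h3 : evalAt (incl Q) (FRT.T Q.Rmat s.castSucc s.succ) (∑ s, c s • skewE Q s) = 0 := h1 h
  rw [map_sum] at h3
  simp only [map_smul, h2, smul_eq_mul, mul_ite, mul_zero, Finset.sum_ite_eq',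
    Finset.mem_univ, if_true] at h3
  exact (mul_eq_zero.1 h3).resolve_right (inv_ne_zero (Q.kappa_ne_zero _ _))

/-! ### The braiding coefficients -/

lemma braidCoeff_self (i : Fin m) : Q.braidCoeff i i = Q.r⁻¹ := by
  rw [QParam.braidCoeff, Q.kappa_mul Fin.castSucc_lt_succ.ne', Q.kappa_self, Q.kappa_self,
    div_mul_cancel_left₀ Q.r_ne_zero]

/-- Regrouped in this way, every factor has the form `κ^a_b κ^b_a`, which is `r` for `a ≠ b` and
`r²` for `a = b`. The individual parameters `p_ij` thus drop out. -/
lemma braidCoeff_comm (i j : Fin m) :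
    Q.braidCoeff i j * Q.braidCoeff j i =
      (Q.kappa i.succ j.castSucc * Q.kappa j.castSucc i.succ) *
      (Q.kappa i.castSucc j.succ * Q.kappa j.succ i.castSucc) /
      ((Q.kappa i.succ j.succ * Q.kappa j.succ i.succ) *
      (Q.kappa i.castSucc j.castSucc * Q.kappa j.castSucc i.castSucc)) := by
  rw [QParam.braidCoeff, QParam.braidCoeff, div_mul_div_comm]
  congr 1 <;> ring

lemma braidCoeff_adjacent {i j : Fin m} (h : i.val + 1 = j.val ∨ j.val + 1 = i.val) :
    Q.braidCoeff i j * Q.braidCoeff j i = Q.r := by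
  wlog h' : i.val + 1 = j.val generalizing i j
  · rw [mul_comm]
    exact this h.symm (h.resolve_left h')
  have hr := Q.r_ne_zero
  -- This is the only coincidence of indices. Its pair contributes `r²` to the numerator and the
  -- other three contribute `r` each, so the quotient is `r³ / r²`.
  have h1 : i.succ = j.castSucc := Fin.ext h'
  have hne : ∀ a b : Fin (m + 1), a.val ≠ b.val → a ≠ b := fun a b hab => Fin.val_ne_iff.1 hab
  rw [braidCoeff_comm, h1, Q.kappa_self, Q.kappa_mul, Q.kappa_mul, Q.kappa_mul]
  · field_simp
  all_goals
    apply hne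
    simp only [Fin.val_succ, Fin.val_castSucc]
    omega

lemma braidCoeff_distant {i j : Fin m} (h : i.val + 1 < j.val ∨ j.val + 1 < i.val) :
    Q.braidCoeff i j * Q.braidCoeff j i = 1 := by
  have hr := Q.r_ne_zero
  have hne : ∀ a b : Fin (m + 1), a.val ≠ b.val → a ≠ b := fun a b hab => Fin.val_ne_iff.1 hab
  -- No indices coincide, so all four pairs give `r` and the quotient is `r² / r²`.
  rw [braidCoeff_comm, Q.kappa_mul, Q.kappa_mul, Q.kappa_mul, Q.kappa_mul]
  · field_simp
  all_goals
    apply hne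
    simp only [Fin.val_succ, Fin.val_castSucc]
    omega

lemma braidCoeff_cartan (i j : Fin m) :
    Q.braidCoeff i j * Q.braidCoeff j i = Q.r⁻¹ ^ CartanMatrix.A m i j := by
  have hA : CartanMatrix.A m i j = if i = j then 2 else
    if i.val + 1 = j.val ∨ j.val + 1 = i.val then -1 else 0 := by
    simp only [CartanMatrix.A, Matrix.of_apply]
  rw [hA]
  split_ifs with h1 h2
  · rw [h1, braidCoeff_self, zpow_ofNat, sq]
  · rw [braidCoeff_adjacent Q h2, zpow_neg_one, inv_inv]
  · rw [braidCoeff_distant Q, zpow_zero]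
    rw [← Fin.val_inj] at h1
    omega

/-- Type `A` is simply laced, so its matrix is symmetric and all `d_i` can be `1`; the parameter is
`q = r⁻¹`, the common diagonal coefficient. -/
lemma isCartanFLType_braidCoeff : IsCartanFLType Q.braidCoeff (CartanMatrix.A m) := by
  have hsymm : ∀ i j, CartanMatrix.A m i j = CartanMatrix.A m j i := fun i j =>
    (CartanMatrix.A_isSymm m).apply j i
  refine ⟨⟨congrFun (CartanMatrix.A_diag m), fun i j h => CartanMatrix.A_apply_le_zero_of_ne _ i j h,
    fun i j h => hsymm i j ▸ h⟩, Q.r⁻¹, inv_ne_zero Q.r_ne_zero, inv_ne_one.2 Q.r_ne_one,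
    fun _ => 1, fun _ => one_pos, fun i j => by rw [hsymm], fun i j => ?_⟩
  rw [braidCoeff_cartan, Nat.cast_one, one_mul]

end Borel

namespace Gr

/-! ### The structure of `gr H` -/

section Projection

variable {k H : Type*} [Field k] [Ring H] [Bialgebra k H]

/-- Degrees such as `0 + 1` and `1` index different types; this moves a class between them. -/
lemma cls_congr {n l : ℕ} (h : n = l) {x : corFil k H n} {y : corFil k H l} (hxy : x.1 = y.1) :
    cls k H n x = cls k H l y := by
  subst h
  rw [Subtype.ext hxy]

variable (k H) in
/-- The projection of `gr H` onto its component of degree `n`. -/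
noncomputable def homog (n : ℕ) : Gr k H →ₗ[k] Gr k H :=
  DirectSum.lof k ℕ (Piece k H) n ∘ₗ DirectSum.component k ℕ (Piece k H) n

lemma homog_cls_self (n : ℕ) (x : corFil k H n) : homog k H n (cls k H n x) = cls k H n x := by
  change DirectSum.lof k ℕ (Piece k H) n (DirectSum.component k ℕ (Piece k H) n
    (DirectSum.lof k ℕ (Piece k H) n (pieceMk k H n x))) = _
  rw [DirectSum.component.lof_self]
  rfl

lemma homog_cls_of_ne {n l : ℕ} (h : n ≠ l) (x : corFil k H l) :
    homog k H n (cls k H l x) = 0 := by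
  change DirectSum.lof k ℕ (Piece k H) n (DirectSum.component k ℕ (Piece k H) n
    (DirectSum.lof k ℕ (Piece k H) l (pieceMk k H l x))) = _
  rw [DirectSum.component.of, dif_neg h.symm]
  exact map_zero _

lemma comp_homog (i n : ℕ) (x : Gr k H) :
    comp k H i (homog k H n x) = if i = n then comp k H i x else 0 := by
  induction x using Gr.induction with
  | h0 => simp
  | hadd x y hx hy =>
    rw [map_add, map_add, hx, hy, map_add]
    split_ifs <;> simp
  | h l x =>
    by_cases hnl : n = l
    · subst hnl
      rw [homog_cls_self, comp_cls]
      split_ifs <;> rfl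
    · rw [homog_cls_of_ne hnl, comp_cls, map_zero]
      split_ifs with h1 h2
      · omega
      · rfl
      · rfl

/-- Degrees add, and `1 = 1 + 0 = 0 + 1` are the only decompositions. The formula makes the
degree-one part a derivation over the degree-zero part. -/
lemma homog_one_mul (x y : Gr k H) : homog k H 1 (x * y) =
    homog k H 1 x * homog k H 0 y + homog k H 0 x * homog k H 1 y := by
  induction x using Gr.induction with
  | h0 => simp
  | hadd x x' hx hx' => simp only [add_mul, map_add, hx, hx']; abel
  | h n x =>
    induction y using Gr.induction with
    | h0 => simp
    | hadd y y' hy hy' => simp only [mul_add, map_add, hy, hy']; abel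
    | h l y =>
      by_cases hnl : n + l = 1
      · obtain ⟨rfl, rfl⟩ | ⟨rfl, rfl⟩ : (n = 0 ∧ l = 1) ∨ (n = 1 ∧ l = 0) := by omega
        · rw [homog_cls_of_ne (by omega : 1 ≠ 0), homog_cls_self, homog_cls_self, zero_mul, zero_add,
            cls_mul, cls_congr hnl (y := ⟨x.1 * y.1, mul_mem_corFil x.2 y.2⟩) rfl,
            homog_cls_self]
        · rw [homog_cls_of_ne (by omega : 0 ≠ 1), homog_cls_self, homog_cls_self, zero_mul, add_zero,
            cls_mul, cls_congr hnl (y := ⟨x.1 * y.1, mul_mem_corFil x.2 y.2⟩) rfl,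
            homog_cls_self]
      · rw [cls_mul, homog_cls_of_ne (Ne.symm hnl)]
        have h1 : homog k H 1 (cls k H n x) * homog k H 0 (cls k H l y) = 0 := by
          by_cases hn : 1 = n
          · rw [homog_cls_of_ne (by omega : 0 ≠ l), mul_zero]
          · rw [homog_cls_of_ne hn, zero_mul]
        have h2 : homog k H 0 (cls k H n x) * homog k H 1 (cls k H l y) = 0 := by
          by_cases hn : 0 = n
          · rw [homog_cls_of_ne (by omega : 1 ≠ l), mul_zero]
          · rw [homog_cls_of_ne hn, zero_mul]
        rw [h1, h2, add_zero]

end Projection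

section Hopf

variable {k H : Type*} [Field k] [Ring H] [HopfAlgebra k H]

lemma proj_cls_zero (x : corFil k H 0) : proj k H (cls k H 0 x) = cls k H 0 x := homog_cls_self 0 x

lemma proj_cls_of_ne {n : ℕ} (h : n ≠ 0) (x : corFil k H n) : proj k H (cls k H n x) = 0 :=
  homog_cls_of_ne h.symm x

lemma proj_mul (x y : Gr k H) : proj k H (x * y) = proj k H x * proj k H y := by
  induction x using Gr.induction with
  | h0 => simp
  | hadd x x' hx hx' => simp only [add_mul, map_add, hx, hx']
  | h n x =>
    induction y using Gr.induction with
    | h0 => simp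
    | hadd y y' hy hy' => simp only [mul_add, map_add, hy, hy']
    | h l y =>
      rw [cls_mul]
      rcases eq_or_ne n 0 with rfl | hn
      · rcases eq_or_ne l 0 with rfl | hl
        · rw [proj_cls_zero x, proj_cls_zero y, cls_mul]
          exact proj_cls_zero _
        · rw [proj_cls_of_ne hl, proj_cls_of_ne (by omega), mul_zero]
      · rw [proj_cls_of_ne hn, proj_cls_of_ne (by omega), zero_mul]

lemma proj_one : proj k H 1 = 1 := proj_cls_zero _

variable (k H) in
/-- The projection `π : gr H → gr H(0)` as an algebra map. -/
noncomputable def projHom : Gr k H →ₐ[k] Gr k H := AlgHom.ofLinearMap (proj k H) proj_one proj_mul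

/-- A term of bidegree `(a, b)` with `a + b = n` survives `π ⊗ π` only if `a = b = 0`, which means
`n = 0`. This is why `π` is a coalgebra map. -/
lemma map_proj_of_lifts {n : ℕ} {t : (H ⊗[k] H) × (Gr k H ⊗[k] Gr k H)} (ht : t ∈ lifts k H n) :
    TensorProduct.map (proj k H) (proj k H) t.2 = if n = 0 then t.2 else 0 := by
  induction ht using Submodule.span_induction with
  | zero => simp
  | add s t _ _ hs ht =>
    rw [Prod.snd_add, map_add, hs, ht]
    split_ifs <;> simp
  | smul c t _ ht =>
    rw [Prod.smul_snd, map_smul, ht]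
    split_ifs <;> simp
  | mem t ht =>
    obtain ⟨a, b, x, y, hab, rfl⟩ := ht
    rw [TensorProduct.map_tmul]
    split_ifs with hn
    · obtain ⟨rfl, rfl⟩ : a = 0 ∧ b = 0 := by omega
      rw [proj_cls_zero, proj_cls_zero]
    · rcases eq_or_ne a 0 with rfl | ha
      · rw [proj_cls_of_ne (by omega : b ≠ 0), TensorProduct.tmul_zero]
      · rw [proj_cls_of_ne ha, TensorProduct.zero_tmul]

lemma map_proj_comul (x : Gr k H) :
    TensorProduct.map (proj k H) (proj k H) (Coalgebra.comul x) = Coalgebra.comul (proj k H x) := by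
  induction x using Gr.induction with
  | h0 => simp
  | hadd x y hx hy => simp only [map_add, hx, hy]
  | h n x =>
    refine (map_proj_of_lifts (comul_mem_lifts x)).trans ?_
    split_ifs with hn
    · subst hn
      rw [proj_cls_zero]
      rfl
    · rw [proj_cls_of_ne hn, map_zero]

lemma counit_proj (x : Gr k H) :
    Coalgebra.counit (R := k) (proj k H x) = Coalgebra.counit (R := k) x := by
  induction x using Gr.induction with
  | h0 => simp
  | hadd x y hx hy => simp only [map_add, hx, hy]
  | h n x =>
    rcases eq_or_ne n 0 with rfl | hn
    · rw [proj_cls_zero]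
    · rw [proj_cls_of_ne hn, map_zero]
      exact (counit_cls_pos hn x).symm

variable (k H) in
/-- The projection `π : gr H → gr H(0)` as a coalgebra map. -/
noncomputable def projCoalgHom : Gr k H →ₗc[k] Gr k H where
  __ := proj k H
  counit_comp := LinearMap.ext counit_proj
  map_comp_comul := LinearMap.ext map_proj_comul

/-! ### Group-like elements in degree zero and their adjoint action -/

lemma ofGroupLike_mul (g h : GroupLike k H) : ofGroupLike (g * h) = ofGroupLike g * ofGroupLike h := by
  have h1 := cls_mul (k := k) (H := H) (i := 0) (j := 0) ⟨g.val, Submodule.subset_span g.2⟩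
    ⟨h.val, Submodule.subset_span h.2⟩
  exact (h1.trans (cls_congr rfl rfl)).symm

lemma ofGroupLike_one : ofGroupLike (1 : GroupLike k H) = 1 := rfl

lemma isGroupLikeElem_ofGroupLike (g : GroupLike k H) : IsGroupLikeElem k (ofGroupLike g) :=
  isGroupLike_cls g.2

lemma ofGroupLike_mul_inv (g : GroupLike k H) : ofGroupLike g * ofGroupLike g⁻¹ = 1 := by
  rw [← ofGroupLike_mul, mul_inv_cancel, ofGroupLike_one]

lemma ofGroupLike_inv_mul (g : GroupLike k H) : ofGroupLike g⁻¹ * ofGroupLike g = 1 := by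
  rw [← ofGroupLike_mul, inv_mul_cancel, ofGroupLike_one]

lemma antipode_ofGroupLike (g : GroupLike k H) :
    HopfAlgebra.antipode k (ofGroupLike g) = ofGroupLike g⁻¹ :=
  left_inv_eq_right_inv (isGroupLikeElem_ofGroupLike g).antipode_mul_cancel (ofGroupLike_mul_inv g)

lemma comul_ofGroupLike (g : GroupLike k H) :
    Coalgebra.comul (R := k) (ofGroupLike g) = ofGroupLike g ⊗ₜ ofGroupLike g :=
  (isGroupLikeElem_ofGroupLike g).comul_eq_tmul_self

lemma proj_ofGroupLike (g : GroupLike k H) : proj k H (ofGroupLike g) = ofGroupLike g :=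
  proj_cls_zero _

lemma adjoint_ofGroupLike (g : GroupLike k H) (x : Gr k H) :
    adjoint k H (ofGroupLike g) x = ofGroupLike g * x * ofGroupLike g⁻¹ := by
  rw [adjoint, LinearMap.comp_apply, comul_ofGroupLike, TensorProduct.lift.tmul,
    LinearMap.compl₁₂_apply, LinearMap.comp_apply, antipode_ofGroupLike]
  simp [mul_assoc]

/-! ### Coinvariants -/

variable (k H) in
/-- The right coaction `(id ⊗ π) Δ` as an algebra map. -/
noncomputable def rightCoaction : Gr k H →ₐ[k] Gr k H ⊗[k] Gr k H :=
  (Algebra.TensorProduct.map (AlgHom.id k _) (projHom k H)).comp (Bialgebra.comulAlgHom k _)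

lemma rightCoaction_apply (x : Gr k H) :
    rightCoaction k H x = (proj k H).lTensor (Gr k H) (Coalgebra.comul x) := rfl

lemma mem_coinvariants {x : Gr k H} : x ∈ coinvariants k H ↔ rightCoaction k H x = x ⊗ₜ 1 := Iff.rfl

variable (k H) in
/-- The coinvariants form a subalgebra. -/
noncomputable def coinvariantsSubalgebra : Subalgebra k (Gr k H) :=
  AlgHom.equalizer (rightCoaction k H) Algebra.TensorProduct.includeLeft

lemma rightCoaction_ofGroupLike (g : GroupLike k H) :
    rightCoaction k H (ofGroupLike g) = ofGroupLike g ⊗ₜ ofGroupLike g := by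
  rw [rightCoaction_apply, comul_ofGroupLike, LinearMap.lTensor_tmul, proj_ofGroupLike]

lemma rightCoaction_mul_ofGroupLike {x : Gr k H} (hx : x ∈ coinvariants k H) (g : GroupLike k H) :
    rightCoaction k H (x * ofGroupLike g) = (x * ofGroupLike g) ⊗ₜ ofGroupLike g := by
  rw [map_mul, mem_coinvariants.1 hx, rightCoaction_ofGroupLike,
    Algebra.TensorProduct.tmul_mul_tmul, one_mul]

lemma toCoinvariants_apply (x : Gr k H) : toCoinvariants k H x =
    LinearMap.mul' k _ ((HopfAlgebra.antipode k).lTensor (Gr k H) (rightCoaction k H x)) := by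
  rw [rightCoaction_apply, ← LinearMap.comp_apply (LinearMap.lTensor _ _), ← LinearMap.lTensor_comp]
  rfl

lemma toCoinvariants_of_mem {x : Gr k H} (hx : x ∈ coinvariants k H) :
    toCoinvariants k H x = x := by
  rw [toCoinvariants_apply, mem_coinvariants.1 hx]
  simp

lemma toCoinvariants_mul_ofGroupLike {x : Gr k H} (hx : x ∈ coinvariants k H) (g : GroupLike k H) :
    toCoinvariants k H (x * ofGroupLike g) = x := by
  rw [toCoinvariants_apply, rightCoaction_mul_ofGroupLike hx]
  simp [antipode_ofGroupLike, mul_assoc, ofGroupLike_mul_inv]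

lemma toCoinvariants_ofGroupLike (g : GroupLike k H) : toCoinvariants k H (ofGroupLike g) = 1 := by
  have h1 : (1 : Gr k H) ∈ coinvariants k H := one_mem (coinvariantsSubalgebra k H)
  simpa using toCoinvariants_mul_ofGroupLike h1 g

/-- A product of coinvariants and group-like elements determines both factors. -/
lemma mul_injective_of_coinvariants {U W : Submodule k (Gr k H)} (hU : U ≤ coinvariants k H)
    (hW : W ≤ Submodule.span k (Set.range ofGroupLike)) :
    Function.Injective (LinearMap.mul' k (Gr k H) ∘ₗ TensorProduct.map U.subtype W.subtype) := by
  -- A left inverse of multiplication. On `ug` the coaction gives `ug ⊗ g`; comultiplying the second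
  -- factor and multiplying the first by `S(g)` gives `u g S(g) ⊗ g = u ⊗ g`.
  let F : Gr k H →ₗ[k] Gr k H ⊗[k] Gr k H :=
    (LinearMap.mul' k (Gr k H) ∘ₗ (HopfAlgebra.antipode k).lTensor (Gr k H)).rTensor (Gr k H) ∘ₗ
      (TensorProduct.assoc k _ _ _).symm.toLinearMap ∘ₗ Coalgebra.comul.lTensor (Gr k H) ∘ₗ
      (rightCoaction k H).toLinearMap
  have hF : ∀ t, F (LinearMap.mul' k (Gr k H) (TensorProduct.map U.subtype W.subtype t)) =
      TensorProduct.map U.subtype W.subtype t := by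
    intro t
    induction t with
    | zero => simp only [map_zero]
    | add x y hx hy => simp only [map_add, hx, hy]
    | tmul u w =>
      have hw := hW w.2
      rw [TensorProduct.map_tmul, LinearMap.mul'_apply, Submodule.subtype_apply,
        Submodule.subtype_apply]
      generalize w.1 = w' at hw
      induction hw using Submodule.span_induction with
      | zero => rw [mul_zero, map_zero, TensorProduct.tmul_zero]
      | add x y _ _ hx hy => rw [mul_add, map_add, hx, hy, TensorProduct.tmul_add]
      | smul c x _ hx => rw [mul_smul_comm, map_smul, hx, TensorProduct.tmul_smul]
      | mem x hx =>
        obtain ⟨g, rfl⟩ := hx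
        simp only [F, LinearMap.comp_apply, AlgHom.toLinearMap_apply, LinearEquiv.coe_coe]
        rw [rightCoaction_mul_ofGroupLike (hU u.2), LinearMap.lTensor_tmul, comul_ofGroupLike,
          TensorProduct.assoc_symm_tmul, LinearMap.rTensor_tmul, LinearMap.comp_apply,
          LinearMap.lTensor_tmul, antipode_ofGroupLike, LinearMap.mul'_apply, mul_assoc,
          ofGroupLike_mul_inv, mul_one]
  intro s t hst
  apply map_injective_of_injective _ _ U.injective_subtype W.injective_subtype
  rw [← hF, ← hF t]
  exact congrArg F hst

/-! ### Primitive elements -/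

/-- As `π` is a coalgebra map, `S ∘ π` is a convolution inverse of `π`, so `Π * π = id * (S ∘ π) * π
= id`. -/
lemma toCoinvariants_mul_proj :
    WithConv.toConv (toCoinvariants k H) * WithConv.toConv (proj k H) =
      WithConv.toConv LinearMap.id := by
  have h := LinearMap.convMul_comp_coalgHom_distrib
    (WithConv.toConv (HopfAlgebra.antipode k (A := Gr k H)))
    (WithConv.toConv LinearMap.id) (projCoalgHom k H)
  rw [LinearMap.antipode_mul_id] at h
  have h2 : WithConv.toConv (HopfAlgebra.antipode k ∘ₗ proj k H) * WithConv.toConv (proj k H) =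
      1 := by
    apply WithConv.ext
    refine h.symm.trans ?_
    ext x
    change algebraMap k _ (Coalgebra.counit (R := k) (proj k H x)) = algebraMap k _ _
    rw [counit_proj]
  change WithConv.toConv LinearMap.id * WithConv.toConv (HopfAlgebra.antipode k ∘ₗ proj k H) *
    WithConv.toConv (proj k H) = _
  rw [mul_assoc, h2, mul_one]

/-- Coassociativity: both sides are `∑ f(x₁) g(x₂) ⊗ x₃`. For `f = Π` and `g = π` it recovers `Δ`
from `Δ_R` and the coaction. -/
lemma rTensor_convMul_comul (f g : WithConv (Gr k H →ₗ[k] Gr k H)) (x : Gr k H) :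
    (f * g).ofConv.rTensor (Gr k H) (Coalgebra.comul x) =
      (LinearMap.mul' k (Gr k H)).rTensor (Gr k H) ((TensorProduct.assoc k _ _ _).symm
        ((g.ofConv.rTensor (Gr k H) ∘ₗ Coalgebra.comul).lTensor (Gr k H)
          (f.ofConv.rTensor (Gr k H) (Coalgebra.comul x)))) := by
  have h1 : ∀ t : Gr k H ⊗[k] (Gr k H ⊗[k] Gr k H),
      (LinearMap.mul' k (Gr k H) ∘ₗ TensorProduct.map f.ofConv g.ofConv).rTensor (Gr k H)
        ((TensorProduct.assoc k _ _ _).symm t) =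
      (LinearMap.mul' k (Gr k H)).rTensor (Gr k H) ((TensorProduct.assoc k _ _ _).symm
        (TensorProduct.map f.ofConv (g.ofConv.rTensor (Gr k H)) t)) := by
    intro t
    induction t with
    | zero => simp
    | add x y hx hy => simp only [map_add, hx, hy]
    | tmul a t =>
      induction t with
      | zero => simp
      | add x y hx hy => simp only [TensorProduct.tmul_add, map_add, hx, hy]
      | tmul b c => simp
  have h2 := h1 (Coalgebra.comul.lTensor _ (Coalgebra.comul (R := k) x))
  rw [← Coalgebra.coassoc_apply, LinearEquiv.symm_apply_apply, ← LinearMap.comp_apply,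
    ← LinearMap.rTensor_comp] at h2
  refine h2.trans ?_
  rw [Coalgebra.coassoc_apply, ← LinearMap.comp_apply (TensorProduct.map _ _),
    LinearMap.map_comp_lTensor, ← LinearMap.comp_apply (LinearMap.lTensor _ _),
    LinearMap.lTensor_comp_rTensor]

lemma mul_rTensor_assoc_one (t : Gr k H ⊗[k] Gr k H) :
    (LinearMap.mul' k (Gr k H)).rTensor (Gr k H)
      ((TensorProduct.assoc k _ _ _).symm (1 ⊗ₜ t)) = t := by
  induction t with
  | zero => simp
  | add x y hx hy => rw [TensorProduct.tmul_add, map_add, map_add, hx, hy]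
  | tmul x y => simp

/-- As `Π * π = id`, the element `Δ(x)` is obtained from `Δ_R(x)` by applying `ρ` to the right
factor and multiplying the left factor into its first component. On `x ⊗ 1 + 1 ⊗ x` this yields `x ⊗
1 + ρ(x)`. -/
lemma comul_of_mem_primitives {x : Gr k H} (hx : x ∈ primitives k H) :
    Coalgebra.comul (R := k) x = x ⊗ₜ 1 + coaction k H x := by
  have h := rTensor_convMul_comul (WithConv.toConv (toCoinvariants k H))
    (WithConv.toConv (proj k H)) x
  have hx2 : (toCoinvariants k H).rTensor (Gr k H) (Coalgebra.comul x) = x ⊗ₜ 1 + 1 ⊗ₜ x := hx.2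
  rw [toCoinvariants_mul_proj] at h
  change LinearMap.id.rTensor (Gr k H) (Coalgebra.comul x) = _ at h
  rw [LinearMap.rTensor_id_apply] at h
  rw [h]
  change (LinearMap.mul' k (Gr k H)).rTensor (Gr k H) ((TensorProduct.assoc k _ _ _).symm
        ((coaction k H).lTensor (Gr k H)
          ((toCoinvariants k H).rTensor (Gr k H) (Coalgebra.comul x)))) = _
  rw [hx2, map_add, map_add, map_add, LinearMap.lTensor_tmul, LinearMap.lTensor_tmul,
    mul_rTensor_assoc_one]
  congr 1
  have : coaction k H 1 = 1 ⊗ₜ 1 := by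
    rw [coaction, LinearMap.comp_apply, Bialgebra.comul_one, Algebra.TensorProduct.one_def,
      LinearMap.rTensor_tmul, proj_one]
  rw [this]
  simp

/-- Since `ε ∘ π = ε`, the map `ε ⊗ id` takes equal values on `Δ(x)` and `ρ(x)`. Applied to `Δ(x) =
x ⊗ 1 + ρ(x)`, it leaves `ε(x) 1 = 0`. -/
lemma counit_of_mem_primitives {x : Gr k H} (hx : x ∈ primitives k H) :
    Coalgebra.counit (R := k) x = 0 := by
  have h := congrArg (Coalgebra.counit.rTensor (Gr k H)) (comul_of_mem_primitives hx)
  have h1 : Coalgebra.counit.rTensor (Gr k H) (coaction k H x) =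
      Coalgebra.counit.rTensor (Gr k H) (Coalgebra.comul x) := by
    rw [coaction, LinearMap.comp_apply, ← LinearMap.comp_apply (LinearMap.rTensor _ _),
      ← LinearMap.rTensor_comp]
    rw [show Coalgebra.counit (R := k) ∘ₗ proj k H = Coalgebra.counit from
      LinearMap.ext counit_proj]
  rw [map_add, h1, right_eq_add, LinearMap.rTensor_tmul] at h
  have h2 := congrArg (fun t => Coalgebra.counit (R := k) (TensorProduct.lid k _ t)) h
  simpa using h2

/-- Applying `ε ⊗ id` to the coinvariance `(id ⊗ π)Δ(x) = x ⊗ 1` gives `π(x) = ε(x) 1`, and the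
counit of a primitive element is zero. -/
lemma proj_of_mem_primitives {x : Gr k H} (hx : x ∈ primitives k H) : proj k H x = 0 := by
  have h := congrArg (Coalgebra.counit.rTensor (Gr k H)) (mem_coinvariants.1 hx.1)
  rw [rightCoaction_apply, ← LinearMap.comp_apply (LinearMap.rTensor _ _),
    LinearMap.rTensor_comp_lTensor, ← LinearMap.lTensor_comp_rTensor, LinearMap.comp_apply,
    Coalgebra.rTensor_counit_comul, LinearMap.rTensor_tmul, counit_of_mem_primitives hx] at h
  simpa using congrArg (TensorProduct.lid k _) h

/-- `corPre (i + j)` is the whole wedge of `corPre i` and `corPre j`, hence the full kernel of the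
map that `delta` factors. So a single bidegree of the comultiplication already determines a
homogeneous element of `gr H`. -/
lemma delta_injective (i j : ℕ) : Function.Injective (delta k H i j) := by
  rw [← LinearMap.ker_eq_bot]
  exact Submodule.ker_liftQ_eq_bot _ _ _ (corPre_add i j).ge

/-- The primitive elements of `R` have degree one. -/
lemma homog_of_mem_primitives {x : Gr k H} (hx : x ∈ primitives k H) : homog k H 1 x = x := by
  rw [← sub_eq_zero]
  apply eq_zero_of_comp
  intro i
  rw [map_sub, comp_homog]
  have hp : ∀ i, i ≠ 0 → ∀ x, comp k H i (proj k H x) = 0 := fun i hi x =>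
    (comp_homog i 0 x).trans (if_neg hi)
  -- Degree zero vanishes because `π(x) = 0`. In degree `n + 2` it suffices to look at `Δ(x)` in
  -- bidegree `(1, n + 1)`: there `x ⊗ 1` vanishes because its right factor has degree zero, and
  -- `ρ(x)` because its left factor does.
  match i with
  | 0 =>
    have h := comp_homog 0 0 x
    rw [if_pos rfl, show homog k H 0 x = 0 from proj_of_mem_primitives hx, map_zero] at h
    rw [if_neg (by omega), ← h, sub_zero]
  | 1 => simp
  | n + 2 =>
    rw [if_neg (by omega), zero_sub, neg_eq_zero]
    rw [show n + 2 = 1 + (n + 1) by omega]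
    apply delta_injective
    rw [← map_comp_comulGr, map_zero]
    change TensorProduct.map _ _ (Coalgebra.comul x) = 0
    rw [comul_of_mem_primitives hx, map_add, TensorProduct.map_tmul, ← cls_one, comp_cls,
      if_neg (by omega), TensorProduct.tmul_zero, zero_add, coaction, LinearMap.comp_apply,
      ← LinearMap.comp_apply, LinearMap.map_comp_rTensor]
    rw [show comp k H 1 ∘ₗ proj k H = 0 from LinearMap.ext (hp 1 one_ne_zero)]
    simp

end Hopf

end Gr

namespace Borel

variable {k : Type*} [Field k] {m : ℕ} (Q : QParam k m)

/-! ### The elements `x_s` -/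

lemma comul_x (s : Fin m) : Coalgebra.comul (R := k) (x Q s) =
    Gr.ofGroupLike (Kbar Q s) ⊗ₜ x Q s + x Q s ⊗ₜ 1 := by
  apply Gr.comulGr_of_lifts
  rw [comul_skewE]
  have h1 : ((Kbar Q s).val ⊗ₜ[k] skewE Q s, Gr.ofGroupLike (Kbar Q s) ⊗ₜ[k] x Q s) ∈
      Gr.lifts k (Borel Q) 1 :=
    Submodule.subset_span ⟨0, 1, (⟨(Kbar Q s).val, Submodule.subset_span (Kbar Q s).2⟩ :
      corFil k (Borel Q) 0), ⟨skewE Q s, E_mul_Kinv_mem Q s⟩, rfl, rfl⟩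
  have h2 : (skewE Q s ⊗ₜ[k] 1, x Q s ⊗ₜ[k] 1) ∈ Gr.lifts k (Borel Q) 1 :=
    Submodule.subset_span ⟨1, 0, ⟨skewE Q s, E_mul_Kinv_mem Q s⟩, ⟨1, one_mem_corFil⟩, rfl, rfl⟩
  exact add_mem h1 h2

lemma proj_x (s : Fin m) : Gr.proj k (Borel Q) (x Q s) = 0 := Gr.proj_cls_of_ne one_ne_zero _

lemma linearIndependent_x : LinearIndependent k (x Q) := by
  rw [Fintype.linearIndependent_iff]
  intro c hc
  apply eq_zero_of_sum_skewE_mem Q c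
  -- The degree-one component takes values modulo `corPre 1`, the group algebra, so a relation among
  -- the `x_s` puts the same combination of skew primitives into it.
  have h := congrArg (Gr.comp k (Borel Q) 1) hc
  have h1 : ∀ s, Gr.comp k (Borel Q) 1 (x Q s) = (corPre k (Borel Q) 1).mkQ (skewE Q s) :=
    fun s => (Gr.comp_cls 1 1 _).trans (if_pos rfl)
  simp only [map_sum, map_smul, h1, map_zero] at h
  rw [← Submodule.Quotient.mk_eq_zero, ← Submodule.mkQ_apply, map_sum]
  simp only [map_smul]
  exact h

lemma x_mem_coinvariants (s : Fin m) : x Q s ∈ Gr.coinvariants k (Borel Q) := by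
  rw [Gr.mem_coinvariants, Gr.rightCoaction_apply, comul_x, map_add, LinearMap.lTensor_tmul,
    LinearMap.lTensor_tmul, proj_x, Gr.proj_one, TensorProduct.tmul_zero, zero_add]

lemma x_mem_primitives (s : Fin m) : x Q s ∈ Gr.primitives k (Borel Q) := by
  refine ⟨x_mem_coinvariants Q s, ?_⟩
  change (Gr.toCoinvariants k (Borel Q)).rTensor _ (Coalgebra.comul (x Q s)) =
    x Q s ⊗ₜ 1 + 1 ⊗ₜ x Q s
  rw [comul_x, map_add, LinearMap.rTensor_tmul, LinearMap.rTensor_tmul,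
    Gr.toCoinvariants_ofGroupLike, Gr.toCoinvariants_of_mem (x_mem_coinvariants Q s), add_comm]

lemma V_le_primitives : V Q ≤ Gr.primitives k (Borel Q) :=
  Submodule.span_le.2 (Set.range_subset_iff.2 (x_mem_primitives Q))

lemma coaction_x (s : Fin m) : Gr.coaction k (Borel Q) (x Q s) =
    Gr.ofGroupLike (Kbar Q s) ⊗ₜ x Q s := by
  rw [Gr.coaction, LinearMap.comp_apply, comul_x, map_add, LinearMap.rTensor_tmul,
    LinearMap.rTensor_tmul, proj_x, Gr.proj_ofGroupLike, TensorProduct.zero_tmul, add_zero]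

/-! ### The adjoint action and the braiding -/

variable {Q} in
lemma ofGroupLike_mul_x {g : GroupLike k (Borel Q)} {s : Fin m} {c : k}
    (h : g.val * skewE Q s = c • (skewE Q s * g.val)) :
    Gr.ofGroupLike g * x Q s = c • (x Q s * Gr.ofGroupLike g) := by
  have hg : g.val ∈ corFil k (Borel Q) 0 := Submodule.subset_span g.2
  have h1 : Gr.ofGroupLike g * x Q s = Gr.cls k (Borel Q) 1
      ⟨g.val * skewE Q s, mul_mem_corFil hg (E_mul_Kinv_mem Q s)⟩ :=
    (Gr.cls_mul (⟨g.val, hg⟩ : corFil k (Borel Q) 0) ⟨_, E_mul_Kinv_mem Q s⟩).trans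
      (Gr.cls_congr (zero_add 1) rfl)
  have h2 : x Q s * Gr.ofGroupLike g = Gr.cls k (Borel Q) 1
      ⟨skewE Q s * g.val, mul_mem_corFil (E_mul_Kinv_mem Q s) hg⟩ :=
    (Gr.cls_mul ⟨_, E_mul_Kinv_mem Q s⟩ (⟨g.val, hg⟩ : corFil k (Borel Q) 0)).trans
      (Gr.cls_congr (add_zero 1) rfl)
  rw [h1, h2, ← map_smul]
  exact Gr.cls_congr rfl h

variable {Q} in
lemma adjoint_x {g : GroupLike k (Borel Q)} {s : Fin m} {c : k}
    (h : g.val * skewE Q s = c • (skewE Q s * g.val)) :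
    Gr.adjoint k (Borel Q) (Gr.ofGroupLike g) (x Q s) = c • x Q s := by
  rw [Gr.adjoint_ofGroupLike, ofGroupLike_mul_x h, smul_mul_assoc, mul_assoc,
    Gr.ofGroupLike_mul_inv, mul_one]

variable {Q} in
lemma adjoint_ofGroupLike_mem_V {g : GroupLike k (Borel Q)} (hg : g ∈ SLG Q)
    {v : Gr k (Borel Q)} (hv : v ∈ V Q) :
    Gr.adjoint k (Borel Q) (Gr.ofGroupLike g) v ∈ V Q := by
  induction hv using Submodule.span_induction with
  | zero => rw [map_zero]; exact zero_mem _
  | add x y _ _ hx hy => rw [map_add]; exact add_mem hx hy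
  | smul c x _ hx => rw [map_smul]; exact Submodule.smul_mem _ c hx
  | mem v hv =>
    obtain ⟨s, rfl⟩ := hv
    obtain ⟨c, -, hc⟩ := exists_SLG_mul_skewE Q hg s
    rw [adjoint_x hc]
    exact Submodule.smul_mem _ c (Submodule.subset_span ⟨s, rfl⟩)

lemma adjoint_mem_V {h : Gr k (Borel Q)} (hh : h ∈ kSLG Q) {v : Gr k (Borel Q)} (hv : v ∈ V Q) :
    Gr.adjoint k (Borel Q) h v ∈ V Q := by
  induction hh using Submodule.span_induction with
  | zero => rw [map_zero]; exact zero_mem _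
  | add x y _ _ hx hy => rw [map_add]; exact add_mem hx hy
  | smul c x _ hx => rw [map_smul]; exact Submodule.smul_mem _ c hx
  | mem g hg =>
    obtain ⟨g, hg, rfl⟩ := hg
    exact adjoint_ofGroupLike_mem_V hg hv

lemma braiding_x (i j : Fin m) : Gr.braiding k (Borel Q) (x Q i ⊗ₜ x Q j) =
    Q.braidCoeff i j • (x Q j ⊗ₜ x Q i) := by
  rw [Gr.braiding, LinearMap.comp_apply, LinearMap.comp_apply, LinearMap.rTensor_tmul, coaction_x,
    LinearEquiv.coe_coe, TensorProduct.rightComm_tmul, LinearMap.rTensor_tmul,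
    TensorProduct.lift.tmul, adjoint_x (Kbar_mul_skewE Q i j), TensorProduct.smul_tmul']

/-! ### The subalgebra generated by `V` and `SLG` -/

/-- Coinvariants are the equalizer of two algebra maps, so it is enough that the generators in `V`
are coinvariant. -/
lemma nichols_le_coinvariants :
    Subalgebra.toSubmodule (nichols Q) ≤ Gr.coinvariants k (Borel Q) := by
  have h : nichols Q ≤ Gr.coinvariantsSubalgebra k (Borel Q) :=
    Algebra.adjoin_le fun v hv => (V_le_primitives Q hv).1
  exact h

lemma kSLG_le : kSLG Q ≤ Submodule.span k (Set.range Gr.ofGroupLike) :=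
  Submodule.span_mono (Set.image_subset_range _ _)

lemma nichols_le_bosonization : nichols Q ≤ bosonization Q :=
  Algebra.adjoin_mono Set.subset_union_left

variable {Q} in
lemma ofGroupLike_mem_bosonization {g : GroupLike k (Borel Q)} (hg : g ∈ SLG Q) :
    Gr.ofGroupLike g ∈ bosonization Q :=
  Algebra.subset_adjoin (Or.inr ⟨g, hg, rfl⟩)

variable {Q} in
lemma V_le_bosonization {v : Gr k (Borel Q)} (hv : v ∈ V Q) : v ∈ bosonization Q :=
  Algebra.subset_adjoin (Or.inl hv)

lemma kSLG_le_bosonization : kSLG Q ≤ Subalgebra.toSubmodule (bosonization Q) :=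
  Submodule.span_le.2 (Set.image_subset_iff.2 fun _ hg => ofGroupLike_mem_bosonization hg)

variable {Q} in
/-- `B(V)` is stable under conjugation by `SLG`. -/
lemma conj_mem_nichols {g : GroupLike k (Borel Q)} (hg : g ∈ SLG Q) {y : Gr k (Borel Q)}
    (hy : y ∈ nichols Q) : Gr.ofGroupLike g * y * Gr.ofGroupLike g⁻¹ ∈ nichols Q := by
  induction hy using Algebra.adjoin_induction with
  | mem v hv =>
    rw [← Gr.adjoint_ofGroupLike]
    exact Algebra.subset_adjoin (adjoint_ofGroupLike_mem_V hg hv)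
  | algebraMap c =>
    rw [← Algebra.commutes, mul_assoc, Gr.ofGroupLike_mul_inv, mul_one]
    exact Subalgebra.algebraMap_mem _ c
  | add y z _ _ hy hz => rw [mul_add, add_mul]; exact add_mem hy hz
  | mul y z _ _ hy hz =>
    have h : Gr.ofGroupLike g * (y * z) * Gr.ofGroupLike g⁻¹ =
        (Gr.ofGroupLike g * y * Gr.ofGroupLike g⁻¹) *
          (Gr.ofGroupLike g * z * Gr.ofGroupLike g⁻¹) := by
      simp only [mul_assoc]
      rw [← mul_assoc (Gr.ofGroupLike g⁻¹) (Gr.ofGroupLike g), Gr.ofGroupLike_inv_mul, one_mul]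
    rw [h]
    exact mul_mem hy hz

lemma one_mem_kSLG : 1 ∈ kSLG Q := Submodule.subset_span ⟨1, one_mem _, Gr.ofGroupLike_one⟩

variable {Q} in
lemma ofGroupLike_mul_mem {g : GroupLike k (Borel Q)} (hg : g ∈ SLG Q) {y : Gr k (Borel Q)}
    (hy : y ∈ Subalgebra.toSubmodule (nichols Q) * kSLG Q) :
    Gr.ofGroupLike g * y ∈ Subalgebra.toSubmodule (nichols Q) * kSLG Q := by
  induction hy using Submodule.mul_induction_on' with
  | add y _ z _ hy hz => rw [mul_add]; exact add_mem hy hz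
  | mem_mul_mem y hy h hh =>
    induction hh using Submodule.span_induction with
    | zero => rw [mul_zero, mul_zero]; exact zero_mem _
    | add a b _ _ ha hb => rw [mul_add, mul_add]; exact add_mem ha hb
    | smul c a _ ha => rw [mul_smul_comm, mul_smul_comm]; exact Submodule.smul_mem _ c ha
    | mem h hh =>
      obtain ⟨h, hh, rfl⟩ := hh
      -- Straightening: `g (y h) = (g y g⁻¹)(g h)`, with the first factor again in `B(V)`.
      have e : Gr.ofGroupLike g * (y * Gr.ofGroupLike h) =
          (Gr.ofGroupLike g * y * Gr.ofGroupLike g⁻¹) * Gr.ofGroupLike (g * h) := by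
        rw [Gr.ofGroupLike_mul, ← mul_assoc, mul_assoc _ (Gr.ofGroupLike g⁻¹),
          ← mul_assoc (Gr.ofGroupLike g⁻¹), Gr.ofGroupLike_inv_mul, one_mul]
      rw [e]
      exact Submodule.mul_mem_mul (conj_mem_nichols hg hy)
        (Submodule.subset_span ⟨_, mul_mem hg hh, rfl⟩)

lemma nichols_mul_kSLG : Subalgebra.toSubmodule (nichols Q) * kSLG Q =
    Subalgebra.toSubmodule (bosonization Q) := by
  apply le_antisymm
  · refine Submodule.mul_le.2 fun y hy h hh => ?_
    exact (bosonization Q).mul_mem (nichols_le_bosonization Q hy) (kSLG_le_bosonization Q hh)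
  -- `B(V) · kSLG` contains `1` and is stable under left multiplication by the generators `V` and
  -- `SLG`, so it contains everything they generate. This avoids checking that it is a subalgebra.
  · have key : ∀ y ∈ bosonization Q, ∀ z ∈ Subalgebra.toSubmodule (nichols Q) * kSLG Q,
        y * z ∈ Subalgebra.toSubmodule (nichols Q) * kSLG Q := by
      intro y hy
      induction hy using Algebra.adjoin_induction with
      | algebraMap c =>
        intro z hz
        rw [← Algebra.smul_def]
        exact Submodule.smul_mem _ c hz
      | add a b _ _ ha hb =>
        intro z hz
        rw [add_mul]
        exact add_mem (ha z hz) (hb z hz)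
      | mul a b _ _ ha hb =>
        intro z hz
        rw [mul_assoc]
        exact ha _ (hb z hz)
      | mem y hy =>
        intro z hz
        rcases hy with hy | ⟨g, hg, rfl⟩
        · have h := Submodule.mul_mem_mul (M := Subalgebra.toSubmodule (nichols Q))
            (show y ∈ Subalgebra.toSubmodule (nichols Q) from Algebra.subset_adjoin hy) hz
          rwa [← mul_assoc, (Subalgebra.isIdempotentElem_toSubmodule _).eq] at h
        · exact ofGroupLike_mul_mem hg hz
    intro y hy
    have h1 := Submodule.mul_mem_mul (M := Subalgebra.toSubmodule (nichols Q)) (one_mem (nichols Q))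
      (one_mem_kSLG Q)
    rw [one_mul] at h1
    simpa using key y hy 1 h1

/-! ### The Hopf subalgebra `B(V) # kSLG` -/

lemma isSubcoalgebra_bosonization :
    IsSubcoalgebra (Subalgebra.toSubmodule (bosonization Q)) := by
  -- The preimage under `Δ` of the image of `A ⊗ A`, where `A` is the generated algebra, is a
  -- subalgebra, so only the generators have to be tested.
  have h : bosonization Q ≤ (Algebra.TensorProduct.map (bosonization Q).val
      (bosonization Q).val).range.comap (Bialgebra.comulAlgHom k (Gr k (Borel Q))) := by
    have hx : ∀ v ∈ V Q, v ∈ (Algebra.TensorProduct.map (bosonization Q).val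
        (bosonization Q).val).range.comap (Bialgebra.comulAlgHom k (Gr k (Borel Q))) := by
      intro v hv
      induction hv using Submodule.span_induction with
      | zero => exact zero_mem _
      | add x y _ _ hx hy => exact add_mem hx hy
      | smul c x _ hx => exact Subalgebra.smul_mem _ hx c
      | mem v hv =>
        obtain ⟨s, rfl⟩ := hv
        have h1 : x Q s ∈ bosonization Q := V_le_bosonization (Submodule.subset_span ⟨s, rfl⟩)
        have h2 : Gr.ofGroupLike (Kbar Q s) ∈ bosonization Q :=
          ofGroupLike_mem_bosonization (Subgroup.subset_closure ⟨s, rfl⟩)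
        exact ⟨⟨_, h2⟩ ⊗ₜ ⟨_, h1⟩ + ⟨_, h1⟩ ⊗ₜ 1, (comul_x Q s).symm⟩
    refine Algebra.adjoin_le ?_
    rintro y (hy | ⟨g, hg, rfl⟩)
    · exact hx y hy
    · exact ⟨⟨_, ofGroupLike_mem_bosonization hg⟩ ⊗ₜ ⟨_, ofGroupLike_mem_bosonization hg⟩,
        (Gr.comul_ofGroupLike g).symm⟩
  intro y hy
  exact h hy

/-- Apply `S * id = ε` to `Δ(x_s) = K̄_s ⊗ x_s + x_s ⊗ 1`, using `ε(x_s) = 0`. -/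
lemma antipode_x (s : Fin m) : HopfAlgebra.antipode k (x Q s) =
    -(Gr.ofGroupLike (Kbar Q s)⁻¹ * x Q s) := by
  have h := HopfAlgebra.mul_antipode_rTensor_comul_apply (R := k) (x Q s)
  have hε : Coalgebra.counit (R := k) (x Q s) = 0 := Gr.counit_cls_pos one_ne_zero _
  rw [hε, comul_x, map_add, LinearMap.rTensor_tmul, LinearMap.rTensor_tmul, map_add,
    LinearMap.mul'_apply, LinearMap.mul'_apply, Gr.antipode_ofGroupLike, mul_one, map_zero] at h
  exact eq_neg_of_add_eq_zero_right h

lemma antipode_mem_bosonization {y : Gr k (Borel Q)} (hy : y ∈ bosonization Q) :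
    HopfAlgebra.antipode k y ∈ bosonization Q := by
  induction hy using Algebra.adjoin_induction with
  | algebraMap c =>
    rw [Algebra.algebraMap_eq_smul_one, map_smul, HopfAlgebra.antipode_one]
    exact Subalgebra.smul_mem _ (one_mem _) c
  | add a b _ _ ha hb => rw [map_add]; exact add_mem ha hb
  | mul a b _ _ ha hb =>
    rw [HopfAlgebra.antipode_mul_antidistrib]
    exact mul_mem hb ha
  | mem y hy =>
    rcases hy with hy | ⟨g, hg, rfl⟩
    · change y ∈ V Q at hy
      induction hy using Submodule.span_induction with
      | zero => rw [map_zero]; exact zero_mem _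
      | add x y _ _ hx hy => rw [map_add]; exact add_mem hx hy
      | smul c x _ hx => rw [map_smul]; exact Subalgebra.smul_mem _ hx c
      | mem v hv =>
        obtain ⟨s, rfl⟩ := hv
        rw [antipode_x]
        exact neg_mem (mul_mem
          (ofGroupLike_mem_bosonization (inv_mem (Subgroup.subset_closure ⟨s, rfl⟩)))
          (V_le_bosonization (Submodule.subset_span ⟨s, rfl⟩)))
    · rw [Gr.antipode_ofGroupLike]
      exact ofGroupLike_mem_bosonization (inv_mem hg)

lemma isHopfSubalgebra_bosonization : IsHopfSubalgebra (bosonization Q) :=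
  ⟨isSubcoalgebra_bosonization Q, fun _ => antipode_mem_bosonization Q⟩

/-! ### Coinvariants and primitive elements of `B(V) # kSLG` -/

lemma bosonization_inf_coinvariants :
    Subalgebra.toSubmodule (bosonization Q) ⊓ Gr.coinvariants k (Borel Q) =
      Subalgebra.toSubmodule (nichols Q) := by
  apply le_antisymm
  · rintro y ⟨hy, hyR⟩
    -- `Π` fixes coinvariants, so it is enough that `Π` maps `B(V) · kSLG` into `B(V)`; indeed
    -- `Π(yg) = y` for `y` in `B(V)`.
    rw [← Gr.toCoinvariants_of_mem hyR]
    clear hyR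
    rw [SetLike.mem_coe, ← nichols_mul_kSLG] at hy
    induction hy using Submodule.mul_induction_on' with
    | add y _ z _ hy hz => rw [map_add]; exact add_mem hy hz
    | mem_mul_mem y hy h hh =>
      induction hh using Submodule.span_induction with
      | zero => rw [mul_zero, map_zero]; exact zero_mem _
      | add a b _ _ ha hb => rw [mul_add, map_add]; exact add_mem ha hb
      | smul c a _ ha => rw [mul_smul_comm, map_smul]; exact Submodule.smul_mem _ c ha
      | mem h hh =>
        obtain ⟨g, -, rfl⟩ := hh
        rwa [Gr.toCoinvariants_mul_ofGroupLike (nichols_le_coinvariants Q hy)]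
  · exact le_inf (nichols_le_bosonization Q) (nichols_le_coinvariants Q)

/-- The component of degree one of `B(V)` is `V`. -/
lemma homog_of_mem_nichols {y : Gr k (Borel Q)} (hy : y ∈ nichols Q) :
    (∃ c : k, Gr.homog k (Borel Q) 0 y = algebraMap k _ c) ∧ Gr.homog k (Borel Q) 1 y ∈ V Q := by
  have h01 : ∀ c : k, Gr.homog k (Borel Q) 0 (algebraMap k _ c) = algebraMap k _ c := fun c => by
    rw [Algebra.algebraMap_eq_smul_one, map_smul]
    exact congrArg _ Gr.proj_one
  -- Both claims must be carried together: the degree-one part of `ab` is `a₁ b₀ + a₀ b₁`, which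
  -- stays in `V` because `a₀` and `b₀` are scalars.
  induction hy using Algebra.adjoin_induction with
  | mem v hv =>
    have h1 : Gr.homog k (Borel Q) 0 v = 0 := Gr.proj_of_mem_primitives (V_le_primitives Q hv)
    refine ⟨⟨0, by rw [h1, map_zero]⟩, ?_⟩
    rw [Gr.homog_of_mem_primitives (V_le_primitives Q hv)]
    exact hv
  | algebraMap c =>
    refine ⟨⟨c, h01 c⟩, ?_⟩
    rw [Algebra.algebraMap_eq_smul_one, map_smul, ← Gr.cls_one, Gr.homog_cls_of_ne one_ne_zero,
      smul_zero]
    exact zero_mem _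
  | add a b _ _ ha hb =>
    obtain ⟨⟨c, hc⟩, ha⟩ := ha
    obtain ⟨⟨d, hd⟩, hb⟩ := hb
    refine ⟨⟨c + d, by rw [map_add, hc, hd, map_add]⟩, ?_⟩
    rw [map_add]
    exact add_mem ha hb
  | mul a b _ _ ha hb =>
    obtain ⟨⟨c, hc⟩, ha⟩ := ha
    obtain ⟨⟨d, hd⟩, hb⟩ := hb
    refine ⟨⟨c * d, ?_⟩, ?_⟩
    · rw [RingHom.map_mul, ← hc, ← hd]
      exact Gr.proj_mul a b
    · rw [Gr.homog_one_mul, hc, hd, ← Algebra.commutes, ← Algebra.smul_def, ← Algebra.smul_def]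
      exact add_mem (Submodule.smul_mem _ d ha) (Submodule.smul_mem _ c hb)

/-- A primitive element of `R` equals its degree-one part, and the degree-one part of an element of
`B(V)` lies in `V`. -/
lemma nichols_inf_primitives :
    Subalgebra.toSubmodule (nichols Q) ⊓ Gr.primitives k (Borel Q) = V Q := by
  apply le_antisymm
  · rintro y ⟨hy, hyP⟩
    rw [← Gr.homog_of_mem_primitives hyP]
    exact (homog_of_mem_nichols Q hy).2
  · exact le_inf (fun _ hv => Algebra.subset_adjoin hv) (V_le_primitives Q)

end Borel

end QuantumGL

/-! ### Assembly of the four claims -/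

theorem proposition2p1 {k : Type*} [Field k] [IsAlgClosed k] [CharZero k] {m : ℕ}
    (Q : QuantumGL.QParam k m) :
    -- `B^l` is pointed, so that `gr B^l` is the associated graded of the coradical filtration
    QuantumGL.IsPointed k (QuantumGL.Borel Q) ∧
    -- the `x_s` form a basis of `V`, which consists of primitive elements of `R`
    LinearIndependent k (QuantumGL.Borel.x Q) ∧
    QuantumGL.Borel.V Q ≤ QuantumGL.Gr.primitives k (QuantumGL.Borel Q) ∧
    -- `V` is a Yetter-Drinfeld module over `k SLG`
    (∀ s, QuantumGL.Gr.coaction k (QuantumGL.Borel Q) (QuantumGL.Borel.x Q s) =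
      QuantumGL.Gr.ofGroupLike (QuantumGL.Borel.Kbar Q s) ⊗ₜ[k] QuantumGL.Borel.x Q s) ∧
    (∀ h ∈ QuantumGL.Borel.kSLG Q, ∀ v ∈ QuantumGL.Borel.V Q,
      QuantumGL.Gr.adjoint k (QuantumGL.Borel Q) h v ∈ QuantumGL.Borel.V Q) ∧
    -- `B(V) # k SLG` is a Hopf subalgebra of `gr B^l`, and it is the product of `B(V)` and `k SLG`
    QuantumGL.IsHopfSubalgebra (QuantumGL.Borel.bosonization Q) ∧
    Function.Injective (LinearMap.mul' k (QuantumGL.Gr k (QuantumGL.Borel Q)) ∘ₗ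
      TensorProduct.map (Subalgebra.toSubmodule (QuantumGL.Borel.nichols Q)).subtype
        (QuantumGL.Borel.kSLG Q).subtype) ∧
    Subalgebra.toSubmodule (QuantumGL.Borel.nichols Q) * QuantumGL.Borel.kSLG Q =
      Subalgebra.toSubmodule (QuantumGL.Borel.bosonization Q) ∧
    -- `B(V)` is the algebra of coinvariants of `B(V) # k SLG`, and `V` is its space of primitives
    Subalgebra.toSubmodule (QuantumGL.Borel.bosonization Q) ⊓
        QuantumGL.Gr.coinvariants k (QuantumGL.Borel Q) =
      Subalgebra.toSubmodule (QuantumGL.Borel.nichols Q) ∧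
    Subalgebra.toSubmodule (QuantumGL.Borel.nichols Q) ⊓
        QuantumGL.Gr.primitives k (QuantumGL.Borel Q) = QuantumGL.Borel.V Q ∧
    -- the braiding of `V` is diagonal, of Cartan type
    ∃ l : Fin m → Fin m → k,
      (∀ i j, QuantumGL.Gr.braiding k (QuantumGL.Borel Q)
          (QuantumGL.Borel.x Q i ⊗ₜ[k] QuantumGL.Borel.x Q j) =
        l i j • (QuantumGL.Borel.x Q j ⊗ₜ[k] QuantumGL.Borel.x Q i)) ∧
      (∀ i, l i i = Q.r⁻¹) ∧
      (∀ i, l i i * l i i = Q.r ^ (-2 : ℤ)) ∧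
      (∀ i j : Fin m, i.val + 1 = j.val ∨ j.val + 1 = i.val → l i j * l j i = Q.r) ∧
      (∀ i j : Fin m, i.val + 1 < j.val ∨ j.val + 1 < i.val → l i j * l j i = 1) ∧
      (∀ i j, l i j * l j i = l i i ^ CartanMatrix.A m i j) ∧
      QuantumGL.IsCartanFLType l (CartanMatrix.A m) :=
  ⟨QuantumGL.Borel.isPointed Q, QuantumGL.Borel.linearIndependent_x Q,
    QuantumGL.Borel.V_le_primitives Q, QuantumGL.Borel.coaction_x Q,
    fun _ hh _ hv => QuantumGL.Borel.adjoint_mem_V Q hh hv,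
    QuantumGL.Borel.isHopfSubalgebra_bosonization Q,
    QuantumGL.Gr.mul_injective_of_coinvariants (QuantumGL.Borel.nichols_le_coinvariants Q)
      (QuantumGL.Borel.kSLG_le Q),
    QuantumGL.Borel.nichols_mul_kSLG Q, QuantumGL.Borel.bosonization_inf_coinvariants Q,
    QuantumGL.Borel.nichols_inf_primitives Q, Q.braidCoeff, QuantumGL.Borel.braiding_x Q,
    QuantumGL.Borel.braidCoeff_self Q,
    fun i => by
      rw [QuantumGL.Borel.braidCoeff_self, zpow_neg, zpow_ofNat, sq, mul_inv],
    fun _ _ => QuantumGL.Borel.braidCoeff_adjacent Q,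
    fun _ _ => QuantumGL.Borel.braidCoeff_distant Q,
    fun i j => by
      rw [QuantumGL.Borel.braidCoeff_self, QuantumGL.Borel.braidCoeff_cartan],
    QuantumGL.Borel.isCartanFLType_braidCoeff Q⟩
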